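/- **Setting.** Fix an alphabet $\Sigma$ and variables $V=\{v_1,v_2,\dots\}$. A *prechart* is a set $Q$ of states with, for each $q\in Q$, a finite set $D(q)\subseteq\Sigma\times Q$ of transitions and a finite set $E(q)\subseteq V$ of outputs; put $\beta(q)=D(q)+E(q)\subseteq \Sigma\times Q+V$. A *finite chart* is a prechart on a finite set with a start node $s$. Let $\Omega$ be the set of finite charts modulo strong bisimilarity, itself a prechart by $[(Q,s,D,E)]\xrightarrow{a}[(Q,s',D,E)]$ for $(a,s')\in D(s)$ and by outputting $E(s)$. On charts, and hence on $\Omega$, one has the empty chart $0$, variables $v$, prefixing $a.C$, choice $C_1+C_2$, simultaneous substitution $C[\vec C/\vec v]$ and recursion $\mu v.C$ (Milner's operations). *Behavioural distance.* For a $1$-bounded pseudometric $d$ on $Q$ let $d^{\uparrow}$ be the pseudometric on $\Sigma\times Q+V$ with $d^\uparrow((a,x),(a,y))=\tfrac12d(x,y)$, $d^\uparrow(m,m)=0$, and $d^\uparrow(m,n)=1$ in all other cases, and let $\mathcal H$ be the Hausdorff lifting to finite subsets (with $\sup\emptyset=0$, $\inf\emptyset=1$). Then $\mathsf{bd}$ is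 the least fixpoint of $\Phi(d)(x,y)=\mathcal H(d^\uparrow)(\beta(x),\beta(y))$ in the complete lattice of $1$-bounded pseudometrics on the prechart $\Omega$. *$\mathsf{RegBeh}$.* Let $\Omega(n)\subseteq\Omega$ consist of the behaviours whose live (reachable-output) variables lie in $\{v_1,\dots,v_n\}$, and let $\mathsf{RegBeh}(m,n)=\Omega(n)^m$, with $f;g=(f_i[\vec g/\vec v])_i$, identities $(v_1,\dots,v_n)$, pairing $\langle f,g\rangle$ given by concatenation of tuples, $f\oplus g$ given by concatenation after shifting the variables of $g$, symmetries $\sigma$ given by permuting variables, and $d^{m,n}(f,g)=\max_{i}\mathsf{bd}(f_i,g_i)$ ($=0$ if $m=0$). The dagger of $f:1\to p+1$ is $f^\dagger=\mu v_{p+1}.f$; it extends to $f:n\to p+n$ by $f^\dagger=0_p$ (the empty tuple) for $n=0$ and $\langle g,f\rangle^\dagger=\langle h^\dagger,\ f^\dagger;\langle \mathrm{id}_p,h^\dagger\rangle\rangle$ with $h=g;\langle\mathrm{id}_{p+1},f^\dagger\rangle$, for $g:1\to p+1+n$ and $f:n\to p+1+n$. The trace of $g:p+n\to q+n$ consists of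 the first $p$ components of $\big(g;\langle (v_1,\dots,v_q),(v_{q+p+1},\dots,v_{q+p+n})\rangle\big)^\dagger$. *$\mathsf{Int}(\mathsf{RegBeh})$.* Objects are pairs $(A^+,A^-)\in\mathbb N^2$. A morphism $(A^+,A^-)\to(B^+,B^-)$ is an element of $\mathsf{RegBeh}(A^++B^-,A^-+B^+)$, and the distance of two morphisms is their distance there. Identities and symmetries are the evident symmetries, $f\otimes g$ is $f\oplus g$ conjugated by the middle-block exchanges, and $f;g=\mathsf{Tr}^{B^-+B^+}(\alpha;(f\oplus g);\beta)$ with $\alpha:A^+C^-B^-B^+\to A^+B^-B^+C^-$ and $\beta:A^-B^+B^-C^+\to A^-C^+B^-B^+$ the reorderings. Put $(A^+,A^-)^*=(A^-,A^+)$; the unit $\eta_{(A^+,A^-)}:(0,0)\to(A^+,A^-)\otimes(A^+,A^-)^*$ and the counit $\epsilon_{(A^+,A^-)}:(A^+,A^-)^*\otimes(A^+,A^-)\to(0,0)$ are both $\sigma_{A^-,A^+}$. Let $N$ send $f:m\to n$ to $f:(m,0)\to(n,0)$. *Diagrams.* $\mathsf{Syn}$ is the free prop (coloured, strict symmetric monoidal;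 terms modulo the axioms of strict symmetric monoidal categories) on two generating objects $\blacktriangleleft,\blacktriangleright$ and generators $\mathsf{copy}:\blacktriangleright\to\blacktriangleright\blacktriangleright$, $\mathsf{del}:\blacktriangleright\to\epsilon$, $\mathsf{merge}:\blacktriangleright\blacktriangleright\to\blacktriangleright$, $\mathsf{gen}:\epsilon\to\blacktriangleright$, $\mathsf{cap}:\blacktriangleleft\blacktriangleright\to\epsilon$, $\mathsf{cup}:\epsilon\to\blacktriangleright\blacktriangleleft$, and $\mathsf{act}_a:\blacktriangleright\to\blacktriangleright$ $(a\in\Sigma)$. The semantics $\llbracket-\rrbracket:\mathsf{Syn}\to\mathsf{Int}(\mathsf{RegBeh})$ is the symmetric monoidal functor with $\llbracket\blacktriangleright\rrbracket=(1,0)$, $\llbracket\blacktriangleleft\rrbracket=(0,1)$ and $$\mathsf{copy}\mapsto N(v_1+v_2),\quad \mathsf{del}\mapsto N(0),\quad \mathsf{merge}\mapsto N(v_1,v_1),\quad \mathsf{gen}\mapsto N(()),\quad \mathsf{act}_a\mapsto N(a.v_1),\quad \mathsf{cap}\mapsto\epsilon_{(1,0)},\quad \mathsf{cup}\mapsto\eta_{(1,0)}.$$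 *Equational theory.* $=$ is the least congruence (for $;$ and $\oplus$) on the morphisms of $\mathsf{Syn}$ containing, with $\sigma$ the crossing of two wires and identities on the evident wires: - (A1) $(\mathsf{cup}\oplus\mathrm{id}_\blacktriangleright);(\mathrm{id}_\blacktriangleright\oplus\mathsf{cap})=\mathrm{id}_\blacktriangleright$; (A2) $(\mathrm{id}_\blacktriangleleft\oplus\mathsf{cup});(\mathsf{cap}\oplus\mathrm{id}_\blacktriangleleft)=\mathrm{id}_\blacktriangleleft$; - (B1) $\mathsf{copy};(\mathsf{copy}\oplus\mathrm{id})=\mathsf{copy};(\mathrm{id}\oplus\mathsf{copy})$; (B2) $\mathsf{copy};(\mathrm{id}\oplus\mathsf{del})=\mathrm{id}$; (B3) $\mathsf{copy};\sigma=\mathsf{copy}$; - (B4) $(\mathsf{merge}\oplus\mathrm{id});\mathsf{merge}=(\mathrm{id}\oplus\mathsf{merge});\mathsf{merge}$; (B5) $(\mathrm{id}\oplus\mathsf{gen});\mathsf{merge}=\mathrm{id}$; (B6) $\sigma;\mathsf{merge}=\mathsf{merge}$; - (B7) $\mathsf{merge};\mathsf{copy}=(\mathsf{copy}\oplus\mathsf{copy});(\mathrm{id}\oplus\sigma\oplus\mathrm{id});(\mathsf{merge}\oplus\mathsf{merge})$;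 (B8) $\mathsf{merge};\mathsf{del}=\mathsf{del}\oplus\mathsf{del}$; (B9) $\mathsf{gen};\mathsf{copy}=\mathsf{gen}\oplus\mathsf{gen}$; - (B10) $\mathsf{copy};\mathsf{merge}=\mathrm{id}$; (B11) $(\mathrm{id}_\blacktriangleright\oplus\mathsf{cup});((\mathsf{merge};\mathsf{copy})\oplus\mathrm{id}_\blacktriangleleft);(\mathrm{id}_\blacktriangleright\oplus(\sigma;\mathsf{cap}))=\mathrm{id}_\blacktriangleright$; - (C1) $\mathsf{merge};\mathsf{act}_a=(\mathsf{act}_a\oplus\mathsf{act}_a);\mathsf{merge}$ for $a\in\Sigma$. *Quantitative theory.* The derivable equations $f=_\varepsilon g$ (with $f,g$ parallel morphisms of $\mathsf{Syn}$ and $\varepsilon\in\mathbb Q_{\ge0}$) form the least set closed under: - (Pref) from $f=_\varepsilon g$, $f,g:\blacktriangleright^m\to\blacktriangleright^n$, and $a_1,\dots,a_m\in\Sigma$ infer $(\bigoplus_i\mathsf{act}_{a_i});f=_{\varepsilon/2}(\bigoplus_i\mathsf{act}_{a_i});g$; - (Max) from $f=_\varepsilon g$ and $\varepsilon'\ge\varepsilon$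 infer $f=_{\varepsilon'}g$; (Refl) from $f=g$ infer $f=_0g$; (Sym) from $f=_\varepsilon g$ infer $g=_\varepsilon f$; - (Cont) from $f=_{\varepsilon'}g$ for all rational $\varepsilon'>\varepsilon$ infer $f=_\varepsilon g$; (Triang) from $f=_{\varepsilon_1}g$ and $g=_{\varepsilon_2}h$ infer $f=_{\varepsilon_1+\varepsilon_2}h$; - (Seq) from $f=_{\varepsilon_1}h$ and $g=_{\varepsilon_2}i$ infer $f;g=_{\max\{\varepsilon_1,\varepsilon_2\}}h;i$; (Top) $f=_1g$ for all parallel $f,g$; - (Tens) from $f_1=_{\varepsilon_1}g_1$ and $f_2=_{\varepsilon_2}g_2$ infer $f_1\oplus f_2=_{\max\{\varepsilon_1,\varepsilon_2\}}g_1\oplus g_2$; - (Codel) $\mathsf{gen}^{\oplus n}=_0\mathsf{gen}^{\oplus m};d$ for every $d:\blacktriangleright^m\to\blacktriangleright^n$. **Theorem (Quantitative soundness).** The semantics is well defined, i.e. the morphism computed from a term depends only on the string diagram that the term represents; and every derivable equation $f=_\varepsilon g$ between string diagrams $f,g:v\to w$ is valid: the distance between $\llbracket f\rrbracket$ and $\llbracket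 g\rrbracket$ in $\mathsf{Int}(\mathsf{RegBeh})(\llbracket v\rrbracket,\llbracket w\rrbracket)$ satisfies $d(\llbracket f\rrbracket,\llbracket g\rrbracket)\le\varepsilon$. -/

import Mathlib

/-! # Precharts, charts and bisimilarity

`A` is the alphabet of letters. The variables `v₁, v₂, …` are the natural numbers, `v_{i+1}` being
`i`; hence `V_n = {v₁, …, v_n}` is `{i | i < n}`. -/

/-- A (finitely branching) prechart with set of states `Q`: labelled transitions and outputs. -/
structure Prechart (A : Type*) (Q : Type*) where
  trans : Q → Finset (A × Q)
  out : Q → Finset ℕ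

namespace Prechart

/-- The combined transition function `Q → P_fin (A × Q + V)`. -/
def beta {A Q : Type*} (P : Prechart A Q) (q : Q) : Finset (A × Q ⊕ ℕ) :=
  (P.trans q).disjSum (P.out q)

/-- Strong bisimulations between two precharts. -/
structure IsBisim {A Q₁ Q₂ : Type*} (P₁ : Prechart A Q₁) (P₂ : Prechart A Q₂)
    (R : Q₁ → Q₂ → Prop) : Prop where
  out_eq : ∀ q₁ q₂, R q₁ q₂ → P₁.out q₁ = P₂.out q₂
  forth : ∀ q₁ q₂, R q₁ q₂ → ∀ a q₁', (a, q₁') ∈ P₁.trans q₁ →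
    ∃ q₂', (a, q₂') ∈ P₂.trans q₂ ∧ R q₁' q₂'
  back : ∀ q₁ q₂, R q₁ q₂ → ∀ a q₂', (a, q₂') ∈ P₂.trans q₂ →
    ∃ q₁', (a, q₁') ∈ P₁.trans q₁ ∧ R q₁' q₂'

/-- `P.Reach q q'`: there is a path of transitions from `q` to `q'`. -/
def Reach {A Q : Type*} (P : Prechart A Q) : Q → Q → Prop :=
  Relation.ReflTransGen fun q q' => ∃ a, (a, q') ∈ P.trans q

/-- The variable `v` is live at the state `q`. -/
def Live {A Q : Type*} (P : Prechart A Q) (q : Q) (v : ℕ) : Prop :=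
  ∃ q', P.Reach q q' ∧ v ∈ P.out q'

open Classical in
/-- The prechart underlying `C[(D₁, …, D_n) / (v₁, …, v_n)]`; `s i` is the start node of `D i`. -/
noncomputable def subst {A Q : Type*} (P : Prechart A Q) {n : ℕ} {S : Fin n → Type*}
    (D : ∀ i, Prechart A (S i)) (s : ∀ i, S i) : Prechart A (Q ⊕ (Σ i, S i)) where
  trans q := match q with
    | .inl q => (P.trans q).image (Prod.map id Sum.inl) ∪
        (Finset.univ.filter fun i : Fin n => (i : ℕ) ∈ P.out q).biUnion fun i =>
          ((D i).trans (s i)).image (Prod.map id fun p => Sum.inr ⟨i, p⟩)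
    | .inr ⟨i, p⟩ => ((D i).trans p).image (Prod.map id fun p' => Sum.inr ⟨i, p'⟩)
  out q := match q with
    | .inl q => (P.out q).filter (fun v => n ≤ v) ∪
        (Finset.univ.filter fun i : Fin n => (i : ℕ) ∈ P.out q).biUnion fun i => (D i).out (s i)
    | .inr ⟨i, p⟩ => (D i).out p

open Classical in
/-- The prechart underlying `μ v. C`, where `s` is the start node of `C`. -/
noncomputable def mu {A Q : Type*} (v : ℕ) (P : Prechart A Q) (s : Q) : Prechart A Q where
  trans q := if v ∈ P.out q then P.trans q ∪ P.trans s else P.trans q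
  out q := if v ∈ P.out q then (P.out q ∪ P.out s).erase v else P.out q

theorem mem_subst_inl {A Q : Type*} {P : Prechart A Q} {n : ℕ} {S : Fin n → Type*}
    {D : ∀ i, Prechart A (S i)} {s : ∀ i, S i} {a : A} {q : Q} {x : Q ⊕ (Σ i, S i)} :
    (a, x) ∈ (P.subst D s).trans (.inl q) ↔ (∃ p, (a, p) ∈ P.trans q ∧ x = .inl p) ∨
      ∃ i : Fin n, (i : ℕ) ∈ P.out q ∧ ∃ p, (a, p) ∈ (D i).trans (s i) ∧ x = .inr ⟨i, p⟩ := by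
  simp only [subst, Finset.mem_union, Finset.mem_image, Finset.mem_biUnion,
    Finset.mem_filter, Finset.mem_univ, true_and, Prod.exists, Prod.map_apply, id,
    Prod.mk.injEq]
  constructor
  · rintro (⟨b, p, hp, rfl, rfl⟩ | ⟨i, hi, b, p, hp, rfl, rfl⟩)
    · exact Or.inl ⟨p, hp, rfl⟩
    · exact Or.inr ⟨i, hi, p, hp, rfl⟩
  · rintro (⟨p, hp, rfl⟩ | ⟨i, hi, p, hp, rfl⟩)
    · exact Or.inl ⟨a, p, hp, rfl, rfl⟩
    · exact Or.inr ⟨i, hi, a, p, hp, rfl, rfl⟩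

theorem mem_subst_inr {A Q : Type*} {P : Prechart A Q} {n : ℕ} {S : Fin n → Type*}
    {D : ∀ i, Prechart A (S i)} {s : ∀ i, S i} {a : A} {i : Fin n} {q : S i}
    {x : Q ⊕ (Σ i, S i)} :
    (a, x) ∈ (P.subst D s).trans (.inr ⟨i, q⟩) ↔
      ∃ p, (a, p) ∈ (D i).trans q ∧ x = .inr ⟨i, p⟩ := by
  simp only [subst, Finset.mem_image, Prod.exists, Prod.map_apply, id, Prod.mk.injEq]
  constructor
  · rintro ⟨b, p, hp, rfl, rfl⟩
    exact ⟨p, hp, rfl⟩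
  · rintro ⟨p, hp, rfl⟩
    exact ⟨a, p, hp, rfl, rfl⟩

theorem mem_mu {A Q : Type*} {P : Prechart A Q} {v : ℕ} {s q : Q} {x : A × Q} :
    x ∈ (P.mu v s).trans q ↔ x ∈ P.trans q ∨ (v ∈ P.out q ∧ x ∈ P.trans s) := by
  simp only [mu]
  split_ifs with h <;> simp [h]

theorem IsBisim.refl {A Q : Type*} (P : Prechart A Q) : IsBisim P P Eq where
  out_eq := by rintro q _ rfl; rfl
  forth := by rintro q _ rfl a q' h; exact ⟨q', h, rfl⟩
  back := by rintro q _ rfl a q' h; exact ⟨q', h, rfl⟩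

theorem IsBisim.symm {A Q₁ Q₂ : Type*} {P₁ : Prechart A Q₁} {P₂ : Prechart A Q₂}
    {R : Q₁ → Q₂ → Prop} (h : IsBisim P₁ P₂ R) : IsBisim P₂ P₁ (fun x y => R y x) where
  out_eq := fun _ _ r => (h.out_eq _ _ r).symm
  forth := fun _ _ r => h.back _ _ r
  back := fun _ _ r => h.forth _ _ r

theorem IsBisim.trans {A Q₁ Q₂ Q₃ : Type*} {P₁ : Prechart A Q₁} {P₂ : Prechart A Q₂}
    {P₃ : Prechart A Q₃} {R : Q₁ → Q₂ → Prop} {S : Q₂ → Q₃ → Prop}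
    (h : IsBisim P₁ P₂ R) (k : IsBisim P₂ P₃ S) :
    IsBisim P₁ P₃ (fun x z => ∃ y, R x y ∧ S y z) where
  out_eq := by
    rintro x z ⟨y, r, s⟩
    exact (h.out_eq _ _ r).trans (k.out_eq _ _ s)
  forth := by
    rintro x z ⟨y, r, s⟩ a x' hx
    obtain ⟨y', hy, r'⟩ := h.forth _ _ r _ _ hx
    obtain ⟨z', hz, s'⟩ := k.forth _ _ s _ _ hy
    exact ⟨z', hz, y', r', s'⟩
  back := by
    rintro x z ⟨y, r, s⟩ a z' hz
    obtain ⟨y', hy, s'⟩ := k.back _ _ s _ _ hz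
    obtain ⟨x', hx, r'⟩ := h.back _ _ r _ _ hy
    exact ⟨x', hx, y', r', s'⟩

theorem IsBisim.live {A Q₁ Q₂ : Type*} {P₁ : Prechart A Q₁} {P₂ : Prechart A Q₂}
    {R : Q₁ → Q₂ → Prop} (h : IsBisim P₁ P₂ R) {q₁ : Q₁} {q₂ : Q₂} (r : R q₁ q₂) {v : ℕ}
    (hv : P₁.Live q₁ v) : P₂.Live q₂ v := by
  obtain ⟨q', hr, ho⟩ := hv
  have key : ∃ p', P₂.Reach q₂ p' ∧ R q' p' := by
    clear ho
    induction hr with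
    | refl => exact ⟨q₂, Relation.ReflTransGen.refl, r⟩
    | tail _ hstep ih =>
      obtain ⟨p', hp, rp⟩ := ih
      obtain ⟨a, ha⟩ := hstep
      obtain ⟨p'', hp'', rp''⟩ := h.forth _ _ rp _ _ ha
      exact ⟨p'', hp.tail ⟨a, hp''⟩, rp''⟩
  obtain ⟨p', hp, rp⟩ := key
  exact ⟨p', hp, h.out_eq _ _ rp ▸ ho⟩

end Prechart

/-- Finite charts. -/
structure Chart (A : Type*) where
  State : Type
  finite : Finite State
  pre : Prechart A State
  start : State

namespace Chart

variable {A : Type*}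

/-- Bisimilarity of charts. -/
def Bisimilar (C D : Chart A) : Prop :=
  ∃ R : C.State → D.State → Prop, C.pre.IsBisim D.pre R ∧ R C.start D.start

instance setoid (A : Type*) : Setoid (Chart A) where
  r := Bisimilar
  iseqv :=
    { refl := fun _ => ⟨Eq, .refl _, rfl⟩
      symm := fun ⟨_, h, s⟩ => ⟨_, h.symm, s⟩
      trans := fun ⟨_, h, s⟩ ⟨_, k, t⟩ => ⟨_, h.trans k, _, s, t⟩ }

/-- The same prechart with another start node. -/
def at' (C : Chart A) (q : C.State) : Chart A := { C with start := q }

def Live (C : Chart A) (v : ℕ) : Prop := C.pre.Live C.start v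

/-- The empty chart `0`. -/
def zero : Chart A where
  State := Unit
  finite := inferInstance
  pre := { trans := fun _ => ∅, out := fun _ => ∅ }
  start := ()

/-- The chart of a variable. -/
def var (v : ℕ) : Chart A where
  State := Unit
  finite := inferInstance
  pre := { trans := fun _ => ∅, out := fun _ => {v} }
  start := ()

open Classical in
/-- Prefix `a.C`; the new start node is `none`. -/
noncomputable def pref (a : A) (C : Chart A) : Chart A where
  State := Option C.State
  finite := by have := C.finite; infer_instance
  pre :=
    { trans := fun q => match q with
        | none => {(a, some C.start)}
        | some q => (C.pre.trans q).image (Prod.map id some)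
      out := fun q => match q with
        | none => ∅
        | some q => C.pre.out q }
  start := none

open Classical in
/-- Nondeterministic choice `C + D`; the new start node is `none`. -/
noncomputable def sum (C D : Chart A) : Chart A where
  State := Option (C.State ⊕ D.State)
  finite := by have := C.finite; have := D.finite; infer_instance
  pre :=
    { trans := fun q => match q with
        | none => (C.pre.trans C.start).image (Prod.map id (some ∘ Sum.inl)) ∪
            (D.pre.trans D.start).image (Prod.map id (some ∘ Sum.inr))
        | some (.inl q) => (C.pre.trans q).image (Prod.map id (some ∘ Sum.inl))
        | some (.inr q) => (D.pre.trans q).image (Prod.map id (some ∘ Sum.inr))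
      out := fun q => match q with
        | none => C.pre.out C.start ∪ D.pre.out D.start
        | some (.inl q) => C.pre.out q
        | some (.inr q) => D.pre.out q }
  start := none

/-- Simultaneous substitution `C[(D₁, …, D_n) / (v₁, …, v_n)]`. -/
noncomputable def subst (C : Chart A) {n : ℕ} (D : Fin n → Chart A) : Chart A where
  State := C.State ⊕ (Σ i, (D i).State)
  finite := by
    have := C.finite
    have := fun i => (D i).finite
    infer_instance
  pre := C.pre.subst (fun i => (D i).pre) fun i => (D i).start
  start := .inl C.start

/-- Recursion `μ v. C`. -/
noncomputable def mu (v : ℕ) (C : Chart A) : Chart A where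
  State := C.State
  finite := C.finite
  pre := C.pre.mu v C.start
  start := C.start

theorem Bisimilar.live {C D : Chart A} (h : Bisimilar C D) (v : ℕ) : C.Live v ↔ D.Live v := by
  obtain ⟨R, hR, s⟩ := h
  exact ⟨fun hv => hR.live s hv, fun hv => hR.symm.live s hv⟩

theorem subst_congr {C C' : Chart A} (h : Bisimilar C C') {n : ℕ} {D D' : Fin n → Chart A}
    (k : ∀ i, Bisimilar (D i) (D' i)) : Bisimilar (C.subst D) (C'.subst D') := by
  obtain ⟨R, hR, s⟩ := h
  choose S hS t using k
  have gen : ∀ {C C' : Chart A} {D D' : Fin n → Chart A} {R : C.State → C'.State → Prop}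
      {S : ∀ i, (D i).State → (D' i).State → Prop}, C.pre.IsBisim C'.pre R →
      (∀ i, (D i).pre.IsBisim (D' i).pre (S i)) → (∀ i, S i (D i).start (D' i).start) →
      ∀ q₁ q₂, Sum.LiftRel R (fun x y : Σ i, _ => ∃ i p p', x = ⟨i, p⟩ ∧ y = ⟨i, p'⟩ ∧ S i p p')
        q₁ q₂ → ∀ a q₁', (a, q₁') ∈ (C.subst D).pre.trans q₁ →
      ∃ q₂', (a, q₂') ∈ (C'.subst D').pre.trans q₂ ∧
        Sum.LiftRel R (fun x y : Σ i, _ => ∃ i p p', x = ⟨i, p⟩ ∧ y = ⟨i, p'⟩ ∧ S i p p')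
          q₁' q₂' := by
    intro C C' D D' R S hR hS t q₁ q₂ hq a q₁' h₁
    cases hq with
    | inl r =>
      rcases Prechart.mem_subst_inl.1 h₁ with ⟨p, hp, rfl⟩ | ⟨i, hi, p, hp, rfl⟩
      · obtain ⟨p', hp', r'⟩ := hR.forth _ _ r _ _ hp
        exact ⟨.inl p', Prechart.mem_subst_inl.2 (Or.inl ⟨_, hp', rfl⟩), .inl r'⟩
      · obtain ⟨p', hp', r'⟩ := (hS i).forth _ _ (t i) _ _ hp
        exact ⟨.inr ⟨i, p'⟩,
          Prechart.mem_subst_inl.2 (Or.inr ⟨i, hR.out_eq _ _ r ▸ hi, _, hp', rfl⟩),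
          .inr ⟨i, p, p', rfl, rfl, r'⟩⟩
    | inr r =>
      obtain ⟨i, p, p', rfl, rfl, r⟩ := r
      obtain ⟨p₁, hp, rfl⟩ := Prechart.mem_subst_inr.1 h₁
      obtain ⟨p₂, hp', r'⟩ := (hS i).forth _ _ r _ _ hp
      exact ⟨.inr ⟨i, p₂⟩, Prechart.mem_subst_inr.2 ⟨_, hp', rfl⟩, .inr ⟨i, _, _, rfl, rfl, r'⟩⟩
  refine ⟨Sum.LiftRel R (fun x y => ∃ i p p', x = ⟨i, p⟩ ∧ y = ⟨i, p'⟩ ∧ S i p p'),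
    ⟨?_, ?_, ?_⟩, .inl s⟩
  · intro q₁ q₂ hq
    cases hq with
    | inl r =>
      simp only [subst, Prechart.subst, hR.out_eq _ _ r]
      congr 1
      exact Finset.biUnion_congr rfl fun i _ => (hS i).out_eq _ _ (t i)
    | inr r =>
      obtain ⟨i, p, p', rfl, rfl, r⟩ := r
      exact (hS i).out_eq _ _ r
  · exact gen hR hS t
  · intro q₁ q₂ hq a q₂' h₂
    have hq' : Sum.LiftRel (fun x y => R y x)
        (fun x y : Σ i, _ => ∃ i p p', x = ⟨i, p⟩ ∧ y = ⟨i, p'⟩ ∧ S i p' p) q₂ q₁ := by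
      cases hq with
      | inl r => exact .inl r
      | inr r =>
        obtain ⟨i, p, p', rfl, rfl, r⟩ := r
        exact .inr ⟨i, p', p, rfl, rfl, r⟩
    obtain ⟨q₁', h₁, hr⟩ := gen (R := fun x y => R y x) (S := fun i x y => S i y x)
      hR.symm (fun i => (hS i).symm) t q₂ q₁ hq' a q₂' h₂
    refine ⟨q₁', h₁, ?_⟩
    cases hr with
    | inl r => exact .inl r
    | inr r =>
      obtain ⟨i, p, p', rfl, rfl, r⟩ := r
      exact .inr ⟨i, p', p, rfl, rfl, r⟩

theorem mu_congr (v : ℕ) {C D : Chart A} (h : Bisimilar C D) :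
    Bisimilar (mu v C) (mu v D) := by
  obtain ⟨R, hR, s⟩ := h
  have gen : ∀ {C D : Chart A} {R : C.State → D.State → Prop}, C.pre.IsBisim D.pre R →
      R C.start D.start → ∀ q₁ q₂, R q₁ q₂ → ∀ a q₁', (a, q₁') ∈ (mu v C).pre.trans q₁ →
      ∃ q₂', (a, q₂') ∈ (mu v D).pre.trans q₂ ∧ R q₁' q₂' := by
    intro C D R hR s q₁ q₂ r a q₁' h₁
    rcases Prechart.mem_mu.1 h₁ with h₁ | ⟨hv, h₁⟩
    · obtain ⟨q₂', h₂, r'⟩ := hR.forth _ _ r _ _ h₁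
      exact ⟨q₂', Prechart.mem_mu.2 (Or.inl h₂), r'⟩
    · obtain ⟨q₂', h₂, r'⟩ := hR.forth _ _ s _ _ h₁
      exact ⟨q₂', Prechart.mem_mu.2 (Or.inr ⟨hR.out_eq _ _ r ▸ hv, h₂⟩), r'⟩
  refine ⟨R, ⟨?_, gen hR s, fun q₁ q₂ r => gen hR.symm s q₂ q₁ r⟩, s⟩
  intro q₁ q₂ r
  simp only [mu, Prechart.mu, hR.out_eq _ _ r, hR.out_eq _ _ s]

theorem live_subst {C : Chart A} {n : ℕ} {D : Fin n → Chart A} {v : ℕ}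
    (h : (C.subst D).Live v) : (C.Live v ∧ n ≤ v) ∨ ∃ i, (D i).Live v := by
  obtain ⟨q', hr, ho⟩ := h
  have key : (∃ q, q' = .inl q ∧ C.pre.Reach C.start q) ∨
      ∃ i p, q' = .inr ⟨i, p⟩ ∧ (D i).pre.Reach (D i).start p := by
    clear ho
    induction hr with
    | refl => exact Or.inl ⟨_, rfl, Relation.ReflTransGen.refl⟩
    | tail _ hstep ih =>
      obtain ⟨a, ha⟩ := hstep
      rcases ih with ⟨q, rfl, hq⟩ | ⟨i, p, rfl, hp⟩
      · rcases Prechart.mem_subst_inl.1 ha with ⟨p, hp, rfl⟩ | ⟨i, hi, p, hp, rfl⟩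
        · exact Or.inl ⟨p, rfl, hq.tail ⟨_, hp⟩⟩
        · exact Or.inr ⟨i, p, rfl, Relation.ReflTransGen.single ⟨_, hp⟩⟩
      · obtain ⟨p₁, hp₁, rfl⟩ := Prechart.mem_subst_inr.1 ha
        exact Or.inr ⟨i, p₁, rfl, hp.tail ⟨_, hp₁⟩⟩
  rcases key with ⟨q, rfl, hq⟩ | ⟨i, p, rfl, hp⟩
  · simp only [subst, Prechart.subst, Finset.mem_union, Finset.mem_biUnion, Finset.mem_filter,
      Finset.mem_univ, true_and] at ho
    rcases ho with ⟨ho, hn⟩ | ⟨i, _, ho⟩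
    · exact Or.inl ⟨⟨q, hq, ho⟩, hn⟩
    · exact Or.inr ⟨i, _, Relation.ReflTransGen.refl, ho⟩
  · exact Or.inr ⟨i, p, hp, ho⟩

theorem live_mu {C : Chart A} {w v : ℕ} (h : (mu w C).Live v) : C.Live v ∧ v ≠ w := by
  obtain ⟨q', hr, ho⟩ := h
  have key : C.pre.Reach C.start q' := by
    clear ho
    induction hr with
    | refl => exact Relation.ReflTransGen.refl
    | tail _ hstep ih =>
      obtain ⟨a, ha⟩ := hstep
      rcases Prechart.mem_mu.1 ha with ha | ⟨_, ha⟩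
      · exact ih.tail ⟨a, ha⟩
      · exact Relation.ReflTransGen.single ⟨a, ha⟩
  simp only [mu, Prechart.mu] at ho
  split_ifs at ho with hv
  · obtain ⟨hne, ho⟩ := Finset.mem_erase.1 ho
    rcases Finset.mem_union.1 ho with ho | ho
    · exact ⟨⟨q', key, ho⟩, hne⟩
    · exact ⟨⟨_, Relation.ReflTransGen.refl, ho⟩, hne⟩
  · exact ⟨⟨q', key, ho⟩, fun e => hv (e ▸ ho)⟩

end Chart

/-! # Regular behaviours -/

/-- The set `Ω` of regular behaviours: finite charts modulo bisimilarity. -/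
def Beh (A : Type*) := Quotient (Chart.setoid A)

namespace Beh

variable {A : Type*}

/-- The class of a finite chart. -/
def mk (C : Chart A) : Beh A := Quotient.mk _ C

def Live (x : Beh A) (v : ℕ) : Prop :=
  Quotient.lift (fun C : Chart A => C.Live v) (fun _ _ h => propext (Chart.Bisimilar.live h v)) x

/-- Substitution on regular behaviours; see `subst_mk`. -/
noncomputable def subst (x : Beh A) {n : ℕ} (g : Fin n → Beh A) : Beh A :=
  Quotient.map (fun C => C.subst fun i => Quotient.out (g i))
    (fun _ _ h => Chart.subst_congr h fun _ => (Chart.setoid A).refl _) x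

theorem subst_mk (C : Chart A) {n : ℕ} (D : Fin n → Chart A) :
    (mk C).subst (fun i => mk (D i)) = mk (C.subst D) :=
  Quotient.sound (Chart.subst_congr ((Chart.setoid A).refl _) fun i => Quotient.mk_out (s := Chart.setoid A) (D i))

/-- Recursion on regular behaviours. -/
noncomputable def mu (v : ℕ) (x : Beh A) : Beh A :=
  Quotient.map (Chart.mu v) (fun _ _ h => Chart.mu_congr v h) x

theorem live_subst {x : Beh A} {n : ℕ} {g : Fin n → Beh A} {v : ℕ}
    (h : (x.subst g).Live v) : (x.Live v ∧ n ≤ v) ∨ ∃ i, (g i).Live v := by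
  induction x using Quotient.inductionOn with
  | h C =>
    rcases Chart.live_subst (C := C) h with h | ⟨i, h⟩
    · exact Or.inl h
    · refine Or.inr ⟨i, ?_⟩
      have := Quotient.out_eq (g i)
      rw [← this]
      exact h

theorem live_mu {x : Beh A} {w v : ℕ} (h : (mu w x).Live v) : x.Live v ∧ v ≠ w := by
  induction x using Quotient.inductionOn with
  | h C => exact Chart.live_mu (C := C) h

open Classical in
/-- The prechart structure on `Ω`: `[(Q, s, D, E)]` has an `a`-transition to `[(Q, s', D, E)]`
whenever `s` has one to `s'`, and outputs what `s` outputs. -/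
noncomputable def prechart (A : Type*) : Prechart A (Beh A) where
  trans := Quotient.lift
    (fun C : Chart A => (C.pre.trans C.start).image (Prod.map id fun q => mk (C.at' q))) (by
      have gen : ∀ {C D : Chart A} {R : C.State → D.State → Prop}, C.pre.IsBisim D.pre R →
          R C.start D.start →
          (C.pre.trans C.start).image (Prod.map id fun q => mk (C.at' q)) ⊆
            (D.pre.trans D.start).image (Prod.map id fun q => mk (D.at' q)) := by
        intro C D R hR s x hx
        simp only [Finset.mem_image, Prod.exists, Prod.map_apply, id] at hx ⊢
        obtain ⟨a, q, hq, rfl⟩ := hx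
        obtain ⟨q', hq', r⟩ := hR.forth _ _ s _ _ hq
        refine ⟨a, q', hq', ?_⟩
        exact congrArg (Prod.mk a) (Quotient.sound ⟨_, hR.symm, r⟩)
      rintro C D ⟨R, hR, s⟩
      exact Finset.Subset.antisymm (gen hR s) (gen hR.symm s))
  out := Quotient.lift (fun C : Chart A => C.pre.out C.start)
    (fun _ _ ⟨_, hR, s⟩ => hR.out_eq _ _ s)

end Beh

/-! # Pseudometrics and the behavioural distance -/

/-- `1`-bounded pseudometrics on `X`. -/
@[ext] structure PMet (X : Type*) where
  d : X → X → unitInterval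
  refl : ∀ x, d x x = 0
  symm : ∀ x y, d x y = d y x
  tri : ∀ x y z, (d x z : ℝ) ≤ d x y + d y z

namespace PMet

instance (X : Type*) : PartialOrder (PMet X) := PartialOrder.lift PMet.d fun _ _ => PMet.ext

/-- Suprema of pseudometrics are computed pointwise. -/
noncomputable instance (X : Type*) : SupSet (PMet X) where
  sSup S :=
    { d := fun x y => ⨆ δ : S, δ.1.d x y
      refl := fun x => by
        apply le_antisymm _ bot_le
        exact iSup_le fun δ => (δ.1.refl x).le
      symm := fun x y => by simp only [fun δ : S => δ.1.symm x y]
      tri := fun x y z => by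
        have : ∀ x y, ∀ δ : S, (δ.1.d x y : ℝ) ≤ (⨆ δ : S, δ.1.d x y : unitInterval) :=
          fun x y δ => Subtype.coe_le_coe.2 (le_iSup (fun δ : S => δ.1.d x y) δ)
        have h0 : (0 : ℝ) ≤ (⨆ δ : S, δ.1.d x y : unitInterval) +
            (⨆ δ : S, δ.1.d y z : unitInterval) := 
          add_nonneg unitInterval.nonneg' unitInterval.nonneg'
        rcases isEmpty_or_nonempty S with hS | hS
        · simp
        · rw [Set.Icc.coe_iSup zero_le_one]
          exact ciSup_le fun δ => (δ.1.tri x y z).trans (add_le_add (this x y δ) (this y z δ)) }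

noncomputable instance (X : Type*) : CompleteLattice (PMet X) :=
  completeLatticeOfSup _ fun S =>
    ⟨fun δ h x y => le_iSup (fun δ : S => δ.1.d x y) ⟨δ, h⟩,
      fun _ h x y => iSup_le fun δ => h δ.2 x y⟩

open Classical in
/-- The lifting `d↑` of a pseudometric to transitions and outputs. -/
noncomputable def lift {A X : Type*} (δ : PMet X) : PMet (A × X ⊕ ℕ) where
  d m n := match m, n with
    | .inl (a, x), .inl (b, y) =>
        if a = b then ⟨1 / 2, by norm_num, by norm_num⟩ * δ.d x y else 1
    | .inr v, .inr w => if v = w then 0 else 1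
    | _, _ => 1
  refl m := by
    rcases m with ⟨a, x⟩ | v <;> simp [δ.refl]
  symm m n := by
    rcases m with ⟨a, x⟩ | v <;> rcases n with ⟨b, y⟩ | w
    · simp only [δ.symm x y, eq_comm]
    · rfl
    · rfl
    · simp only [eq_comm]
  tri m n k := by
    have one : ∀ u w : unitInterval, (u : ℝ) ≤ 1 + w := fun u w => by
      linarith [unitInterval.le_one u, unitInterval.nonneg w]
    have one' : ∀ u w : unitInterval, (u : ℝ) ≤ w + 1 := fun u w => by
      linarith [unitInterval.le_one u, unitInterval.nonneg w]
    rcases m with ⟨a, x⟩ | v <;> rcases n with ⟨b, y⟩ | w <;> rcases k with ⟨c, z⟩ | u <;>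
      simp only [Set.Icc.coe_one] <;>
      try first
        | exact one _ 1
        | exact one _ _
        | exact one' _ _
        | exact le_add_of_nonneg_right (unitInterval.nonneg _)
        | exact le_add_of_nonneg_left (unitInterval.nonneg _)
    · by_cases h : a = b
      · by_cases h' : b = c
        · subst h h'
          have := δ.tri x y z
          simp only [if_true, Set.Icc.coe_mul]
          linarith
        · simpa only [if_neg h', Set.Icc.coe_one] using one' _ _
      · simpa only [if_neg h, Set.Icc.coe_one] using one _ _
    · by_cases h : v = w
      · subst h
        simp
      · simpa only [if_neg h, Set.Icc.coe_one] using one _ _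

/-- The Hausdorff lifting; here `sup ∅ = 0` and `inf ∅ = 1`. -/
noncomputable def hausdorff {X : Type*} (δ : PMet X) : PMet (Finset X) where
  d S T := max (S.sup fun x => T.inf fun y => δ.d x y) (T.sup fun y => S.inf fun x => δ.d y x)
  refl S := by
    have : (S.sup fun x => S.inf fun y => δ.d x y) ≤ 0 :=
      Finset.sup_le fun x hx => (Finset.inf_le hx).trans (δ.refl x).le
    exact le_antisymm (max_le this this) bot_le
  symm S T := max_comm _ _
  tri S T U := by
    have key : ∀ S T U : Finset X,
        ((S.sup fun x => U.inf fun y => δ.d x y : unitInterval) : ℝ) ≤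
          (S.sup fun x => T.inf fun y => δ.d x y : unitInterval) +
            (T.sup fun x => U.inf fun y => δ.d x y : unitInterval) := by
      intro S T U
      have split : ∀ (S T : Finset X) (x : X), x ∈ S →
          (∃ y ∈ T, δ.d x y ≤ S.sup fun x => T.inf fun y => δ.d x y) ∨
            (S.sup fun x => T.inf fun y => δ.d x y) = 1 := by
        intro S T x hx
        have hle : (T.inf fun y => δ.d x y) ≤ S.sup fun x => T.inf fun y => δ.d x y :=
          Finset.le_sup (f := fun x => T.inf fun y => δ.d x y) hx
        rcases T.eq_empty_or_nonempty with rfl | hT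
        · exact Or.inr (top_le_iff.1 hle)
        · obtain ⟨y, hy, e⟩ := Finset.exists_mem_eq_inf T hT fun y => δ.d x y
          exact Or.inl ⟨y, hy, e ▸ hle⟩
      by_contra hlt
      push Not at hlt
      have hlt' : ∃ x ∈ S, ((S.sup fun x => T.inf fun y => δ.d x y : unitInterval) : ℝ) +
            (T.sup fun x => U.inf fun y => δ.d x y : unitInterval) <
              (U.inf fun y => δ.d x y : unitInterval) := by
        by_contra hno
        push Not at hno
        rcases S.eq_empty_or_nonempty with rfl | hS
        · have h0 : ((∅ : Finset X).sup fun x => U.inf fun y => δ.d x y) = (0 : unitInterval) :=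
            rfl
          rw [h0] at hlt
          exact absurd hlt (not_lt.2
            (add_nonneg unitInterval.nonneg' unitInterval.nonneg'))
        · obtain ⟨x, hx, e⟩ := Finset.exists_mem_eq_sup S hS fun x => U.inf fun y => δ.d x y
          rw [e] at hlt
          exact absurd hlt (not_lt.2 (hno x hx))
      obtain ⟨x, hx, h⟩ := hlt'
      have h1 : ((U.inf fun y => δ.d x y : unitInterval) : ℝ) ≤ 1 := unitInterval.le_one'
      have hn1 : (0 : ℝ) ≤ (S.sup fun x => T.inf fun y => δ.d x y : unitInterval) :=
        unitInterval.nonneg'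
      have hn2 : (0 : ℝ) ≤ (T.sup fun x => U.inf fun y => δ.d x y : unitInterval) :=
        unitInterval.nonneg'
      rcases split S T x hx with ⟨y, hy, hxy⟩ | e
      · rcases split T U y hy with ⟨z, hz, hyz⟩ | e
        · have h2 : (U.inf fun y => δ.d x y) ≤ δ.d x z := Finset.inf_le hz
          have h3 := δ.tri x y z
          have h2' := Subtype.coe_le_coe.2 h2
          have hxy' := Subtype.coe_le_coe.2 hxy
          have hyz' := Subtype.coe_le_coe.2 hyz
          linarith
        · rw [e, Set.Icc.coe_one] at h
          linarith
      · rw [e, Set.Icc.coe_one] at h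
        linarith
    have h1 := key S T U
    have h2 := key U T S
    rcases max_choice (S.sup fun x => U.inf fun y => δ.d x y)
      (U.sup fun y => S.inf fun x => δ.d y x) with e | e <;> rw [e]
    · exact h1.trans (add_le_add (Subtype.coe_le_coe.2 (le_max_left _ _))
        (Subtype.coe_le_coe.2 (le_max_left _ _)))
    · rw [add_comm] at h2
      exact h2.trans (add_le_add (Subtype.coe_le_coe.2 (le_max_right _ _))
        (Subtype.coe_le_coe.2 (le_max_right _ _)))

/-- The pseudometric `Φ_β(d)` on the states of a prechart. -/
noncomputable def step {A Q : Type*} (P : Prechart A Q) (δ : PMet Q) : PMet Q where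
  d x y := (hausdorff (lift δ)).d (P.beta x) (P.beta y)
  refl _ := (hausdorff (lift δ)).refl _
  symm _ _ := (hausdorff (lift δ)).symm _ _
  tri _ _ _ := (hausdorff (lift δ)).tri _ _ _

theorem step_mono {A Q : Type*} (P : Prechart A Q) : Monotone (step P) := by
  intro δ δ' h x y
  have hl : ∀ m n, (lift (A := A) δ).d m n ≤ (lift δ').d m n := by
    rintro (⟨a, x⟩ | v) (⟨b, y⟩ | w) <;> simp only [lift, le_refl]
    split_ifs
    · exact mul_le_mul_right (h x y) _
    · exact le_rfl
  exact max_le_max (Finset.sup_mono_fun fun m _ => Finset.inf_mono_fun fun n _ => hl m n)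
    (Finset.sup_mono_fun fun m _ => Finset.inf_mono_fun fun n _ => hl m n)

/-- The behavioural distance of a prechart: the least fixpoint of `Φ_β`. -/
noncomputable def bd {A Q : Type*} (P : Prechart A Q) : PMet Q :=
  OrderHom.lfp ⟨step P, step_mono P⟩

end PMet

/-! # The category of regular behaviours -/

/-- `Ω(n)`: the regular behaviours whose live variables are among `v₁, …, v_n`. -/
def BehOn (A : Type*) (n : ℕ) := { x : Beh A // ∀ v, x.Live v → v < n }

def BehOn.mono {A : Type*} {m n : ℕ} (h : m ≤ n) (x : BehOn A m) : BehOn A n :=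
  ⟨x.1, fun v hv => (x.2 v hv).trans_le h⟩

/-- `RegBeh(m, n)`: the `m`-tuples of elements of `Ω(n)`. -/
def RegBeh (A : Type*) (m n : ℕ) := Fin m → BehOn A n

namespace RegBeh

variable {A : Type*}

/-- The behaviour of a variable. -/
def var {n : ℕ} (i : Fin n) : BehOn A n :=
  ⟨Beh.mk (Chart.var i), by
    rintro v ⟨q, _, h⟩
    obtain rfl : v = i := Finset.mem_singleton.1 h
    exact i.2⟩

/-- A tuple of variables. -/
def vars {m n : ℕ} (ρ : Fin m → Fin n) : RegBeh A m n := fun i => var (ρ i)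

def id (n : ℕ) : RegBeh A n n := vars fun i => i

/-- Sequential composition `f ; g`. -/
noncomputable def comp {m n p : ℕ} (f : RegBeh A m n) (g : RegBeh A n p) : RegBeh A m p :=
  fun i => ⟨(f i).1.subst fun j => (g j).1, fun v hv => by
    rcases Beh.live_subst hv with ⟨h, h'⟩ | ⟨j, h⟩
    · exact absurd ((f i).2 v h) (not_lt.2 h')
    · exact (g j).2 v h⟩

def empty (n : ℕ) : RegBeh A 0 n := fun i => i.elim0

/-- Pairing `⟨f, g⟩`. -/
def pair {k l m : ℕ} (f : RegBeh A k m) (g : RegBeh A l m) : RegBeh A (k + l) m :=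
  Fin.addCases f g

/-- Parallel composition `f ⊕ g`. -/
noncomputable def oplus {k l m n : ℕ} (f : RegBeh A k l) (g : RegBeh A m n) :
    RegBeh A (k + m) (l + n) :=
  pair (fun i => (f i).mono (Nat.le_add_right l n)) (comp g (vars (Fin.natAdd l)))

/-- The codiagonal `∇_n`. -/
def codiag (n : ℕ) : RegBeh A (n + n) n := pair (id n) (id n)

def cast {m m' n n' : ℕ} (hm : m = m') (hn : n = n') (f : RegBeh A m n) : RegBeh A m' n' :=
  fun i => (f (i.cast hm.symm)).mono hn.le

/-- The scalar dagger `f† = μ v_{p+1}. f`. -/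
noncomputable def dagger₁ {p : ℕ} (f : RegBeh A 1 (p + 1)) : RegBeh A 1 p :=
  fun i => ⟨Beh.mu p (f i).1, fun v hv => by
    obtain ⟨h, h'⟩ := Beh.live_mu hv
    have := (f i).2 v h
    omega⟩

/-- The dagger `f† : n → p` of `f : n → p + n`, in which the `i`-th component of `f` is fed back
into the variable `v_{p+i}`, extended from `n = 1` by the pairing identity
`⟨g, f⟩† = ⟨h†, f† ; ⟨id_p, h†⟩⟩` where `h = g ; ⟨id_{p+1}, f†⟩`, for `g : 1 → p + 1 + n` and
`f : n → p + 1 + n`. -/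
noncomputable def dagger : (n p : ℕ) → RegBeh A n (p + n) → RegBeh A n p
  | 0, p, _ => empty p
  | n + 1, p, F =>
    let g : RegBeh A 1 (p + 1 + n) := fun _ => (F 0).mono (by omega)
    let f : RegBeh A n (p + 1 + n) := fun i => (F i.succ).mono (by omega)
    let f' : RegBeh A n (p + 1) := dagger n (p + 1) f
    let h' : RegBeh A 1 p := dagger₁ (comp g (pair (id (p + 1)) f'))
    Fin.cons (h' 0) (comp f' (pair (id p) h'))

/-- The trace `Tr^n_{p,q}(g) : p → q` of `g : p + n → q + n`. -/
noncomputable def trace {p q n : ℕ} (g : RegBeh A (p + n) (q + n)) : RegBeh A p q :=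
  comp (vars (Fin.castAdd n)) (dagger (p + n) q
    (comp g (pair (vars (Fin.castAdd (p + n))) (vars fun j => Fin.natAdd q (Fin.natAdd p j)))))

/-- The distance on `RegBeh(m, n)`: the maximum of the behavioural distances between components. -/
noncomputable def dist {m n : ℕ} (f g : RegBeh A m n) : unitInterval :=
  Finset.univ.sup fun i => (PMet.bd (Beh.prechart A)).d (f i).1 (g i).1

/-- The symmetry `σ_{m,n} : m + n → n + m`. -/
def swap (m n : ℕ) : RegBeh A (m + n) (n + m) :=
  vars (Fin.addCases (Fin.natAdd n) (Fin.castAdd m))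

/-- The exchange of the two middle blocks, `id ⊕ σ_{b,c} ⊕ id`. -/
def mid (a b c d : ℕ) : RegBeh A ((a + b) + (c + d)) ((a + c) + (b + d)) :=
  vars (Fin.addCases
    (Fin.addCases (fun i => Fin.castAdd (b + d) (Fin.castAdd c i))
      (fun i => Fin.natAdd (a + c) (Fin.castAdd d i)))
    (Fin.addCases (fun i => Fin.castAdd (b + d) (Fin.natAdd a i))
      (fun i => Fin.natAdd (a + c) (Fin.natAdd b i))))

/-- The behaviour `v₁ + v₂`. -/
noncomputable def choice : RegBeh A 1 2 := fun _ =>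
  ⟨Beh.mk (Chart.sum (Chart.var 0) (Chart.var 1)), by
    rintro v ⟨q, _, h⟩
    rcases q with _ | q | q
    · rcases Finset.mem_union.1 h with h | h <;> have := Finset.mem_singleton.1 h <;> omega
    · have := Finset.mem_singleton.1 h
      omega
    · have := Finset.mem_singleton.1 h
      omega⟩

/-- The behaviour of the empty chart. -/
def zero : RegBeh A 1 0 := fun _ =>
  ⟨Beh.mk Chart.zero, by
    rintro v ⟨q, _, h⟩
    exact absurd h (Finset.notMem_empty v)⟩

/-- The behaviour `a.v₁`. -/
noncomputable def act (a : A) : RegBeh A 1 1 := fun _ =>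
  ⟨Beh.mk (Chart.pref a (Chart.var 0)), by
    rintro v ⟨q, _, h⟩
    rcases q with _ | q
    · exact absurd h (Finset.notMem_empty v)
    · have := Finset.mem_singleton.1 h
      omega⟩

end RegBeh

/-! # The Int construction -/

/-- Morphisms of `Int(RegBeh)` from `(X⁺, X⁻)` to `(Y⁺, Y⁻)`: the elements of
`RegBeh(X⁺ + Y⁻, X⁻ + Y⁺)`. -/
def IntHom (A : Type*) (X Y : ℕ × ℕ) := RegBeh A (X.1 + Y.2) (X.2 + Y.1)

namespace IntHom

variable {A : Type*}

def cast {X X' Y Y' : ℕ × ℕ} (hX : X = X') (hY : Y = Y') (f : IntHom A X Y) : IntHom A X' Y' :=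
  RegBeh.cast (by rw [hX, hY]) (by rw [hX, hY]) f

def id (X : ℕ × ℕ) : IntHom A X X := RegBeh.swap X.1 X.2

/-- The reordering `X⁺ Z⁻ Y⁻ Y⁺ → X⁺ Y⁻ Y⁺ Z⁻`. -/
def alpha (X Y Z : ℕ × ℕ) :
    RegBeh A ((X.1 + Z.2) + (Y.2 + Y.1)) ((X.1 + Y.2) + (Y.1 + Z.2)) :=
  RegBeh.vars (Fin.addCases
    (Fin.addCases (fun i => Fin.castAdd (Y.1 + Z.2) (Fin.castAdd Y.2 i))
      (fun i => Fin.natAdd (X.1 + Y.2) (Fin.natAdd Y.1 i)))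
    (Fin.addCases (fun i => Fin.castAdd (Y.1 + Z.2) (Fin.natAdd X.1 i))
      (fun i => Fin.natAdd (X.1 + Y.2) (Fin.castAdd Z.2 i))))

/-- The reordering `X⁻ Y⁺ Y⁻ Z⁺ → X⁻ Z⁺ Y⁻ Y⁺`. -/
def beta (X Y Z : ℕ × ℕ) :
    RegBeh A ((X.2 + Y.1) + (Y.2 + Z.1)) ((X.2 + Z.1) + (Y.2 + Y.1)) :=
  RegBeh.vars (Fin.addCases
    (Fin.addCases (fun i => Fin.castAdd (Y.2 + Y.1) (Fin.castAdd Z.1 i))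
      (fun i => Fin.natAdd (X.2 + Z.1) (Fin.natAdd Y.2 i)))
    (Fin.addCases (fun i => Fin.natAdd (X.2 + Z.1) (Fin.castAdd Y.1 i))
      (fun i => Fin.castAdd (Y.2 + Y.1) (Fin.natAdd X.2 i))))

noncomputable def comp {X Y Z : ℕ × ℕ} (f : IntHom A X Y) (g : IntHom A Y Z) : IntHom A X Z :=
  RegBeh.trace (((alpha X Y Z).comp (RegBeh.oplus f g)).comp (beta X Y Z))

/-- The monoidal product; on objects it is the sum of `ℕ × ℕ`. -/
noncomputable def tens {X Y Z W : ℕ × ℕ} (f : IntHom A X Y) (g : IntHom A Z W) :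
    IntHom A (X + Z) (Y + W) :=
  ((RegBeh.mid X.1 Z.1 Y.2 W.2).comp (RegBeh.oplus f g)).comp (RegBeh.mid X.2 Y.1 Z.2 W.1)

/-- The symmetry `X⁺ Y⁺ Y⁻ X⁻ → X⁻ Y⁻ Y⁺ X⁺`. -/
def sym (X Y : ℕ × ℕ) : IntHom A (X + Y) (Y + X) :=
  (RegBeh.vars (Fin.addCases
    (Fin.addCases (fun i => Fin.natAdd (X.2 + Y.2) (Fin.natAdd Y.1 i))
      (fun i => Fin.natAdd (X.2 + Y.2) (Fin.castAdd X.1 i)))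
    (Fin.addCases (fun i => Fin.castAdd (Y.1 + X.1) (Fin.natAdd X.2 i))
      (fun i => Fin.castAdd (Y.1 + X.1) (Fin.castAdd Y.2 i)))) :
    RegBeh A ((X.1 + Y.1) + (Y.2 + X.2)) ((X.2 + Y.2) + (Y.1 + X.1)))

/-- The dual of an object. -/
def dual (X : ℕ × ℕ) : ℕ × ℕ := (X.2, X.1)

/-- The unit `η_X : (0, 0) → X ⊗ X*`. -/
def unit (X : ℕ × ℕ) : IntHom A (0, 0) (X + dual X) :=
  RegBeh.cast (Nat.zero_add _).symm (Nat.zero_add _).symm (RegBeh.swap X.2 X.1)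

/-- The counit `ε_X : X* ⊗ X → (0, 0)`. -/
def counit (X : ℕ × ℕ) : IntHom A (dual X + X) (0, 0) :=
  RegBeh.cast (Nat.add_zero _).symm (Nat.add_zero _).symm (RegBeh.swap X.2 X.1)

/-- The embedding `N` of `RegBeh` into `Int(RegBeh)`. -/
def embed {m n : ℕ} (f : RegBeh A m n) : IntHom A (m, 0) (n, 0) :=
  RegBeh.cast (Nat.add_zero _).symm (Nat.zero_add _).symm f

/-- The distance on `Int(RegBeh)`, inherited from `RegBeh`. -/
noncomputable def dist {X Y : ℕ × ℕ} (f g : IntHom A X Y) : unitInterval := RegBeh.dist f g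

end IntHom

/-! # String diagrams -/

/-- The generating objects `◄` (`l`) and `►` (`r`). -/
inductive Dir
  | l
  | r

/-- Words over the generating objects. -/
abbrev Word := List Dir

/-- The word `►^n`. -/
abbrev Word.right (n : ℕ) : Word := List.replicate n Dir.r

/-- The generating morphisms. -/
inductive Gen (A : Type*) : Word → Word → Type _
  | copy : Gen A [.r] [.r, .r]
  | delete : Gen A [.r] []
  | merge : Gen A [.r, .r] [.r]
  | generate : Gen A [] [.r]
  | cap : Gen A [.l, .r] []
  | cup : Gen A [] [.r, .l]
  | act (a : A) : Gen A [.r] [.r]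

/-- The terms from which string diagrams are obtained as a quotient. -/
inductive Term (A : Type*) : Word → Word → Type _
  | gen {v w : Word} (g : Gen A v w) : Term A v w
  | id (w : Word) : Term A w w
  | sym (v w : Word) : Term A (v ++ w) (w ++ v)
  | comp {u v w : Word} (s : Term A u v) (t : Term A v w) : Term A u w
  | tens {v₁ w₁ v₂ w₂ : Word} (s : Term A v₁ w₁) (t : Term A v₂ w₂) :
      Term A (v₁ ++ v₂) (w₁ ++ w₂)

def Term.cast {A : Type*} {v v' w w' : Word} (hv : v = v') (hw : w = w') (t : Term A v w) :
    Term A v' w' := hv ▸ hw ▸ t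

/-- Equality of terms modulo the axioms of strict symmetric monoidal categories. -/
inductive Term.Eqv {A : Type*} : {v w : Word} → Term A v w → Term A v w → Prop
  | refl {v w : Word} (t : Term A v w) : Eqv t t
  | symm {v w : Word} {s t : Term A v w} : Eqv s t → Eqv t s
  | trans {v w : Word} {s t u : Term A v w} : Eqv s t → Eqv t u → Eqv s u
  | comp_congr {u v w : Word} {s s' : Term A u v} {t t' : Term A v w} :
      Eqv s s' → Eqv t t' → Eqv (s.comp t) (s'.comp t')
  | tens_congr {v₁ w₁ v₂ w₂ : Word} {s s' : Term A v₁ w₁} {t t' : Term A v₂ w₂} :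
      Eqv s s' → Eqv t t' → Eqv (s.tens t) (s'.tens t')
  | comp_assoc {u v w x : Word} (s : Term A u v) (t : Term A v w) (r : Term A w x) :
      Eqv ((s.comp t).comp r) (s.comp (t.comp r))
  | id_comp {v w : Word} (t : Term A v w) : Eqv ((Term.id v).comp t) t
  | comp_id {v w : Word} (t : Term A v w) : Eqv (t.comp (Term.id w)) t
  | tens_id (v w : Word) : Eqv ((Term.id v).tens (Term.id w)) (Term.id (v ++ w))
  | interchange {u₁ v₁ w₁ u₂ v₂ w₂ : Word} (s₁ : Term A u₁ v₁) (t₁ : Term A v₁ w₁)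
      (s₂ : Term A u₂ v₂) (t₂ : Term A v₂ w₂) :
      Eqv ((s₁.tens s₂).comp (t₁.tens t₂)) ((s₁.comp t₁).tens (s₂.comp t₂))
  | tens_assoc {v₁ w₁ v₂ w₂ v₃ w₃ : Word} (s : Term A v₁ w₁) (t : Term A v₂ w₂)
      (r : Term A v₃ w₃) :
      Eqv (((s.tens t).tens r).cast (List.append_assoc _ _ _) (List.append_assoc _ _ _))
        (s.tens (t.tens r))
  | id_tens {v w : Word} (t : Term A v w) : Eqv ((Term.id []).tens t) t
  | tens_unit {v w : Word} (t : Term A v w) :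
      Eqv ((t.tens (Term.id [])).cast (List.append_nil v) (List.append_nil w)) t
  | sym_natural {v v' w w' : Word} (s : Term A v v') (t : Term A w w') :
      Eqv ((s.tens t).comp (Term.sym v' w')) ((Term.sym v w).comp (t.tens s))
  | sym_sym (v w : Word) : Eqv ((Term.sym v w).comp (Term.sym w v)) (Term.id (v ++ w))
  | sym_append (u v w : Word) :
      Eqv (Term.sym u (v ++ w))
        (((((Term.sym u v).tens (Term.id w)).cast (List.append_assoc u v w)
          (List.append_assoc v u w)).comp ((Term.id v).tens (Term.sym u w))).cast rfl
            (List.append_assoc v w u).symm)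

/-- `Syn(v, w)`: the string diagrams of type `v → w`. -/
def Syn (A : Type*) (v w : Word) := Quot (Term.Eqv (A := A) (v := v) (w := w))

namespace Syn

variable {A : Type*}

def mk {v w : Word} (t : Term A v w) : Syn A v w := Quot.mk _ t

def gen {v w : Word} (g : Gen A v w) : Syn A v w := mk (.gen g)

def id (w : Word) : Syn A w w := mk (.id w)

def sym (v w : Word) : Syn A (v ++ w) (w ++ v) := mk (.sym v w)

/-- Horizontal composition. -/
def comp {u v w : Word} : Syn A u v → Syn A v w → Syn A u w :=
  Quot.map₂ Term.comp (fun _ _ _ h => .comp_congr (.refl _) h)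
    (fun _ _ _ h => .comp_congr h (.refl _))

/-- Vertical composition. -/
def tens {v₁ w₁ v₂ w₂ : Word} : Syn A v₁ w₁ → Syn A v₂ w₂ → Syn A (v₁ ++ v₂) (w₁ ++ w₂) :=
  Quot.map₂ Term.tens (fun _ _ _ h => .tens_congr (.refl _) h)
    (fun _ _ _ h => .tens_congr h (.refl _))

/-- The vertical composite of the generators `a₁, …, a_m`. -/
def acts : {m : ℕ} → (Fin m → A) → Syn A (Word.right m) (Word.right m)
  | 0, _ => id []
  | _ + 1, a => (gen (.act (a 0))).tens (acts fun i => a i.succ)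

/-- The vertical composite of `n` generators `generate`. -/
def generates : (n : ℕ) → Syn A [] (Word.right n)
  | 0 => id []
  | n + 1 => (gen .generate).tens (generates n)

end Syn

/-! # Semantics of string diagrams -/

/-- The object of `Int(RegBeh)` denoted by a word. -/
def Word.obj : Word → ℕ × ℕ
  | [] => (0, 0)
  | .l :: w => (0, 1) + Word.obj w
  | .r :: w => (1, 0) + Word.obj w

theorem Word.obj_append (v w : Word) : Word.obj (v ++ w) = Word.obj v + Word.obj w := by
  induction v with
  | nil => exact (zero_add _).symm
  | cons d v ih => cases d <;> simp only [List.cons_append, Word.obj, ih, add_assoc]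

noncomputable def Gen.sem {A : Type*} : {v w : Word} → Gen A v w → IntHom A v.obj w.obj
  | _, _, .copy => IntHom.embed RegBeh.choice
  | _, _, .delete => IntHom.embed RegBeh.zero
  | _, _, .merge => IntHom.embed (RegBeh.codiag 1)
  | _, _, .generate => IntHom.embed (RegBeh.empty 1)
  | _, _, .cap => IntHom.counit (1, 0)
  | _, _, .cup => IntHom.unit (1, 0)
  | _, _, .act a => IntHom.embed (RegBeh.act a)

noncomputable def Term.sem {A : Type*} : {v w : Word} → Term A v w → IntHom A v.obj w.obj
  | _, _, .gen g => g.sem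
  | _, _, .id w => IntHom.id w.obj
  | _, _, .sym v w => (IntHom.sym v.obj w.obj).cast (Word.obj_append v w).symm
      (Word.obj_append w v).symm
  | _, _, .comp s t => s.sem.comp t.sem
  | _, _, .tens s t => (s.sem.tens t.sem).cast (Word.obj_append _ _).symm
      (Word.obj_append _ _).symm

/-- The semantics `⟦f⟧` of a string diagram, computed from some term that represents `f`; that the
result does not depend on this term is asserted along with soundness. -/
noncomputable def Syn.sem {A : Type*} {v w : Word} (f : Syn A v w) : IntHom A v.obj w.obj :=
  (Quot.out f).sem

/-! # Equational and quantitative theories -/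

open Syn in
/-- The equational theory: the least congruence containing the axioms. -/
inductive SynEq {A : Type*} : {v w : Word} → Syn A v w → Syn A v w → Prop
  | refl {v w : Word} (f : Syn A v w) : SynEq f f
  | symm {v w : Word} {f g : Syn A v w} : SynEq f g → SynEq g f
  | trans {v w : Word} {f g h : Syn A v w} : SynEq f g → SynEq g h → SynEq f h
  | comp_congr {u v w : Word} {f f' : Syn A u v} {g g' : Syn A v w} :
      SynEq f f' → SynEq g g' → SynEq (f.comp g) (f'.comp g')
  | tens_congr {v₁ w₁ v₂ w₂ : Word} {f f' : Syn A v₁ w₁} {g g' : Syn A v₂ w₂} :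
      SynEq f f' → SynEq g g' → SynEq (f.tens g) (f'.tens g')
  | A1 : SynEq (v := [.r]) (w := [.r])
      (comp (v := [.r, .l, .r]) (tens (gen .cup) (id [.r])) (tens (id [.r]) (gen .cap)))
      (id [.r])
  | A2 : SynEq (v := [.l]) (w := [.l])
      (comp (v := [.l, .r, .l]) (tens (id [.l]) (gen .cup)) (tens (gen .cap) (id [.l])))
      (id [.l])
  | B1 : SynEq (v := [.r]) (w := [.r, .r, .r])
      (comp (gen .copy) (tens (gen .copy) (id [.r])))
      (comp (gen .copy) (tens (id [.r]) (gen .copy)))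
  | B2 : SynEq (v := [.r]) (w := [.r])
      (comp (gen .copy) (tens (id [.r]) (gen .delete))) (id [.r])
  | B3 : SynEq (v := [.r]) (w := [.r, .r])
      (comp (gen .copy) (sym [.r] [.r])) (gen .copy)
  | B4 : SynEq (v := [.r, .r, .r]) (w := [.r])
      (comp (tens (gen .merge) (id [.r])) (gen .merge))
      (comp (tens (id [.r]) (gen .merge)) (gen .merge))
  | B5 : SynEq (v := [.r]) (w := [.r])
      (comp (tens (id [.r]) (gen .generate)) (gen .merge)) (id [.r])
  | B6 : SynEq (v := [.r, .r]) (w := [.r])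
      (comp (sym [.r] [.r]) (gen .merge)) (gen .merge)
  | B7 : SynEq (v := [.r, .r]) (w := [.r, .r])
      (comp (gen .merge) (gen .copy))
      (comp (v := [.r, .r, .r, .r]) (tens (gen .copy) (gen .copy))
        (comp (v := [.r, .r, .r, .r])
          (tens (v₁ := [.r]) (w₁ := [.r]) (v₂ := [.r, .r, .r]) (w₂ := [.r, .r, .r]) (id [.r])
            (tens (v₁ := [.r, .r]) (w₁ := [.r, .r]) (sym [.r] [.r]) (id [.r])))
          (tens (gen .merge) (gen .merge))))
  | B8 : SynEq (v := [.r, .r]) (w := [])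
      (comp (gen .merge) (gen .delete)) (tens (gen .delete) (gen .delete))
  | B9 : SynEq (v := []) (w := [.r, .r])
      (comp (gen .generate) (gen .copy)) (tens (gen .generate) (gen .generate))
  | B10 : SynEq (v := [.r]) (w := [.r]) (comp (gen .copy) (gen .merge)) (id [.r])
  | B11 : SynEq (v := [.r]) (w := [.r])
      (comp (v := [.r, .r, .l]) (tens (id [.r]) (gen .cup))
        (comp (v := [.r, .r, .l]) (tens (comp (gen .merge) (gen .copy)) (id [.l]))
          (tens (v₁ := [.r]) (w₁ := [.r]) (v₂ := [.r, .l]) (id [.r])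
            (comp (sym [.r] [.l]) (gen .cap)))))
      (id [.r])
  | C1 (a : A) : SynEq (v := [.r, .r]) (w := [.r])
      (comp (gen .merge) (gen (.act a)))
      (comp (tens (gen (.act a)) (gen (.act a))) (gen .merge))

/-- `Derivable f ε g`: the quantitative equation `f =_ε g` is derivable. -/
inductive Derivable {A : Type*} : {v w : Word} → Syn A v w → ℚ≥0 → Syn A v w → Prop
  | pref {m n : ℕ} {f g : Syn A (Word.right m) (Word.right n)} {ε : ℚ≥0} (a : Fin m → A) :
      Derivable f ε g → Derivable ((Syn.acts a).comp f) (ε / 2) ((Syn.acts a).comp g)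
  | max {v w : Word} {f g : Syn A v w} {ε ε' : ℚ≥0} :
      Derivable f ε g → ε ≤ ε' → Derivable f ε' g
  | refl {v w : Word} {f g : Syn A v w} : SynEq f g → Derivable f 0 g
  | symm {v w : Word} {f g : Syn A v w} {ε : ℚ≥0} : Derivable f ε g → Derivable g ε f
  | cont {v w : Word} {f g : Syn A v w} {ε : ℚ≥0} :
      (∀ ε', ε < ε' → Derivable f ε' g) → Derivable f ε g
  | triang {v w : Word} {f g h : Syn A v w} {ε₁ ε₂ : ℚ≥0} :
      Derivable f ε₁ g → Derivable g ε₂ h → Derivable f (ε₁ + ε₂) h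
  | seq {u v w : Word} {f h : Syn A u v} {g i : Syn A v w} {ε₁ ε₂ : ℚ≥0} :
      Derivable f ε₁ h → Derivable g ε₂ i → Derivable (f.comp g) (ε₁ ⊔ ε₂) (h.comp i)
  | top {v w : Word} (f g : Syn A v w) : Derivable f 1 g
  | tens {v₁ w₁ v₂ w₂ : Word} {f₁ g₁ : Syn A v₁ w₁} {f₂ g₂ : Syn A v₂ w₂} {ε₁ ε₂ : ℚ≥0} :
      Derivable f₁ ε₁ g₁ → Derivable f₂ ε₂ g₂ →
        Derivable (f₁.tens f₂) (ε₁ ⊔ ε₂) (g₁.tens g₂)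
  | codel {m n : ℕ} (d : Syn A (Word.right m) (Word.right n)) :
      Derivable (Syn.generates n) 0 ((Syn.generates m).comp d)

/-- `Valid f ε g`: the distance in `Int(RegBeh)` between `⟦f⟧` and `⟦g⟧` is at most `ε`. -/
def Valid {A : Type*} {v w : Word} (f : Syn A v w) (ε : ℚ≥0) (g : Syn A v w) : Prop :=
  (IntHom.dist f.sem g.sem : ℝ) ≤ ε

/-! Behaviours are handled coinductively. A behaviour is determined by its one-step observations
`beta`, and any relation closed under observations, up to equality, relates only equal behaviours
(`eq_of_bisim`, `beta_injective`). Substitution becomes a monadic `bind`, recursion obeys an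
unfolding law, and both are described by their observations alone.

Well-definedness amounts to the axioms of strict symmetric monoidal categories in Int(RegBeh).
Composition there is a trace, hence a dagger, which is defined one variable at a time by the pairing
identity. `mem_beta_dagger` replaces this by a symmetric description: component `i` of `f†` makes an
observation iff a chain of silent steps leads from `i` to a component that makes it by a transition
or by a visible output, where a step `i → k` means that `f_i` outputs the `k`-th feedback variable.
This implies the fixpoint equation, and it also says that unguarded cycles contribute nothing. If
one factor of a composite consists of wires, the fixpoint equation alone computes the composite,
since no cycle arises; this covers identities and symmetries. In associativity and interchange there
is genuine feedback. There, morphisms are presented by graphs with silent edges, labelled edges and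
numbered ports. Composition glues graphs and the monoidal product juxtaposes them (`Presents.comp`,
`Presents.tens`), so the two sides of each law are presented by isomorphic graphs.

The same graphs settle the A and B axioms. Every generator other than `act` denotes a full morphism,
each of whose components outputs all variables and does nothing else. A graph without labelled edges
in which every entry reaches every exit presents a full morphism, and there is only one full
morphism of a given type; so these axioms reduce to connectivity. C1 is a computation with
substitutions.

For the quantitative rules, `Approx k` is bisimilarity up to depth `k`. As the distance is halved at
every transition, it is at most `r` iff bisimilarity holds up to depth `k + 1` for every `k` with `r
< 2⁻ᵏ` (`bd_le_iff`). `Approx k` is preserved by substitution and recursion, hence by dagger, trace,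
composition and monoidal product, which gives Seq and Tens. A layer of prefixes adds one to the
depth, which gives Pref; Cont follows by choosing a rational between `ε` and `2⁻ᵏ`, Triang from the
triangle inequality, and Codel because a morphism without entries has no components. -/

namespace Beh

/-! ### Coinduction, substitution and recursion on regular behaviours -/

variable {A : Type*}

/-- The transitions and outputs of a behaviour. -/
noncomputable def beta (x : Beh A) : Finset (A × Beh A ⊕ ℕ) := (prechart A).beta x

theorem inl_mem_beta {x : Beh A} {m : A × Beh A} :
    .inl m ∈ beta x ↔ m ∈ (prechart A).trans x := by
  simp [beta, Prechart.beta]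

theorem inr_mem_beta {x : Beh A} {v : ℕ} : .inr v ∈ beta x ↔ v ∈ (prechart A).out x := by
  simp [beta, Prechart.beta]

open Classical in
theorem inl_mem_beta_mk {C : Chart A} {a : A} {y : Beh A} :
    .inl (a, y) ∈ beta (mk C) ↔ ∃ q, (a, q) ∈ C.pre.trans C.start ∧ mk (C.at' q) = y := by
  rw [inl_mem_beta]
  change (a, y) ∈ (C.pre.trans C.start).image (Prod.map id fun q => mk (C.at' q)) ↔ _
  simp only [Finset.mem_image, Prod.exists, Prod.map_apply, id, Prod.mk.injEq]
  constructor
  · rintro ⟨b, q, h, rfl, rfl⟩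
    exact ⟨q, h, rfl⟩
  · rintro ⟨q, h, rfl⟩
    exact ⟨a, q, h, rfl, rfl⟩

theorem inr_mem_beta_mk {C : Chart A} {v : ℕ} :
    .inr v ∈ beta (mk C) ↔ v ∈ C.pre.out C.start :=
  inr_mem_beta

/-- `R` is a bisimulation up to equality between behaviours at the pair `x`, `y`. -/
structure BisimAt (R : Beh A → Beh A → Prop) (x y : Beh A) : Prop where
  out : ∀ v, .inr v ∈ beta x ↔ .inr v ∈ beta y
  forth : ∀ a x', .inl (a, x') ∈ beta x → ∃ y', .inl (a, y') ∈ beta y ∧ (R x' y' ∨ x' = y')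
  back : ∀ a y', .inl (a, y') ∈ beta y → ∃ x', .inl (a, x') ∈ beta x ∧ (R x' y' ∨ x' = y')

theorem BisimAt.refl (R : Beh A → Beh A → Prop) (x : Beh A) : BisimAt R x x where
  out _ := Iff.rfl
  forth _ x' h := ⟨x', h, Or.inr rfl⟩
  back _ x' h := ⟨x', h, Or.inr rfl⟩

/-- The coinduction principle. Between representing charts, the pairs of states whose classes are
equal or related by `R` form a strong bisimulation, because matched successors again have equal or
related classes. -/
theorem eq_of_bisim (R : Beh A → Beh A → Prop) (hR : ∀ x y, R x y → BisimAt R x y)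
    {x y : Beh A} (h : R x y) : x = y := by
  induction x using Quotient.inductionOn with
  | h C =>
  induction y using Quotient.inductionOn with
  | h D =>
  have hR' : ∀ x y, R x y ∨ x = y → BisimAt R x y := by
    rintro x y (h | rfl)
    · exact hR x y h
    · exact .refl R x
  refine Quotient.sound ⟨fun q q' => R (mk (C.at' q)) (mk (D.at' q')) ∨
    mk (C.at' q) = mk (D.at' q'), ⟨?_, ?_, ?_⟩, Or.inl h⟩
  · intro q q' r
    ext v
    have := (hR' _ _ r).out v
    rwa [inr_mem_beta_mk, inr_mem_beta_mk] at this
  · intro q q' r a p hp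
    obtain ⟨y', hy', r'⟩ := (hR' _ _ r).forth a _ (inl_mem_beta_mk.2 ⟨p, hp, rfl⟩)
    obtain ⟨p', hp', rfl⟩ := inl_mem_beta_mk.1 hy'
    exact ⟨p', hp', r'⟩
  · intro q q' r a p hp
    obtain ⟨y', hy', r'⟩ := (hR' _ _ r).back a _ (inl_mem_beta_mk.2 ⟨p, hp, rfl⟩)
    obtain ⟨p', hp', rfl⟩ := inl_mem_beta_mk.1 hy'
    exact ⟨p', hp', r'⟩

/-- Equal observations match every successor with itself, which the up-to-equality clause accepts at
once. Identities of behaviours thereby become identities of sets of observations. -/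
theorem beta_injective : Function.Injective (beta (A := A)) := by
  intro x y h
  refine eq_of_bisim (fun x y => beta x = beta y) ?_ h
  intro x y h
  exact ⟨fun v => by rw [h], fun a x' hx => ⟨x', h ▸ hx, Or.inr rfl⟩,
    fun a x' hx => ⟨x', h ▸ hx, Or.inr rfl⟩⟩

theorem mk_at_eq_of_bisim {C D : Chart A} (R : C.State → D.State → Prop)
    (h : C.pre.IsBisim D.pre R) {q : C.State} {q' : D.State} (r : R q q') :
    mk (C.at' q) = mk (D.at' q') :=
  Quotient.sound ⟨R, h, r⟩

theorem live_of_inr_mem {x : Beh A} {v : ℕ} (h : .inr v ∈ beta x) : x.Live v := by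
  induction x using Quotient.inductionOn with
  | h C => exact ⟨C.start, Relation.ReflTransGen.refl, inr_mem_beta_mk.1 h⟩

theorem live_of_inl_mem {x y : Beh A} {a : A} (h : .inl (a, y) ∈ beta x) {v : ℕ}
    (hv : y.Live v) : x.Live v := by
  induction x using Quotient.inductionOn with
  | h C =>
    obtain ⟨q, hq, rfl⟩ := inl_mem_beta_mk.1 h
    obtain ⟨q', hr, ho⟩ := hv
    exact ⟨q', .head ⟨a, hq⟩ hr, ho⟩

/-- The bound gives `bind` a finite arity; by `subst_congr_live` its choice is immaterial. -/
theorem exists_live_bound (x : Beh A) : ∃ n, ∀ v, x.Live v → v < n := by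
  induction x using Quotient.inductionOn with
  | h C =>
    have := C.finite
    have := Fintype.ofFinite C.State
    refine ⟨(Finset.univ.sup fun q => (C.pre.out q).sup fun v => v) + 1, ?_⟩
    rintro v ⟨q, _, ho⟩
    refine Nat.lt_succ_of_le (le_trans ?_ (Finset.le_sup (Finset.mem_univ q)))
    exact Finset.le_sup (f := fun v => v) ho

theorem inr_mem_beta_subst {x : Beh A} {n : ℕ} {g : Fin n → Beh A} {v : ℕ} :
    .inr v ∈ beta (x.subst g) ↔ (.inr v ∈ beta x ∧ n ≤ v) ∨
      ∃ i : Fin n, .inr (i : ℕ) ∈ beta x ∧ .inr v ∈ beta (g i) := by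
  induction x using Quotient.inductionOn with
  | h C =>
    obtain ⟨D, rfl⟩ : ∃ D : Fin n → Chart A, g = fun i => mk (D i) :=
      ⟨fun i => (g i).out, funext fun i => (Quotient.out_eq (g i)).symm⟩
    change .inr v ∈ beta ((mk C).subst _) ↔ (.inr v ∈ beta (mk C) ∧ _) ∨
      ∃ i : Fin n, .inr (i : ℕ) ∈ beta (mk C) ∧ _
    rw [subst_mk]
    simp only [inr_mem_beta_mk, Chart.subst, Prechart.subst, Finset.mem_union, Finset.mem_filter,
      Finset.mem_biUnion, Finset.mem_univ, true_and]

theorem inl_mem_beta_subst {x : Beh A} {n : ℕ} {g : Fin n → Beh A} {a : A} {y : Beh A} :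
    .inl (a, y) ∈ beta (x.subst g) ↔ (∃ x', .inl (a, x') ∈ beta x ∧ y = x'.subst g) ∨
      ∃ i : Fin n, .inr (i : ℕ) ∈ beta x ∧ .inl (a, y) ∈ beta (g i) := by
  induction x using Quotient.inductionOn with
  | h C =>
    obtain ⟨D, rfl⟩ : ∃ D : Fin n → Chart A, g = fun i => mk (D i) :=
      ⟨fun i => (g i).out, funext fun i => (Quotient.out_eq (g i)).symm⟩
    change .inl (a, y) ∈ beta ((mk C).subst fun i => mk (D i)) ↔
      (∃ x', .inl (a, x') ∈ beta (mk C) ∧ y = x'.subst fun i => mk (D i)) ∨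
      ∃ i : Fin n, .inr (i : ℕ) ∈ beta (mk C) ∧ .inl (a, y) ∈ beta (mk (D i))
    rw [subst_mk]
    -- In the chart of a substitution, a state of the left copy still awaits the substitution,
    -- whereas a state of a right copy behaves as in its own chart, since nothing leads back to the
    -- left.
    have hinl : ∀ q, mk ((C.subst D).at' (.inl q)) = (mk (C.at' q)).subst fun i => mk (D i) :=
      fun q => (subst_mk (C.at' q) D).symm
    have hinr : ∀ i p, mk ((C.subst D).at' (.inr ⟨i, p⟩)) = mk ((D i).at' p) := by
      intro i p
      refine mk_at_eq_of_bisim (C := C.subst D) (D := D i)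
        (fun z w => z = (Sum.inr ⟨i, w⟩ : C.State ⊕ Σ i, (D i).State)) ⟨?_, ?_, ?_⟩ rfl
      · rintro _ w rfl
        rfl
      · rintro _ w rfl b z hz
        obtain ⟨p', hp', rfl⟩ := Prechart.mem_subst_inr.1 hz
        exact ⟨p', hp', rfl⟩
      · rintro _ w rfl b z hz
        exact ⟨_, Prechart.mem_subst_inr.2 ⟨z, hz, rfl⟩, rfl⟩
    simp only [inl_mem_beta_mk, inr_mem_beta_mk]
    constructor
    · rintro ⟨q, hq, rfl⟩
      rcases Prechart.mem_subst_inl.1 hq with ⟨p, hp, rfl⟩ | ⟨i, hi, p, hp, rfl⟩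
      · exact Or.inl ⟨_, ⟨p, hp, rfl⟩, hinl p⟩
      · exact Or.inr ⟨i, hi, p, hp, (hinr i p).symm⟩
    · rintro (⟨_, ⟨p, hp, rfl⟩, rfl⟩ | ⟨i, hi, p, hp, rfl⟩)
      · exact ⟨.inl p, Prechart.mem_subst_inl.2 (Or.inl ⟨p, hp, rfl⟩), hinl p⟩
      · exact ⟨.inr ⟨i, p⟩, Prechart.mem_subst_inl.2 (Or.inr ⟨i, hi, p, hp, rfl⟩), hinr i p⟩

/-- Substitution reads only the values at live variables. Liveness at a successor implies liveness
at the source, so the instances of all `y` whose live variables are live in `x` form a bisimulation.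
-/
theorem subst_congr_live {x : Beh A} {n m : ℕ} {g : Fin n → Beh A} {g' : Fin m → Beh A}
    (hn : ∀ v, x.Live v → v < n) (hm : ∀ v, x.Live v → v < m)
    (h : ∀ v hv hv', x.Live v → g ⟨v, hv⟩ = g' ⟨v, hv'⟩) : x.subst g = x.subst g' := by
  refine eq_of_bisim (fun z z' => ∃ y : Beh A, (∀ v, y.Live v → x.Live v) ∧
    z = y.subst g ∧ z' = y.subst g') ?_ ⟨x, fun _ => id, rfl, rfl⟩
  rintro _ _ ⟨y, hy, rfl, rfl⟩
  refine ⟨?_, ?_, ?_⟩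
  · intro v
    simp only [inr_mem_beta_subst]
    constructor
    · rintro (⟨h1, h2⟩ | ⟨i, h1, h2⟩)
      · exact absurd (hn v (hy _ (live_of_inr_mem h1))) (not_lt.2 h2)
      · have hl := hy _ (live_of_inr_mem h1)
        exact Or.inr ⟨⟨i, hm _ hl⟩, h1, h i i.2 (hm _ hl) hl ▸ h2⟩
    · rintro (⟨h1, h2⟩ | ⟨i, h1, h2⟩)
      · exact absurd (hm v (hy _ (live_of_inr_mem h1))) (not_lt.2 h2)
      · have hl := hy _ (live_of_inr_mem h1)
        exact Or.inr ⟨⟨i, hn _ hl⟩, h1, (h i (hn _ hl) i.2 hl).symm ▸ h2⟩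
  · intro a z hz
    rcases inl_mem_beta_subst.1 hz with ⟨x', h1, rfl⟩ | ⟨i, h1, h2⟩
    · exact ⟨_, inl_mem_beta_subst.2 (Or.inl ⟨x', h1, rfl⟩),
        Or.inl ⟨x', fun v hv => hy v (live_of_inl_mem h1 hv), rfl, rfl⟩⟩
    · have hl := hy _ (live_of_inr_mem h1)
      exact ⟨z, inl_mem_beta_subst.2 (Or.inr ⟨⟨i, hm _ hl⟩, h1, h i i.2 (hm _ hl) hl ▸ h2⟩),
        Or.inr rfl⟩
  · intro a z hz
    rcases inl_mem_beta_subst.1 hz with ⟨x', h1, rfl⟩ | ⟨i, h1, h2⟩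
    · exact ⟨_, inl_mem_beta_subst.2 (Or.inl ⟨x', h1, rfl⟩),
        Or.inl ⟨x', fun v hv => hy v (live_of_inl_mem h1 hv), rfl, rfl⟩⟩
    · have hl := hy _ (live_of_inr_mem h1)
      exact ⟨z, inl_mem_beta_subst.2
        (Or.inr ⟨⟨i, hn _ hl⟩, h1, (h i (hn _ hl) i.2 hl).symm ▸ h2⟩), Or.inr rfl⟩

/-- Simultaneous substitution for all variables. -/
noncomputable def bind (x : Beh A) (θ : ℕ → Beh A) : Beh A :=
  x.subst fun i : Fin (exists_live_bound x).choose => θ i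

/-- This removes arities: once the live variables lie below `n`, an `n`-ary substitution is a
`bind`, whose laws hold without side conditions. -/
theorem subst_eq_bind {x : Beh A} {n : ℕ} {g : Fin n → Beh A} {θ : ℕ → Beh A}
    (hn : ∀ v, x.Live v → v < n) (h : ∀ v (hv : v < n), g ⟨v, hv⟩ = θ v) :
    x.subst g = x.bind θ :=
  subst_congr_live hn (exists_live_bound x).choose_spec fun v hv _ _ => h v hv

theorem bind_congr {x : Beh A} {θ ψ : ℕ → Beh A} (h : ∀ v, x.Live v → θ v = ψ v) :
    x.bind θ = x.bind ψ :=
  subst_congr_live (exists_live_bound x).choose_spec (exists_live_bound x).choose_spec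
    fun v _ _ hv => h v hv

theorem inr_mem_beta_bind {x : Beh A} {θ : ℕ → Beh A} {v : ℕ} :
    .inr v ∈ beta (x.bind θ) ↔ ∃ i, .inr i ∈ beta x ∧ .inr v ∈ beta (θ i) := by
  have hx := (exists_live_bound x).choose_spec
  rw [bind, inr_mem_beta_subst]
  constructor
  · rintro (⟨h1, h2⟩ | ⟨i, h1, h2⟩)
    · exact absurd (hx v (live_of_inr_mem h1)) (not_lt.2 h2)
    · exact ⟨i, h1, h2⟩
  · rintro ⟨i, h1, h2⟩
    exact Or.inr ⟨⟨i, hx _ (live_of_inr_mem h1)⟩, h1, h2⟩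

theorem inl_mem_beta_bind {x : Beh A} {θ : ℕ → Beh A} {a : A} {y : Beh A} :
    .inl (a, y) ∈ beta (x.bind θ) ↔ (∃ x', .inl (a, x') ∈ beta x ∧ y = x'.bind θ) ∨
      ∃ i, .inr i ∈ beta x ∧ .inl (a, y) ∈ beta (θ i) := by
  have hx := (exists_live_bound x).choose_spec
  rw [bind, inl_mem_beta_subst]
  have key : ∀ x', .inl (a, x') ∈ beta x →
      (x'.subst fun i : Fin (exists_live_bound x).choose => θ i) = x'.bind θ := fun x' h =>
    subst_eq_bind (fun v hv => hx v (live_of_inl_mem h hv)) fun _ _ => rfl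
  constructor
  · rintro (⟨x', h1, rfl⟩ | ⟨i, h1, h2⟩)
    · exact Or.inl ⟨x', h1, key x' h1⟩
    · exact Or.inr ⟨i, h1, h2⟩
  · rintro (⟨x', h1, rfl⟩ | ⟨i, h1, h2⟩)
    · exact Or.inl ⟨x', h1, (key x' h1).symm⟩
    · exact Or.inr ⟨⟨i, hx _ (live_of_inr_mem h1)⟩, h1, h2⟩

/-- The observation `e`, with the substitution `θ` applied to the target of a transition, is made
at `x` by a transition, not by an output. -/
def TransObs (θ : ℕ → Beh A) (x : Beh A) (e : A × Beh A ⊕ ℕ) : Prop :=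
  ∃ a x', .inl (a, x') ∈ beta x ∧ e = .inl (a, x'.bind θ)

theorem mem_beta_bind {x : Beh A} {θ : ℕ → Beh A} {e : A × Beh A ⊕ ℕ} :
    e ∈ beta (x.bind θ) ↔ TransObs θ x e ∨ ∃ i, .inr i ∈ beta x ∧ e ∈ beta (θ i) := by
  rcases e with ⟨a, y⟩ | v
  · rw [inl_mem_beta_bind]
    simp only [TransObs, Sum.inl.injEq, Prod.mk.injEq]
    constructor
    · rintro (⟨x', h, rfl⟩ | h)
      · exact Or.inl ⟨a, x', h, rfl, rfl⟩
      · exact Or.inr h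
    · rintro (⟨_, x', h, rfl, rfl⟩ | h)
      · exact Or.inl ⟨x', h, rfl⟩
      · exact Or.inr h
  · rw [inr_mem_beta_bind]
    simp [TransObs]

theorem beta_bind_mono {x y : Beh A} (h : beta x ⊆ beta y) (θ : ℕ → Beh A) :
    beta (x.bind θ) ⊆ beta (y.bind θ) := by
  intro e he
  rcases mem_beta_bind.1 he with ⟨a, x', h1, rfl⟩ | ⟨i, h1, h2⟩
  · exact mem_beta_bind.2 (Or.inl ⟨a, x', h h1, rfl⟩)
  · exact mem_beta_bind.2 (Or.inr ⟨i, h h1, h2⟩)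

/-- The behaviour of the variable `v`. -/
def var (v : ℕ) : Beh A := mk (Chart.var v)

theorem mem_beta_var {v : ℕ} {e : A × Beh A ⊕ ℕ} : e ∈ beta (var v) ↔ e = .inr v := by
  rcases e with ⟨a, y⟩ | w
  · rw [var, inl_mem_beta_mk]
    simp only [reduceCtorEq, iff_false]
    rintro ⟨q, hq, _⟩
    exact absurd hq (Finset.notMem_empty _)
  · rw [var, inr_mem_beta_mk]
    simp [Chart.var]

/-- The behaviour of the empty chart. -/
def zero : Beh A := mk Chart.zero

theorem notMem_beta_zero {e : A × Beh A ⊕ ℕ} : e ∉ beta zero := by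
  rcases e with ⟨a, y⟩ | w
  · rw [zero, inl_mem_beta_mk]
    rintro ⟨q, hq, _⟩
    exact absurd hq (Finset.notMem_empty _)
  · rw [zero, inr_mem_beta_mk]
    simp [Chart.zero]

theorem live_zero {v : ℕ} : ¬ (zero : Beh A).Live v := by
  rintro ⟨q, _, h⟩
  exact absurd h (Finset.notMem_empty v)

theorem var_bind (v : ℕ) (θ : ℕ → Beh A) : (var v).bind θ = θ v := by
  apply beta_injective
  ext e
  rw [mem_beta_bind]
  simp [TransObs, mem_beta_var]

theorem zero_bind (θ : ℕ → Beh A) : zero.bind θ = zero := by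
  apply beta_injective
  ext e
  rw [mem_beta_bind]
  simp [TransObs, notMem_beta_zero]

theorem bind_var (x : Beh A) : x.bind var = x := by
  refine eq_of_bisim (fun z x => z = x.bind var) ?_ rfl
  rintro _ x rfl
  refine ⟨?_, ?_, ?_⟩
  · intro v
    simp [inr_mem_beta_bind, mem_beta_var]
  · intro a z hz
    rcases inl_mem_beta_bind.1 hz with ⟨x', h, rfl⟩ | ⟨i, _, h⟩
    · exact ⟨x', h, Or.inl rfl⟩
    · simp [mem_beta_var] at h
  · intro a z hz
    exact ⟨z.bind var, inl_mem_beta_bind.2 (Or.inl ⟨z, hz, rfl⟩), Or.inl rfl⟩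

/-- A transition of either side stems from `x`, from some `θ i` or from some `ψ i`. In the first
case the successors are again an instance of the law; in the other two they coincide, which the
up-to-equality clause covers. -/
theorem bind_bind (x : Beh A) (θ ψ : ℕ → Beh A) :
    (x.bind θ).bind ψ = x.bind fun v => (θ v).bind ψ := by
  refine eq_of_bisim (fun z w => ∃ x : Beh A, z = (x.bind θ).bind ψ ∧
    w = x.bind fun v => (θ v).bind ψ) ?_ ⟨x, rfl, rfl⟩
  rintro _ _ ⟨x, rfl, rfl⟩
  refine ⟨?_, ?_, ?_⟩
  · intro v
    simp only [inr_mem_beta_bind]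
    constructor
    · rintro ⟨i, ⟨j, h1, h2⟩, h3⟩
      exact ⟨j, h1, i, h2, h3⟩
    · rintro ⟨j, h1, i, h2, h3⟩
      exact ⟨i, ⟨j, h1, h2⟩, h3⟩
  · intro a z hz
    rcases inl_mem_beta_bind.1 hz with ⟨x', h, rfl⟩ | ⟨i, h1, h2⟩
    · rcases inl_mem_beta_bind.1 h with ⟨x'', h', rfl⟩ | ⟨i, h1, h2⟩
      · exact ⟨x''.bind fun v => (θ v).bind ψ, inl_mem_beta_bind.2 (Or.inl ⟨x'', h', rfl⟩),
          Or.inl ⟨x'', rfl, rfl⟩⟩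
      · exact ⟨_, inl_mem_beta_bind.2 (Or.inr ⟨i, h1, inl_mem_beta_bind.2
          (Or.inl ⟨x', h2, rfl⟩)⟩), Or.inr rfl⟩
    · obtain ⟨j, h3, h4⟩ := inr_mem_beta_bind.1 h1
      exact ⟨_, inl_mem_beta_bind.2 (Or.inr ⟨j, h3, inl_mem_beta_bind.2
        (Or.inr ⟨i, h4, h2⟩)⟩), Or.inr rfl⟩
  · intro a z hz
    rcases inl_mem_beta_bind.1 hz with ⟨x', h, rfl⟩ | ⟨i, h1, h2⟩
    · exact ⟨_, inl_mem_beta_bind.2 (Or.inl ⟨_, inl_mem_beta_bind.2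
        (Or.inl ⟨x', h, rfl⟩), rfl⟩), Or.inl ⟨x', rfl, rfl⟩⟩
    · rcases inl_mem_beta_bind.1 h2 with ⟨x', h, rfl⟩ | ⟨j, h3, h4⟩
      · exact ⟨_, inl_mem_beta_bind.2 (Or.inl ⟨_, inl_mem_beta_bind.2
          (Or.inr ⟨i, h1, h⟩), rfl⟩), Or.inr rfl⟩
      · exact ⟨_, inl_mem_beta_bind.2 (Or.inr ⟨j, inr_mem_beta_bind.2 ⟨i, h1, h3⟩, h4⟩),
          Or.inr rfl⟩

theorem inr_mem_beta_mu {x : Beh A} {w v : ℕ} :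
    .inr v ∈ beta (mu w x) ↔ .inr v ∈ beta x ∧ v ≠ w := by
  induction x using Quotient.inductionOn with
  | h C =>
    change .inr v ∈ beta (mk (Chart.mu w C)) ↔ .inr v ∈ beta (mk C) ∧ _
    simp only [inr_mem_beta_mk, Chart.mu, Prechart.mu]
    split_ifs with h
    · simp [and_comm]
    · exact ⟨fun hv => ⟨hv, fun e => h (e ▸ hv)⟩, And.left⟩

/-- In the chart of a recursion, a state with output `w` receives the transitions and outputs of the
start state and loses `w`. This is the effect of substituting the whole recursion for `w`, so the
unfolding law holds at every state. -/
theorem mk_mu_at (C : Chart A) (w : ℕ) (q : C.State) :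
    mk ((Chart.mu w C).at' q) =
      (mk (C.at' q)).bind (Function.update var w (mk (Chart.mu w C))) := by
  refine eq_of_bisim (fun z z' => ∃ q : C.State, z = mk ((Chart.mu w C).at' q) ∧
    z' = (mk (C.at' q)).bind (Function.update var w (mk (Chart.mu w C)))) ?_ ⟨q, rfl, rfl⟩
  rintro _ _ ⟨q, rfl, rfl⟩
  have hmu : ∀ a z, .inl (a, z) ∈ beta (mk ((Chart.mu w C).at' q)) ↔
      ∃ p, ((a, p) ∈ C.pre.trans q ∨ (w ∈ C.pre.out q ∧ (a, p) ∈ C.pre.trans C.start)) ∧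
        mk ((Chart.mu w C).at' p) = z := by
    intro a z
    rw [inl_mem_beta_mk]
    exact exists_congr fun p => and_congr_left' Prechart.mem_mu
  -- The start state can only receive its own transitions, so it gains none.
  have hst : ∀ a z, .inl (a, z) ∈ beta (mk (Chart.mu w C)) ↔
      ∃ p, (a, p) ∈ C.pre.trans C.start ∧ mk ((Chart.mu w C).at' p) = z := by
    intro a z
    rw [inl_mem_beta_mk]
    refine exists_congr fun p => and_congr_left' (Prechart.mem_mu.trans ?_)
    exact ⟨fun h => h.elim id And.right, Or.inl⟩
  have hout : ∀ v, .inr v ∈ beta (mk (Chart.mu w C)) ↔ v ∈ C.pre.out C.start ∧ v ≠ w :=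
    fun v => (inr_mem_beta_mu (x := mk C)).trans (and_congr_left' inr_mem_beta_mk)
  refine ⟨?_, ?_, ?_⟩
  · intro v
    rw [inr_mem_beta_bind, inr_mem_beta_mk]
    constructor
    · intro h
      simp only [Chart.mu, Chart.at', Prechart.mu] at h
      split_ifs at h with hw
      · obtain ⟨hne, h⟩ := Finset.mem_erase.1 h
        rcases Finset.mem_union.1 h with h | h
        · refine ⟨v, inr_mem_beta_mk.2 h, ?_⟩
          rw [Function.update_of_ne hne, mem_beta_var]
        · refine ⟨w, inr_mem_beta_mk.2 hw, ?_⟩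
          rw [Function.update_self, hout]
          exact ⟨h, hne⟩
      · have hne : v ≠ w := fun e => hw (e ▸ h)
        refine ⟨v, inr_mem_beta_mk.2 h, ?_⟩
        rw [Function.update_of_ne hne, mem_beta_var]
    · rintro ⟨i, hi, hv⟩
      rw [inr_mem_beta_mk] at hi
      change i ∈ C.pre.out q at hi
      simp only [Chart.mu, Chart.at', Prechart.mu]
      by_cases hiw : i = w
      · subst hiw
        rw [Function.update_self, hout] at hv
        rw [if_pos hi]
        exact Finset.mem_erase.2 ⟨hv.2, Finset.mem_union_right _ hv.1⟩
      · rw [Function.update_of_ne hiw, mem_beta_var] at hv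
        obtain rfl : v = i := Sum.inr.inj hv
        split_ifs
        · exact Finset.mem_erase.2 ⟨hiw, Finset.mem_union_left _ hi⟩
        · exact hi
  · intro a z hz
    obtain ⟨p, hp | ⟨hw, hp⟩, rfl⟩ := (hmu a z).1 hz
    · exact ⟨_, inl_mem_beta_bind.2 (Or.inl ⟨_, inl_mem_beta_mk.2 ⟨p, hp, rfl⟩, rfl⟩),
        Or.inl ⟨p, rfl, rfl⟩⟩
    · refine ⟨_, inl_mem_beta_bind.2 (Or.inr ⟨w, inr_mem_beta_mk.2 hw, ?_⟩), Or.inr rfl⟩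
      rw [Function.update_self]
      exact (hst a _).2 ⟨p, hp, rfl⟩
  · intro a z hz
    rcases inl_mem_beta_bind.1 hz with ⟨x', h, rfl⟩ | ⟨i, h1, h2⟩
    · obtain ⟨p, hp, rfl⟩ := inl_mem_beta_mk.1 h
      exact ⟨_, (hmu a _).2 ⟨p, Or.inl hp, rfl⟩, Or.inl ⟨p, rfl, rfl⟩⟩
    · by_cases hiw : i = w
      · subst hiw
        rw [Function.update_self] at h2
        obtain ⟨p, hp, rfl⟩ := (hst a z).1 h2
        exact ⟨_, (hmu a _).2 ⟨p, Or.inr ⟨inr_mem_beta_mk.1 h1, hp⟩, rfl⟩, Or.inr rfl⟩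
      · rw [Function.update_of_ne hiw, mem_beta_var] at h2
        cases h2

/-- As the start state gains no transitions, recursion shows only in the targets. In particular an
unguarded `w` contributes nothing. -/
theorem inl_mem_beta_mu {x : Beh A} {w : ℕ} {a : A} {y : Beh A} :
    .inl (a, y) ∈ beta (mu w x) ↔
      ∃ x', .inl (a, x') ∈ beta x ∧ y = x'.bind (Function.update var w (mu w x)) := by
  induction x using Quotient.inductionOn with
  | h C =>
    change .inl (a, y) ∈ beta (mk (Chart.mu w C)) ↔
      ∃ x', .inl (a, x') ∈ beta (mk C) ∧ y = x'.bind (Function.update var w (mk (Chart.mu w C)))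
    simp only [inl_mem_beta_mk]
    constructor
    · rintro ⟨q, hq, rfl⟩
      have hq' : (a, q) ∈ C.pre.trans C.start :=
        (Prechart.mem_mu.1 hq).elim id And.right
      exact ⟨_, ⟨q, hq', rfl⟩, mk_mu_at C w q⟩
    · rintro ⟨_, ⟨q, hq, rfl⟩, rfl⟩
      exact ⟨q, Prechart.mem_mu.2 (Or.inl hq), mk_mu_at C w q⟩

theorem mem_beta_mu {x : Beh A} {w : ℕ} {e : A × Beh A ⊕ ℕ} :
    e ∈ beta (mu w x) ↔ TransObs (Function.update var w (mu w x)) x e ∨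
      ∃ v, .inr v ∈ beta x ∧ v ≠ w ∧ e = .inr v := by
  rcases e with ⟨a, y⟩ | v
  · rw [inl_mem_beta_mu]
    simp only [TransObs, Sum.inl.injEq, Prod.mk.injEq]
    constructor
    · rintro ⟨x', h, rfl⟩
      exact Or.inl ⟨a, x', h, rfl, rfl⟩
    · rintro (⟨_, x', h, rfl, rfl⟩ | ⟨v, _, _, h⟩)
      · exact ⟨x', h, rfl⟩
      · cases h
  · rw [inr_mem_beta_mu]
    simp [TransObs]

end Beh

/-! ### Observations after feeding solutions back into variables -/

namespace Beh

variable {A : Type*}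

theorem transObs_bind {x : Beh A} {θ ψ : ℕ → Beh A} {e : A × Beh A ⊕ ℕ} :
    TransObs ψ (x.bind θ) e ↔ TransObs (fun v => (θ v).bind ψ) x e ∨
      ∃ i, .inr i ∈ beta x ∧ TransObs ψ (θ i) e := by
  constructor
  · rintro ⟨a, z, hz, rfl⟩
    rcases inl_mem_beta_bind.1 hz with ⟨x', h, rfl⟩ | ⟨i, h1, h2⟩
    · exact Or.inl ⟨a, x', h, by rw [bind_bind]⟩
    · exact Or.inr ⟨i, h1, a, z, h2, rfl⟩
  · rintro (⟨a, x', h, rfl⟩ | ⟨i, h1, a, z, h2, rfl⟩)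
    · exact ⟨a, _, inl_mem_beta_bind.2 (Or.inl ⟨x', h, rfl⟩), by rw [bind_bind]⟩
    · exact ⟨a, z, inl_mem_beta_bind.2 (Or.inr ⟨i, h1, h2⟩), rfl⟩

theorem transObs_congr {x : Beh A} {θ ψ : ℕ → Beh A} (h : ∀ v, x.Live v → θ v = ψ v)
    {e : A × Beh A ⊕ ℕ} : TransObs θ x e ↔ TransObs ψ x e := by
  refine exists_congr fun a => exists_congr fun x' => and_congr_right fun hx => ?_
  rw [bind_congr fun v hv => h v (live_of_inl_mem hx hv)]

/-- The observation `e` is made at `x` by a transition or by an output below `p`. -/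
def TopObs (p : ℕ) (θ : ℕ → Beh A) (x : Beh A) (e : A × Beh A ⊕ ℕ) : Prop :=
  TransObs θ x e ∨ ∃ v, v < p ∧ .inr v ∈ beta x ∧ e = .inr v

/-- The substitution that feeds `D` back into the variables from `p` on. -/
def feed (p : ℕ) (D : ℕ → Beh A) (v : ℕ) : Beh A := if v < p then var v else D (v - p)

theorem feed_of_lt {p v : ℕ} (h : v < p) (D : ℕ → Beh A) : feed p D v = var v := if_pos h

theorem feed_add (p k : ℕ) (D : ℕ → Beh A) : feed p D (p + k) = D k := by
  rw [feed, if_neg (by omega), Nat.add_sub_cancel_left]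

theorem mem_beta_bind_feed {x : Beh A} {p : ℕ} {D : ℕ → Beh A} {e : A × Beh A ⊕ ℕ} :
    e ∈ beta (x.bind (feed p D)) ↔
      TopObs p (feed p D) x e ∨ ∃ k, .inr (p + k) ∈ beta x ∧ e ∈ beta (D k) := by
  rw [mem_beta_bind, TopObs, or_assoc]
  refine or_congr_right ⟨?_, ?_⟩
  · rintro ⟨i, h1, h2⟩
    rcases lt_or_ge i p with hi | hi
    · rw [feed_of_lt hi, mem_beta_var] at h2
      exact Or.inl ⟨i, hi, h1, h2⟩
    · obtain ⟨k, rfl⟩ := Nat.exists_eq_add_of_le hi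
      rw [feed_add] at h2
      exact Or.inr ⟨k, h1, h2⟩
  · rintro (⟨v, hv, h1, rfl⟩ | ⟨k, h1, h2⟩)
    · exact ⟨v, h1, by rw [feed_of_lt hv, mem_beta_var]⟩
    · exact ⟨p + k, h1, by rwa [feed_add]⟩

/-- This describes the composite inside the pairing identity. The variable `p` is neither visible to
`TopObs p` nor fed with `D`; it is reserved for the recursion that follows. -/
theorem topObs_bind_feed {x : Beh A} {p : ℕ} {D ψ : ℕ → Beh A} {e : A × Beh A ⊕ ℕ} :
    TopObs p ψ (x.bind (feed (p + 1) D)) e ↔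
      TopObs p (fun v => (feed (p + 1) D v).bind ψ) x e ∨
        ∃ k, .inr (p + 1 + k) ∈ beta x ∧ TopObs p ψ (D k) e := by
  simp only [TopObs, transObs_bind, inr_mem_beta_bind]
  constructor
  · rintro ((h | ⟨i, h1, h2⟩) | ⟨v, hv, ⟨i, h1, h2⟩, rfl⟩)
    · exact Or.inl (Or.inl h)
    · rcases lt_or_ge i (p + 1) with hi | hi
      · obtain ⟨a, z, hz, _⟩ := h2
        rw [feed_of_lt hi, mem_beta_var] at hz
        cases hz
      · obtain ⟨k, rfl⟩ := Nat.exists_eq_add_of_le hi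
        rw [feed_add] at h2
        exact Or.inr ⟨k, h1, Or.inl h2⟩
    · rcases lt_or_ge i (p + 1) with hi | hi
      · rw [feed_of_lt hi, mem_beta_var] at h2
        obtain rfl := Sum.inr.inj h2
        exact Or.inl (Or.inr ⟨v, hv, h1, rfl⟩)
      · obtain ⟨k, rfl⟩ := Nat.exists_eq_add_of_le hi
        rw [feed_add] at h2
        exact Or.inr ⟨k, h1, Or.inr ⟨v, hv, h2, rfl⟩⟩
  · rintro ((h | ⟨v, hv, h1, rfl⟩) | ⟨k, h1, h2 | ⟨v, hv, h2, rfl⟩⟩)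
    · exact Or.inl (Or.inl h)
    · exact Or.inr ⟨v, hv, ⟨v, h1, by rw [feed_of_lt (by omega), mem_beta_var]⟩, rfl⟩
    · exact Or.inl (Or.inr ⟨_, h1, by rwa [feed_add]⟩)
    · exact Or.inr ⟨v, hv, ⟨_, h1, by rwa [feed_add]⟩, rfl⟩

/-- When all live variables are at most `p`, dropping the output `p` leaves exactly the outputs
visible to `TopObs p`, and `ψ` has to agree with the unfolding substitution only on these variables
and `p`. -/
theorem mem_beta_mu_of_live {x : Beh A} {p : ℕ} (hx : ∀ v, x.Live v → v < p + 1)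
    {ψ : ℕ → Beh A} (h1 : ∀ v, v < p → ψ v = var v) (h2 : ψ p = mu p x) {e : A × Beh A ⊕ ℕ} :
    e ∈ beta (mu p x) ↔ TopObs p ψ x e := by
  rw [mem_beta_mu]
  refine or_congr (transObs_congr fun v hv => ?_) (exists_congr fun v => ?_)
  · rcases Nat.lt_succ_iff_lt_or_eq.1 (hx v hv) with h | rfl
    · rw [Function.update_of_ne h.ne, h1 v h]
    · rw [Function.update_self, h2]
  · constructor
    · rintro ⟨h, h', rfl⟩
      have := hx v (live_of_inr_mem h)
      exact ⟨by omega, h, rfl⟩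
    · rintro ⟨h, h', rfl⟩
      exact ⟨h', by omega, rfl⟩

end Beh

/-! ### Components of tuples and the explicit form of the dagger -/

namespace RegBeh

variable {A : Type*}

open Beh (beta)

/-- The components of a tuple, indexed by the natural numbers. -/
noncomputable def nth {m n : ℕ} (f : RegBeh A m n) (i : ℕ) : Beh A :=
  if h : i < m then (f ⟨i, h⟩).1 else Beh.zero

theorem nth_of_lt {m n : ℕ} (f : RegBeh A m n) {i : ℕ} (h : i < m) : nth f i = (f ⟨i, h⟩).1 :=
  dif_pos h

theorem nth_of_le {m n : ℕ} (f : RegBeh A m n) {i : ℕ} (h : m ≤ i) : nth f i = Beh.zero :=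
  dif_neg (not_lt.2 h)

theorem lt_of_live_nth {m n : ℕ} {f : RegBeh A m n} {i v : ℕ} (h : (nth f i).Live v) : v < n := by
  rcases lt_or_ge i m with hi | hi
  · rw [nth_of_lt f hi] at h
    exact (f _).2 v h
  · rw [nth_of_le f hi] at h
    exact absurd h Beh.live_zero

theorem lt_of_inr_mem_nth {m n : ℕ} {f : RegBeh A m n} {i v : ℕ}
    (h : .inr v ∈ beta (nth f i)) : v < n :=
  lt_of_live_nth (Beh.live_of_inr_mem h)

theorem ext_nth {m n : ℕ} {f g : RegBeh A m n} (h : ∀ i, i < m → nth f i = nth g i) : f = g := by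
  funext i
  have := h i i.2
  rw [nth_of_lt f i.2, nth_of_lt g i.2] at this
  exact Subtype.ext this

theorem nth_comp {m n p : ℕ} (f : RegBeh A m n) (g : RegBeh A n p) (i : ℕ) :
    nth (comp f g) i = (nth f i).bind (nth g) := by
  rcases lt_or_ge i m with h | h
  · rw [nth_of_lt _ h, nth_of_lt _ h]
    exact Beh.subst_eq_bind (f ⟨i, h⟩).2 fun v hv => (nth_of_lt g hv).symm
  · rw [nth_of_le _ h, nth_of_le _ h, Beh.zero_bind]

theorem nth_pair {k l m : ℕ} (f : RegBeh A k m) (g : RegBeh A l m) (i : ℕ) :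
    nth (pair f g) i = if i < k then nth f i else nth g (i - k) := by
  split_ifs with h
  · rw [nth_of_lt _ h, nth_of_lt _ (Nat.lt_add_right l h)]
    exact congrArg Subtype.val (Fin.addCases_left (motive := fun _ => BehOn A m)
      (left := f) (right := g) ⟨i, h⟩)
  · rcases lt_or_ge i (k + l) with h' | h'
    · rw [nth_of_lt _ h', nth_of_lt _ (by omega : i - k < l)]
      have := Fin.addCases_right (motive := fun _ => BehOn A m)
        (left := f) (right := g) ⟨i - k, by omega⟩
      rw [← congrArg Subtype.val this]
      congr 2
      exact Fin.ext (by simp; omega)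
    · rw [nth_of_le _ h', nth_of_le _ (by omega)]

theorem nth_vars {m n : ℕ} (ρ : Fin m → Fin n) (i : ℕ) :
    nth (vars (A := A) ρ) i = if h : i < m then Beh.var (ρ ⟨i, h⟩) else Beh.zero := rfl

theorem nth_mono {m n n' : ℕ} (f : RegBeh A m n) (h : n ≤ n') :
    nth (fun i => (f i).mono h) = nth f := rfl

theorem nth_id (n i : ℕ) : nth (id (A := A) n) i = if i < n then Beh.var i else Beh.zero := by
  rw [id, nth_vars]
  rfl

theorem nth_pair_id {n p : ℕ} (f : RegBeh A n p) : nth (pair (id p) f) = Beh.feed p (nth f) := by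
  funext v
  rw [nth_pair, nth_id, Beh.feed]
  split_ifs <;> rfl

theorem nth_oplus {k l m n : ℕ} (f : RegBeh A k l) (g : RegBeh A m n) (i : ℕ) :
    nth (oplus f g) i =
      if i < k then nth f i else (nth g (i - k)).bind fun v => Beh.var (l + v) := by
  refine (nth_pair _ _ i).trans ?_
  rw [nth_mono f, nth_comp]
  congr 1
  refine Beh.bind_congr fun v hv => ?_
  rw [nth_vars, dif_pos (lt_of_live_nth hv)]
  rfl

/-- The pairing identity in components, free of the arithmetic in the types: `F 0` plays the part of
`g`, the shifted remainder that of `f`. The inductions over the dagger rest on these equations. -/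
theorem nth_dagger_succ {n p : ℕ} (F : RegBeh A (n + 1) (p + (n + 1))) :
    ∃ f : RegBeh A n (p + 1 + n), (∀ k, nth f k = nth F (k + 1)) ∧
      nth (dagger (n + 1) p F) 0 =
        Beh.mu p ((nth F 0).bind (Beh.feed (p + 1) (nth (dagger n (p + 1) f)))) ∧
      ∀ k, nth (dagger (n + 1) p F) (k + 1) = (nth (dagger n (p + 1) f) k).bind
        (Beh.feed p fun _ => nth (dagger (n + 1) p F) 0) := by
  let g : RegBeh A 1 (p + 1 + n) := fun _ => (F 0).mono (by omega)
  let f : RegBeh A n (p + 1 + n) := fun i => (F i.succ).mono (by omega)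
  let h' : RegBeh A 1 p := dagger₁ (comp g (pair (id (p + 1)) (dagger n (p + 1) f)))
  have hD : dagger (n + 1) p F =
      Fin.cons (h' 0) (comp (dagger n (p + 1) f) (pair (id p) h')) := by
    rw [dagger]
  have h0 : nth (dagger (n + 1) p F) 0 = (h' 0).1 := by
    rw [nth_of_lt _ (Nat.succ_pos n), hD]
    rfl
  refine ⟨f, fun k => ?_, ?_, fun k => ?_⟩
  · rcases lt_or_ge k n with h | h
    · rw [nth_of_lt _ h, nth_of_lt _ (Nat.succ_lt_succ h)]
      rfl
    · rw [nth_of_le _ h, nth_of_le _ (Nat.succ_le_succ h)]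
  · have hc := nth_comp g (pair (id (p + 1)) (dagger n (p + 1) f)) 0
    rw [nth_of_lt _ one_pos, nth_pair_id] at hc
    rw [h0]
    exact congrArg (Beh.mu p) hc
  · have hk : nth (dagger (n + 1) p F) (k + 1) =
        nth (comp (dagger n (p + 1) f) (pair (id p) h')) k := by
      rcases lt_or_ge k n with h | h
      · rw [nth_of_lt _ h, nth_of_lt _ (Nat.succ_lt_succ h), hD]
        rfl
      · rw [nth_of_le _ h, nth_of_le _ (Nat.succ_le_succ h)]
    rw [hk, nth_comp, nth_pair_id, h0]
    refine Beh.bind_congr fun v hv => ?_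
    have := lt_of_live_nth hv
    simp only [Beh.feed]
    split_ifs with h
    · rfl
    · rw [nth_of_lt _ (by omega : v - p < 1)]
      congr 2
      omega

/-- The explicit solution of the system of equations defining the dagger. -/
theorem mem_beta_dagger {n p : ℕ} (F : RegBeh A n (p + n)) (i : ℕ) (e : A × Beh A ⊕ ℕ) :
    e ∈ beta (nth (dagger n p F) i) ↔
      ∃ j, Relation.ReflTransGen (fun i k => .inr (p + k) ∈ beta (nth F i)) i j ∧
        Beh.TopObs p (Beh.feed p (nth (dagger n p F))) (nth F j) e := by
  -- The number `p` must vary, since for the tail the feedback variable `p` of component `0` counts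
  -- as visible.
  induction n generalizing p i e with
  | zero =>
    have h0 : ∀ {q} (g : RegBeh A 0 q) j, nth g j = Beh.zero := fun g j =>
      nth_of_le g (Nat.zero_le j)
    simp [h0, Beh.TopObs, Beh.TransObs, Beh.notMem_beta_zero]
  | succ n ih =>
    obtain ⟨f, hf, h0, hs⟩ := nth_dagger_succ F
    set D := nth (dagger (n + 1) p F) with hD
    set E := nth (dagger n (p + 1) f) with hE
    set ψ := Beh.feed p fun _ => D 0 with hψ
    have hψp : ψ p = D 0 := by simp [hψ, Beh.feed]
    have hψv : ∀ v, v < p → ψ v = Beh.var v := fun v hv => Beh.feed_of_lt hv _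
    -- Feeding back the tail `E` and then the head `D 0` amounts to feeding back the whole solution
    -- `D`.
    have hcomp : (fun v => (Beh.feed (p + 1) E v).bind ψ) = Beh.feed p D := by
      funext v
      rcases lt_trichotomy v p with h | rfl | h
      · rw [Beh.feed_of_lt (by omega), Beh.var_bind, hψv v h, Beh.feed_of_lt h]
      · rw [Beh.feed_of_lt (by omega), Beh.var_bind, hψp]
        exact (Beh.feed_add v 0 D).symm
      · obtain ⟨k, rfl⟩ := Nat.exists_eq_add_of_le h
        rw [Beh.feed_add, ← hs k]
        simp only [Beh.feed]
        rw [if_neg (by omega)]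
        congr 1
        omega
    -- By the induction hypothesis, the tail shows below `p` what is reached on paths avoiding
    -- component `0`. Its output `p`, treated in `hpk`, is the way back to component `0`.
    have hEk : ∀ k e, Beh.TopObs p ψ (E k) e ↔
        ∃ j, Relation.ReflTransGen (fun i k => .inr (p + 1 + k) ∈ beta (nth f i)) k j ∧
          Beh.TopObs p (Beh.feed p D) (nth f j) e := by
      intro k e
      constructor
      · rintro (⟨a, z, hz, rfl⟩ | ⟨v, hv, hz, rfl⟩)
        · obtain ⟨j, hj, ⟨b, y, hy, h⟩ | ⟨v, _, _, h⟩⟩ := (ih f k _).1 hz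
          · cases h
            exact ⟨j, hj, Or.inl ⟨a, y, hy, by rw [Beh.bind_bind, hcomp]⟩⟩
          · cases h
        · obtain ⟨j, hj, ⟨b, y, hy, h⟩ | ⟨w, _, hw, h⟩⟩ := (ih f k _).1 hz
          · cases h
          · cases h
            exact ⟨j, hj, Or.inr ⟨v, hv, hw, rfl⟩⟩
      · rintro ⟨j, hj, ⟨a, y, hy, rfl⟩ | ⟨v, hv, hz, rfl⟩⟩
        · exact Or.inl ⟨a, _, (ih f k _).2 ⟨j, hj, Or.inl ⟨a, y, hy, rfl⟩⟩,
            by rw [Beh.bind_bind, hcomp]⟩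
        · exact Or.inr ⟨v, hv, (ih f k _).2 ⟨j, hj, Or.inr ⟨v, by omega, hz, rfl⟩⟩, rfl⟩
    have hpk : ∀ k, .inr p ∈ beta (E k) ↔
        ∃ j, Relation.ReflTransGen (fun i k => .inr (p + 1 + k) ∈ beta (nth f i)) k j ∧
          .inr p ∈ beta (nth f j) := by
      intro k
      rw [hE, ih f k]
      refine exists_congr fun j => and_congr_right fun _ => ?_
      constructor
      · rintro (⟨_, _, _, h⟩ | ⟨v, _, h, h'⟩)
        · cases h
        · cases h'
          exact h
      · exact fun h => Or.inr ⟨p, by omega, h, rfl⟩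
    -- Recursion over `p` ignores the output `p`, so observations at component `0` are found on
    -- paths that never return there.
    have hD0 : ∀ e, e ∈ beta (D 0) ↔ Beh.TopObs p (Beh.feed p D) (nth F 0) e ∨
        ∃ k, .inr (p + 1 + k) ∈ beta (nth F 0) ∧ Beh.TopObs p ψ (E k) e := by
      intro e
      have hlive : ∀ v, ((nth F 0).bind (Beh.feed (p + 1) E)).Live v → v < p + 1 := by
        intro v hv
        have h := nth_comp (fun _ => (F 0).mono (by omega) : RegBeh A 1 (p + 1 + n))
          (pair (id (p + 1)) (dagger n (p + 1) f)) 0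
        rw [nth_pair_id] at h
        have h' : nth (fun _ => (F 0).mono (by omega) : RegBeh A 1 (p + 1 + n)) 0 = nth F 0 := rfl
        rw [h'] at h
        rw [← h] at hv
        exact lt_of_live_nth hv
      rw [h0, Beh.mem_beta_mu_of_live hlive hψv (hψp.trans h0), Beh.topObs_bind_feed, hcomp]
    have hDs : ∀ k e, e ∈ beta (D (k + 1)) ↔ Beh.TopObs p ψ (E k) e ∨
        (.inr p ∈ beta (E k) ∧ e ∈ beta (D 0)) := by
      intro k e
      rw [hs, Beh.mem_beta_bind_feed]
      refine or_congr_right ⟨?_, ?_⟩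
      · rintro ⟨l, h1, h2⟩
        have := lt_of_inr_mem_nth h1
        obtain rfl : l = 0 := by omega
        exact ⟨h1, h2⟩
      · rintro ⟨h1, h2⟩
        exact ⟨0, h1, h2⟩
    have hlift : ∀ k j, Relation.ReflTransGen
        (fun i k => .inr (p + 1 + k) ∈ beta (nth f i)) k j → Relation.ReflTransGen
        (fun i k => .inr (p + k) ∈ beta (nth F i)) (k + 1) (j + 1) := by
      intro k j h
      refine Relation.ReflTransGen.lift (· + 1) (fun a b hab => ?_) _ _ h
      rw [hf] at hab
      have : p + (b + 1) = p + 1 + b := by omega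
      change .inr (p + (b + 1)) ∈ beta (nth F (a + 1))
      rw [this]
      exact hab
    have hzero : ∀ e, e ∈ beta (D 0) → ∃ j, Relation.ReflTransGen
        (fun i k => .inr (p + k) ∈ beta (nth F i)) 0 j ∧
          Beh.TopObs p (Beh.feed p D) (nth F j) e := by
      intro e he
      rcases (hD0 e).1 he with h | ⟨k, hk, h⟩
      · exact ⟨0, .refl, h⟩
      · obtain ⟨j, hj, h⟩ := (hEk k e).1 h
        refine ⟨j + 1, .head ?_ (hlift k j hj), hf j ▸ h⟩
        have : p + (k + 1) = p + 1 + k := by omega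
        rw [this]
        exact hk
    constructor
    · intro he
      cases i with
      | zero => exact hzero e he
      | succ k =>
        rcases (hDs k e).1 he with h | ⟨h, h'⟩
        · obtain ⟨j, hj, h⟩ := (hEk k e).1 h
          exact ⟨j + 1, hlift k j hj, hf j ▸ h⟩
        · obtain ⟨j, hj, h⟩ := (hpk k).1 h
          obtain ⟨l, hl, h'⟩ := hzero e h'
          rw [hf] at h
          exact ⟨l, (hlift k j hj).trans (.head (b := 0) h hl), h'⟩
    -- The path is followed backwards, by whether each edge starts or ends at component `0`. An edge
    -- from `0` to itself is absorbed, as is a return to `0` through the tail.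
    · rintro ⟨j, hj, he⟩
      induction hj using Relation.ReflTransGen.head_induction_on with
      | refl =>
        cases j with
        | zero => exact (hD0 e).2 (Or.inl he)
        | succ k => exact (hDs k e).2 (Or.inl ((hEk k e).2 ⟨k, .refl, (hf k).symm ▸ he⟩))
      | @head a c hac _ hc =>
        cases a with
        | zero =>
          cases c with
          | zero => exact hc
          | succ l =>
            have : p + (l + 1) = p + 1 + l := by omega
            rw [this] at hac
            rcases (hDs l e).1 hc with h | ⟨_, h⟩
            · exact (hD0 e).2 (Or.inr ⟨l, hac, h⟩)
            · exact h
        | succ k =>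
          cases c with
          | zero => exact (hDs k e).2 (Or.inr ⟨(hpk k).2 ⟨k, .refl, (hf k).symm ▸ hac⟩, hc⟩)
          | succ l =>
            have : p + (l + 1) = p + 1 + l := by omega
            rw [this, ← hf] at hac
            rcases (hDs l e).1 hc with h | ⟨h, h'⟩
            · obtain ⟨m, hm, h⟩ := (hEk l e).1 h
              exact (hDs k e).2 (Or.inl ((hEk k e).2 ⟨m, .head hac hm, h⟩))
            · obtain ⟨m, hm, h⟩ := (hpk l).1 h
              exact (hDs k e).2 (Or.inr ⟨(hpk k).2 ⟨m, .head hac hm, h⟩, h'⟩)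

/-- The fixpoint equation results from splitting off the first step of the path in
`mem_beta_dagger`. -/
theorem nth_dagger_eq {n p : ℕ} (F : RegBeh A n (p + n)) (i : ℕ) :
    nth (dagger n p F) i = (nth F i).bind (Beh.feed p (nth (dagger n p F))) := by
  apply Beh.beta_injective
  ext e
  rw [Beh.mem_beta_bind_feed]
  constructor
  · intro h
    obtain ⟨j, hj, h⟩ := (mem_beta_dagger F i e).1 h
    rcases hj.cases_head with rfl | ⟨k, hk, hkj⟩
    · exact Or.inl h
    · exact Or.inr ⟨k, hk, (mem_beta_dagger F k e).2 ⟨j, hkj, h⟩⟩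
  · rintro (h | ⟨k, hk, h⟩)
    · exact (mem_beta_dagger F i e).2 ⟨i, .refl, h⟩
    · obtain ⟨j, hj, h⟩ := (mem_beta_dagger F k e).1 h
      exact (mem_beta_dagger F i e).2 ⟨j, .head hk hj, h⟩

end RegBeh

theorem Fin.val_addCases {k l m : ℕ} (ρ : Fin k → Fin m) (τ : Fin l → Fin m) (i : Fin (k + l)) :
    (Fin.addCases (motive := fun _ => Fin m) ρ τ i).val =
      if h : i.val < k then (ρ ⟨i, h⟩).val else (τ ⟨i - k, by omega⟩).val := by
  refine Fin.addCases (fun j => ?_) (fun j => ?_) i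
  · simp
  · simp

/-! ### Composition and monoidal product in components -/

namespace IntHom

variable {A : Type*}

open Beh (beta)

/-- The components of a morphism, indexed by the natural numbers. -/
noncomputable def nth {X Y : ℕ × ℕ} (f : IntHom A X Y) (i : ℕ) : Beh A :=
  RegBeh.nth (m := X.1 + Y.2) (n := X.2 + Y.1) f i

theorem ext_nth {X Y : ℕ × ℕ} {f g : IntHom A X Y}
    (h : ∀ i, i < X.1 + Y.2 → f.nth i = g.nth i) : f = g :=
  RegBeh.ext_nth h

theorem nth_cast {X X' Y Y' : ℕ × ℕ} (hX : X = X') (hY : Y = Y') (f : IntHom A X Y) :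
    (f.cast hX hY).nth = f.nth := by
  subst hX hY
  rfl

theorem nth_alpha (X Y Z : ℕ × ℕ) (i : ℕ) :
    RegBeh.nth (alpha (A := A) X Y Z) i =
      if i < X.1 then Beh.var i
      else if i < X.1 + Z.2 then Beh.var (X.1 + Y.2 + (Y.1 + (i - X.1)))
      else if i < X.1 + Z.2 + Y.2 then Beh.var (X.1 + (i - (X.1 + Z.2)))
      else if i < X.1 + Z.2 + Y.2 + Y.1 then Beh.var (X.1 + Y.2 + (i - (X.1 + Z.2 + Y.2)))
      else Beh.zero := by
  simp only [alpha, RegBeh.nth_vars, Fin.val_addCases]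
  split_ifs <;> first | omega | rfl | (simp; try congr 1; try omega)

theorem nth_beta (X Y Z : ℕ × ℕ) (i : ℕ) :
    RegBeh.nth (IntHom.beta (A := A) X Y Z) i =
      if i < X.2 then Beh.var i
      else if i < X.2 + Y.1 then Beh.var (X.2 + Z.1 + (Y.2 + (i - X.2)))
      else if i < X.2 + Y.1 + Y.2 then Beh.var (X.2 + Z.1 + (i - (X.2 + Y.1)))
      else if i < X.2 + Y.1 + Y.2 + Z.1 then Beh.var (X.2 + (i - (X.2 + Y.1 + Y.2)))
      else Beh.zero := by
  simp only [IntHom.beta, RegBeh.nth_vars, Fin.val_addCases]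
  split_ifs <;> first | omega | rfl | (simp; try congr 1; try omega)

/-- The variables of `f` in the system of equations for `f ; g`. -/
def leftVar (X Y Z : ℕ × ℕ) (v : ℕ) : ℕ :=
  if v < X.2 then v else X.2 + Z.1 + (X.1 + Z.2 + (Y.2 + (v - X.2)))

/-- The variables of `g` in the system of equations for `f ; g`. -/
def rightVar (X Y Z : ℕ × ℕ) (v : ℕ) : ℕ :=
  if v < Y.2 then X.2 + Z.1 + (X.1 + Z.2 + v) else X.2 + (v - Y.2)

/-- The composite `f ; g` solves a system of equations given by the components of `f` and `g`. -/
theorem exists_comp_system {X Y Z : ℕ × ℕ} (f : IntHom A X Y) (g : IntHom A Y Z) :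
    ∃ F : RegBeh A (X.1 + Z.2 + (Y.2 + Y.1)) (X.2 + Z.1 + (X.1 + Z.2 + (Y.2 + Y.1))),
      (∀ i, i < X.1 + Z.2 → (f.comp g).nth i = RegBeh.nth (RegBeh.dagger _ _ F) i) ∧
      (∀ i, i < X.1 →
        RegBeh.nth F i = (f.nth i).bind fun v => Beh.var (leftVar X Y Z v)) ∧
      (∀ i, i < Z.2 →
        RegBeh.nth F (X.1 + i) = (g.nth (Y.1 + i)).bind fun v => Beh.var (rightVar X Y Z v)) ∧
      (∀ i, i < Y.2 →
        RegBeh.nth F (X.1 + Z.2 + i) =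
          (f.nth (X.1 + i)).bind fun v => Beh.var (leftVar X Y Z v)) ∧
      (∀ i, i < Y.1 →
        RegBeh.nth F (X.1 + Z.2 + (Y.2 + i)) =
          (g.nth i).bind fun v => Beh.var (rightVar X Y Z v)) := by
  set K := ((alpha X Y Z).comp (RegBeh.oplus f g)).comp (IntHom.beta X Y Z) with hK
  -- The renaming that the trace applies before its dagger: visible variables stay, traced ones move
  -- past the feedback variables of the first `X.1 + Z.2` components, which are never fed back.
  set T : RegBeh A (X.2 + Z.1 + (Y.2 + Y.1)) (X.2 + Z.1 + (X.1 + Z.2 + (Y.2 + Y.1))) :=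
    RegBeh.pair (RegBeh.vars (Fin.castAdd _))
      (RegBeh.vars fun j => Fin.natAdd (X.2 + Z.1) (Fin.natAdd (X.1 + Z.2) j)) with hT
  have hTn : ∀ v, v < X.2 + Z.1 + (Y.2 + Y.1) → RegBeh.nth T v =
      if v < X.2 + Z.1 then Beh.var v
      else Beh.var (X.2 + Z.1 + (X.1 + Z.2 + (v - (X.2 + Z.1)))) := by
    intro v hv
    simp only [hT, RegBeh.nth_pair, RegBeh.nth_vars]
    split_ifs <;> first | rfl | omega
  have hF : ∀ i, RegBeh.nth (RegBeh.comp K T) i =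
      (((RegBeh.nth (alpha X Y Z) i).bind (RegBeh.nth (RegBeh.oplus f g))).bind
        (RegBeh.nth (IntHom.beta X Y Z))).bind (RegBeh.nth T) := by
    intro i
    rw [RegBeh.nth_comp, hK, RegBeh.nth_comp, RegBeh.nth_comp]
  have hleft : ∀ i, ((f.nth i).bind (RegBeh.nth (IntHom.beta X Y Z))).bind (RegBeh.nth T) =
      (f.nth i).bind fun v => Beh.var (leftVar X Y Z v) := by
    intro i
    rw [Beh.bind_bind]
    refine Beh.bind_congr fun v hv => ?_
    have hv := RegBeh.lt_of_live_nth hv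
    rw [nth_beta, leftVar]
    split_ifs
    · rw [Beh.var_bind, hTn _ (by omega), if_pos (by omega)]
    · rw [Beh.var_bind, hTn _ (by omega), if_neg (by omega)]
      congr 1
      omega
  have hright : ∀ i, (((g.nth i).bind fun v => Beh.var (X.2 + Y.1 + v)).bind
      (RegBeh.nth (IntHom.beta X Y Z))).bind (RegBeh.nth T) =
      (g.nth i).bind fun v => Beh.var (rightVar X Y Z v) := by
    intro i
    rw [Beh.bind_bind, Beh.bind_bind]
    refine Beh.bind_congr fun v hv => ?_
    have hv := RegBeh.lt_of_live_nth hv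
    rw [Beh.var_bind, nth_beta, rightVar]
    simp only [show ¬ X.2 + Y.1 + v < X.2 by omega, show ¬ X.2 + Y.1 + v < X.2 + Y.1 by omega,
      if_false]
    by_cases h : v < Y.2
    · rw [if_pos (by omega), if_pos h, Beh.var_bind, hTn _ (by omega), if_neg (by omega)]
      congr 1
      omega
    · rw [if_neg (by omega), if_neg h, if_pos (by omega), Beh.var_bind, hTn _ (by omega),
        if_pos (by omega)]
      congr 1
      omega
  have hop : ∀ i, RegBeh.nth (RegBeh.oplus f g) i = if i < X.1 + Y.2 then f.nth i
      else (g.nth (i - (X.1 + Y.2))).bind fun v => Beh.var (X.2 + Y.1 + v) :=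
    RegBeh.nth_oplus _ _
  refine ⟨RegBeh.comp K T, fun i hi => ?_, fun i hi => ?_, fun i hi => ?_, fun i hi => ?_,
    fun i hi => ?_⟩
  · change RegBeh.nth (RegBeh.comp (RegBeh.vars (Fin.castAdd _)) (RegBeh.dagger _ _ _)) i = _
    rw [RegBeh.nth_comp, RegBeh.nth_vars, dif_pos hi, Beh.var_bind]
    rfl
  · rw [hF, nth_alpha, if_pos hi, Beh.var_bind, hop, if_pos (by omega)]
    exact hleft i
  · rw [hF, nth_alpha, if_neg (by omega), if_pos (by omega), Beh.var_bind, hop,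
      if_neg (by omega)]
    refine Eq.trans ?_ (hright _)
    congr 4
    omega
  · rw [hF, nth_alpha, if_neg (by omega), if_neg (by omega), if_pos (by omega), Beh.var_bind,
      hop, if_pos (by omega)]
    refine Eq.trans ?_ (hleft _)
    congr 3
    omega
  · rw [hF, nth_alpha, if_neg (by omega), if_neg (by omega), if_neg (by omega),
      if_pos (by omega), Beh.var_bind, hop, if_neg (by omega)]
    refine Eq.trans ?_ (hright _)
    congr 4
    omega

theorem nth_mid (a b c d i : ℕ) :
    RegBeh.nth (RegBeh.mid (A := A) a b c d) i =
      if i < a then Beh.var i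
      else if i < a + b then Beh.var (a + c + (i - a))
      else if i < a + b + c then Beh.var (a + (i - (a + b)))
      else if i < a + b + c + d then Beh.var (a + c + b + (i - (a + b + c)))
      else Beh.zero := by
  simp only [RegBeh.mid, RegBeh.nth_vars, Fin.val_addCases]
  split_ifs <;> first | omega | rfl | (simp; try congr 1; try omega)

/-- The variables of `f` in `f ⊗ g`. -/
def leftTensVar (X Z : ℕ × ℕ) (v : ℕ) : ℕ := if v < X.2 then v else Z.2 + v

/-- The variables of `g` in `f ⊗ g`. -/
def rightTensVar (X Y Z : ℕ × ℕ) (v : ℕ) : ℕ := if v < Z.2 then X.2 + v else X.2 + Y.1 + v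

theorem nth_tens {X Y Z W : ℕ × ℕ} (f : IntHom A X Y) (g : IntHom A Z W) :
    (∀ i, i < X.1 →
      (f.tens g).nth i = (f.nth i).bind fun v => Beh.var (leftTensVar X Z v)) ∧
    (∀ i, i < Z.1 →
      (f.tens g).nth (X.1 + i) = (g.nth i).bind fun v => Beh.var (rightTensVar X Y Z v)) ∧
    (∀ i, i < Y.2 → (f.tens g).nth (X.1 + Z.1 + i) =
      (f.nth (X.1 + i)).bind fun v => Beh.var (leftTensVar X Z v)) ∧
    (∀ i, i < W.2 → (f.tens g).nth (X.1 + Z.1 + (Y.2 + i)) =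
      (g.nth (Z.1 + i)).bind fun v => Beh.var (rightTensVar X Y Z v)) := by
  have hF : ∀ i, (f.tens g).nth i =
      ((RegBeh.nth (RegBeh.mid X.1 Z.1 Y.2 W.2) i).bind (RegBeh.nth (RegBeh.oplus f g))).bind
        (RegBeh.nth (RegBeh.mid X.2 Y.1 Z.2 W.1)) := by
    intro i
    change RegBeh.nth (RegBeh.comp (RegBeh.comp _ _) _) i = _
    rw [RegBeh.nth_comp, RegBeh.nth_comp]
  have hleft : ∀ i, (f.nth i).bind (RegBeh.nth (RegBeh.mid X.2 Y.1 Z.2 W.1)) =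
      (f.nth i).bind fun v => Beh.var (leftTensVar X Z v) := by
    intro i
    refine Beh.bind_congr fun v hv => ?_
    have hv := RegBeh.lt_of_live_nth hv
    rw [nth_mid, leftTensVar]
    split_ifs
    · rfl
    · congr 1
      omega
  have hright : ∀ i, ((g.nth i).bind fun v => Beh.var (X.2 + Y.1 + v)).bind
      (RegBeh.nth (RegBeh.mid X.2 Y.1 Z.2 W.1)) =
      (g.nth i).bind fun v => Beh.var (rightTensVar X Y Z v) := by
    intro i
    rw [Beh.bind_bind]
    refine Beh.bind_congr fun v hv => ?_
    have hv := RegBeh.lt_of_live_nth hv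
    rw [Beh.var_bind, nth_mid, rightTensVar, if_neg (by omega), if_neg (by omega)]
    by_cases h : v < Z.2
    · rw [if_pos (by omega), if_pos h]
      congr 1
      omega
    · rw [if_neg (by omega), if_neg h, if_pos (by omega)]
      congr 1
      omega
  have hop : ∀ i, RegBeh.nth (RegBeh.oplus f g) i = if i < X.1 + Y.2 then f.nth i
      else (g.nth (i - (X.1 + Y.2))).bind fun v => Beh.var (X.2 + Y.1 + v) :=
    RegBeh.nth_oplus _ _
  refine ⟨fun i hi => ?_, fun i hi => ?_, fun i hi => ?_, fun i hi => ?_⟩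
  · rw [hF, nth_mid, if_pos hi, Beh.var_bind, hop, if_pos (by omega)]
    exact hleft i
  · rw [hF, nth_mid, if_neg (by omega), if_pos (by omega), Beh.var_bind, hop,
      if_neg (by omega)]
    refine Eq.trans ?_ (hright _)
    congr 3
    omega
  · rw [hF, nth_mid, if_neg (by omega), if_neg (by omega), if_pos (by omega), Beh.var_bind,
      hop, if_pos (by omega)]
    refine Eq.trans ?_ (hleft _)
    congr 2
    omega
  · rw [hF, nth_mid, if_neg (by omega), if_neg (by omega), if_neg (by omega),
      if_pos (by omega), Beh.var_bind, hop, if_neg (by omega)]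
    refine Eq.trans ?_ (hright _)
    congr 3
    omega

end IntHom

/-! ### Wires and the laws that need no genuine feedback -/

namespace IntHom

variable {A : Type*}

open Beh (beta)

theorem feed_leftVar_of_lt {X Y Z : ℕ × ℕ} {v : ℕ} (h : v < X.2) (D : ℕ → Beh A) :
    Beh.feed (X.2 + Z.1) D (leftVar X Y Z v) = Beh.var v := by
  rw [leftVar, if_pos h, Beh.feed_of_lt (by omega)]

theorem feed_leftVar_add {X Y Z : ℕ × ℕ} (v : ℕ) (D : ℕ → Beh A) :
    Beh.feed (X.2 + Z.1) D (leftVar X Y Z (X.2 + v)) = D (X.1 + Z.2 + (Y.2 + v)) := by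
  rw [leftVar, if_neg (by omega), Beh.feed_add, Nat.add_sub_cancel_left]

theorem feed_rightVar_of_lt {X Y Z : ℕ × ℕ} {v : ℕ} (h : v < Y.2) (D : ℕ → Beh A) :
    Beh.feed (X.2 + Z.1) D (rightVar X Y Z v) = D (X.1 + Z.2 + v) := by
  rw [rightVar, if_pos h, Beh.feed_add]

theorem feed_rightVar_add {X Y Z : ℕ × ℕ} {v : ℕ} (h : v < Z.1) (D : ℕ → Beh A) :
    Beh.feed (X.2 + Z.1) D (rightVar X Y Z (Y.2 + v)) = Beh.var (X.2 + v) := by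
  rw [rightVar, if_neg (by omega), Nat.add_sub_cancel_left, Beh.feed_of_lt (by omega)]

/-- These fixpoint equations do not record which solution is meant. They suffice when one factor
consists of wires, because then they can be solved by successive substitution. -/
theorem exists_comp_solution {X Y Z : ℕ × ℕ} (f : IntHom A X Y) (g : IntHom A Y Z) :
    ∃ D : ℕ → Beh A,
      (∀ i, i < X.1 + Z.2 → (f.comp g).nth i = D i) ∧
      (∀ i, i < X.1 →
        D i = (f.nth i).bind fun v => Beh.feed (X.2 + Z.1) D (leftVar X Y Z v)) ∧
      (∀ i, i < Z.2 →
        D (X.1 + i) =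
          (g.nth (Y.1 + i)).bind fun v => Beh.feed (X.2 + Z.1) D (rightVar X Y Z v)) ∧
      (∀ i, i < Y.2 →
        D (X.1 + Z.2 + i) =
          (f.nth (X.1 + i)).bind fun v => Beh.feed (X.2 + Z.1) D (leftVar X Y Z v)) ∧
      (∀ i, i < Y.1 →
        D (X.1 + Z.2 + (Y.2 + i)) =
          (g.nth i).bind fun v => Beh.feed (X.2 + Z.1) D (rightVar X Y Z v)) := by
  obtain ⟨F, h0, h1, h2, h3, h4⟩ := exists_comp_system f g
  refine ⟨RegBeh.nth (RegBeh.dagger _ _ F), h0, fun i hi => ?_, fun i hi => ?_, fun i hi => ?_,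
    fun i hi => ?_⟩
  · rw [RegBeh.nth_dagger_eq, h1 i hi, Beh.bind_bind]
    simp only [Beh.var_bind]
  · rw [RegBeh.nth_dagger_eq, h2 i hi, Beh.bind_bind]
    simp only [Beh.var_bind]
  · rw [RegBeh.nth_dagger_eq, h3 i hi, Beh.bind_bind]
    simp only [Beh.var_bind]
  · rw [RegBeh.nth_dagger_eq, h4 i hi, Beh.bind_bind]
    simp only [Beh.var_bind]

/-- The morphism `f` consists of wires; the wire from `X⁺ᵢ` leads to `Y⁺_{ρ i}`, the one from `Y⁻ⱼ`
to `X⁻_{τ j}`. -/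
structure IsWire {X Y : ℕ × ℕ} (f : IntHom A X Y) (ρ τ : ℕ → ℕ) : Prop where
  pos_lt : ∀ i, i < X.1 → ρ i < Y.1
  neg_lt : ∀ j, j < Y.2 → τ j < X.2
  pos : ∀ i, i < X.1 → f.nth i = Beh.var (X.2 + ρ i)
  neg : ∀ j, j < Y.2 → f.nth (X.1 + j) = Beh.var (τ j)

theorem ext_pos_neg {X Y : ℕ × ℕ} {f g : IntHom A X Y} (h : ∀ i, i < X.1 → f.nth i = g.nth i)
    (h' : ∀ j, j < Y.2 → f.nth (X.1 + j) = g.nth (X.1 + j)) : f = g := by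
  refine ext_nth fun i hi => ?_
  rcases lt_or_ge i X.1 with hX | hX
  · exact h i hX
  · obtain ⟨j, rfl⟩ := Nat.exists_eq_add_of_le hX
    exact h' j (by omega)

theorem IsWire.unique {X Y : ℕ × ℕ} {f g : IntHom A X Y} {ρ τ ρ' τ' : ℕ → ℕ}
    (hf : f.IsWire ρ τ) (hg : g.IsWire ρ' τ') (hρ : ∀ i, i < X.1 → ρ i = ρ' i)
    (hτ : ∀ j, j < Y.2 → τ j = τ' j) : f = g :=
  ext_pos_neg (fun i hi => by rw [hf.pos i hi, hg.pos i hi, hρ i hi])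
    (fun j hj => by rw [hf.neg j hj, hg.neg j hj, hτ j hj])

theorem IsWire.cast {X X' Y Y' : ℕ × ℕ} (hX : X = X') (hY : Y = Y') {f : IntHom A X Y}
    {ρ τ : ℕ → ℕ} (hf : f.IsWire ρ τ) : (f.cast hX hY).IsWire ρ τ := by
  subst hX hY
  exact hf

theorem isWire_id (X : ℕ × ℕ) : (IntHom.id (A := A) X).IsWire (fun i => i) fun j => j := by
  refine ⟨fun _ h => h, fun _ h => h, fun i hi => ?_, fun j hj => ?_⟩
  · simp only [nth, IntHom.id, RegBeh.swap, RegBeh.nth_vars, Fin.val_addCases]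
    rw [dif_pos (by omega), dif_pos hi]
    rfl
  · simp only [nth, IntHom.id, RegBeh.swap, RegBeh.nth_vars, Fin.val_addCases]
    rw [dif_pos (by omega), dif_neg (by omega)]
    simp

theorem isWire_sym (X Y : ℕ × ℕ) : (IntHom.sym (A := A) X Y).IsWire
    (fun i => if i < X.1 then Y.1 + i else i - X.1)
    (fun j => if j < Y.2 then X.2 + j else j - Y.2) := by
  have hX : (X + Y).1 = X.1 + Y.1 := rfl
  have hX' : (X + Y).2 = X.2 + Y.2 := rfl
  have hY : (Y + X).1 = Y.1 + X.1 := rfl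
  have hY' : (Y + X).2 = Y.2 + X.2 := rfl
  refine ⟨fun i hi => ?_, fun j hj => ?_, fun i hi => ?_, fun j hj => ?_⟩
  · split_ifs <;> omega
  · split_ifs <;> omega
  · simp only [nth, IntHom.sym]
    refine (RegBeh.nth_vars (m := X.1 + Y.1 + (Y.2 + X.2)) (n := X.2 + Y.2 + (Y.1 + X.1))
      _ _).trans ?_
    rw [dif_pos (by omega)]
    simp only [Fin.val_addCases]
    congr 1
    split_ifs <;> simp <;> omega
  · simp only [nth, IntHom.sym]
    refine (RegBeh.nth_vars (m := X.1 + Y.1 + (Y.2 + X.2)) (n := X.2 + Y.2 + (Y.1 + X.1))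
      _ _).trans ?_
    rw [dif_pos (by omega)]
    simp only [Fin.val_addCases]
    congr 1
    split_ifs <;> simp <;> omega

/-- A wire never turns back: what `f` sends into `w` leaves at `Z⁺`, and what `w` sends to `f` comes
from `Z⁻`. Hence the system unwinds without a cycle. -/
theorem nth_comp_wire {X Y Z : ℕ × ℕ} (f : IntHom A X Y) {w : IntHom A Y Z} {ρ τ : ℕ → ℕ}
    (hw : w.IsWire ρ τ) :
    (∀ i, i < X.1 → (f.comp w).nth i =
      (f.nth i).bind fun v => Beh.var (if v < X.2 then v else X.2 + ρ (v - X.2))) ∧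
    (∀ j, j < Z.2 → (f.comp w).nth (X.1 + j) = (f.nth (X.1 + τ j)).bind
      fun v => Beh.var (if v < X.2 then v else X.2 + ρ (v - X.2))) := by
  obtain ⟨D, h0, h1, h2, h3, h4⟩ := exists_comp_solution f w
  have key : ∀ i, ((f.nth i).bind fun v => Beh.feed (X.2 + Z.1) D (leftVar X Y Z v)) =
      (f.nth i).bind fun v => Beh.var (if v < X.2 then v else X.2 + ρ (v - X.2)) := by
    intro i
    refine Beh.bind_congr fun v hv => ?_
    have hv := RegBeh.lt_of_live_nth hv
    split_ifs with h
    · exact feed_leftVar_of_lt h D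
    · obtain ⟨y, rfl⟩ := Nat.exists_eq_add_of_le (not_lt.1 h)
      have hy : y < Y.1 := by omega
      rw [feed_leftVar_add, h4 y hy, hw.pos y hy, Beh.var_bind,
        feed_rightVar_add (hw.pos_lt y hy), Nat.add_sub_cancel_left]
  refine ⟨fun i hi => ?_, fun j hj => ?_⟩
  · rw [h0 i (by omega), h1 i hi, key]
  · rw [h0 _ (by omega), h2 j hj, hw.neg j hj, Beh.var_bind, feed_rightVar_of_lt (hw.neg_lt j hj),
      h3 _ (hw.neg_lt j hj), key]

theorem nth_wire_comp {X Y Z : ℕ × ℕ} {w : IntHom A X Y} (g : IntHom A Y Z) {ρ τ : ℕ → ℕ}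
    (hw : w.IsWire ρ τ) :
    (∀ i, i < X.1 → (w.comp g).nth i = (g.nth (ρ i)).bind
      fun v => Beh.var (if v < Y.2 then τ v else X.2 + (v - Y.2))) ∧
    (∀ j, j < Z.2 → (w.comp g).nth (X.1 + j) = (g.nth (Y.1 + j)).bind
      fun v => Beh.var (if v < Y.2 then τ v else X.2 + (v - Y.2))) := by
  obtain ⟨D, h0, h1, h2, h3, h4⟩ := exists_comp_solution w g
  have key : ∀ i, ((g.nth i).bind fun v => Beh.feed (X.2 + Z.1) D (rightVar X Y Z v)) =
      (g.nth i).bind fun v => Beh.var (if v < Y.2 then τ v else X.2 + (v - Y.2)) := by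
    intro i
    refine Beh.bind_congr fun v hv => ?_
    have hv := RegBeh.lt_of_live_nth hv
    split_ifs with h
    · rw [feed_rightVar_of_lt h, h3 v h, hw.neg v h, Beh.var_bind,
        feed_leftVar_of_lt (hw.neg_lt v h)]
    · obtain ⟨y, rfl⟩ := Nat.exists_eq_add_of_le (not_lt.1 h)
      rw [feed_rightVar_add (by omega), Nat.add_sub_cancel_left]
  refine ⟨fun i hi => ?_, fun j hj => ?_⟩
  · rw [h0 i (by omega), h1 i hi, hw.pos i hi, Beh.var_bind, feed_leftVar_add,
      h4 _ (hw.pos_lt i hi), key]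
  · rw [h0 _ (by omega), h2 j hj, key]

theorem IsWire.comp {X Y Z : ℕ × ℕ} {f : IntHom A X Y} {g : IntHom A Y Z} {ρ τ ρ' τ' : ℕ → ℕ}
    (hf : f.IsWire ρ τ) (hg : g.IsWire ρ' τ') :
    (f.comp g).IsWire (fun i => ρ' (ρ i)) fun j => τ (τ' j) := by
  obtain ⟨h1, h2⟩ := nth_comp_wire f hg
  refine ⟨fun i hi => hg.pos_lt _ (hf.pos_lt i hi), fun j hj => hf.neg_lt _ (hg.neg_lt j hj),
    fun i hi => ?_, fun j hj => ?_⟩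
  · rw [h1 i hi, hf.pos i hi, Beh.var_bind, if_neg (by omega), Nat.add_sub_cancel_left]
  · rw [h2 j hj, hf.neg _ (hg.neg_lt j hj), Beh.var_bind,
      if_pos (hf.neg_lt _ (hg.neg_lt j hj))]

theorem IsWire.tens {X Y Z W : ℕ × ℕ} {f : IntHom A X Y} {g : IntHom A Z W}
    {ρ τ ρ' τ' : ℕ → ℕ} (hf : f.IsWire ρ τ) (hg : g.IsWire ρ' τ') :
    (f.tens g).IsWire (fun i => if i < X.1 then ρ i else Y.1 + ρ' (i - X.1))
      fun j => if j < Y.2 then τ j else X.2 + τ' (j - Y.2) := by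
  have hX : (X + Z).1 = X.1 + Z.1 := rfl
  have hX' : (X + Z).2 = X.2 + Z.2 := rfl
  have hY : (Y + W).1 = Y.1 + W.1 := rfl
  have hY' : (Y + W).2 = Y.2 + W.2 := rfl
  obtain ⟨h1, h2, h3, h4⟩ := nth_tens f g
  refine ⟨fun i hi => ?_, fun j hj => ?_, fun i hi => ?_, fun j hj => ?_⟩
  · split_ifs with h
    · have := hf.pos_lt i h
      omega
    · have := hg.pos_lt (i - X.1) (by omega)
      omega
  · split_ifs with h
    · have := hf.neg_lt j h
      omega
    · have := hg.neg_lt (j - Y.2) (by omega)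
      omega
  · split_ifs with h
    · rw [h1 i h, hf.pos i h, Beh.var_bind, leftTensVar, if_neg (by omega)]
      congr 1
      omega
    · obtain ⟨k, rfl⟩ := Nat.exists_eq_add_of_le (not_lt.1 h)
      rw [h2 k (by omega), hg.pos k (by omega), Beh.var_bind, rightTensVar, if_neg (by omega),
        Nat.add_sub_cancel_left]
      congr 1
      omega
  · rw [hX]
    split_ifs with h
    · rw [h3 j h, hf.neg j h, Beh.var_bind, leftTensVar, if_pos (hf.neg_lt j h)]
    · obtain ⟨k, rfl⟩ := Nat.exists_eq_add_of_le (not_lt.1 h)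
      have := hg.neg_lt k (by omega)
      rw [h4 k (by omega), hg.neg k (by omega), Beh.var_bind, rightTensVar, if_pos this,
        Nat.add_sub_cancel_left]

theorem id_comp {X Y : ℕ × ℕ} (f : IntHom A X Y) : (IntHom.id X).comp f = f := by
  obtain ⟨h1, h2⟩ := nth_wire_comp f (isWire_id X)
  have key : ∀ i, ((f.nth i).bind fun v => Beh.var (if v < X.2 then v else X.2 + (v - X.2))) =
      f.nth i := by
    intro i
    refine Eq.trans (Beh.bind_congr fun v _ => ?_) (Beh.bind_var _)
    congr 1
    split_ifs <;> omega
  exact ext_pos_neg (fun i hi => by rw [h1 i hi, key]) fun j hj => by rw [h2 j hj, key]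

theorem comp_id {X Y : ℕ × ℕ} (f : IntHom A X Y) : f.comp (IntHom.id Y) = f := by
  obtain ⟨h1, h2⟩ := nth_comp_wire f (isWire_id Y)
  have key : ∀ i, ((f.nth i).bind fun v => Beh.var (if v < X.2 then v else X.2 + (v - X.2))) =
      f.nth i := by
    intro i
    refine Eq.trans (Beh.bind_congr fun v _ => ?_) (Beh.bind_var _)
    congr 1
    split_ifs <;> omega
  exact ext_pos_neg (fun i hi => by rw [h1 i hi, key]) fun j hj => by rw [h2 j hj, key]

theorem tens_id (X Y : ℕ × ℕ) :
    (IntHom.id X).tens (IntHom.id Y) = IntHom.id (A := A) (X + Y) := by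
  refine ((isWire_id X).tens (isWire_id Y)).unique (isWire_id (X + Y)) (fun i _ => ?_)
    fun j _ => ?_
  · split_ifs <;> omega
  · split_ifs <;> omega

theorem sym_sym (X Y : ℕ × ℕ) :
    (IntHom.sym X Y).comp (IntHom.sym Y X) = IntHom.id (A := A) (X + Y) := by
  have hX : (X + Y).1 = X.1 + Y.1 := rfl
  have hX' : (X + Y).2 = X.2 + Y.2 := rfl
  refine ((isWire_sym X Y).comp (isWire_sym Y X)).unique (isWire_id (X + Y)) (fun i _ => ?_)
    fun j _ => ?_
  · split_ifs <;> omega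
  · split_ifs <;> omega

/-- Reasoning by cases about the tensor product of two morphisms. -/
theorem ext_tens {X Y Z W : ℕ × ℕ} {f g : IntHom A (X + Z) (Y + W)}
    (h1 : ∀ i, i < X.1 → f.nth i = g.nth i)
    (h2 : ∀ i, i < Z.1 → f.nth (X.1 + i) = g.nth (X.1 + i))
    (h3 : ∀ i, i < Y.2 → f.nth (X.1 + Z.1 + i) = g.nth (X.1 + Z.1 + i))
    (h4 : ∀ i, i < W.2 → f.nth (X.1 + Z.1 + (Y.2 + i)) = g.nth (X.1 + Z.1 + (Y.2 + i))) :
    f = g := by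
  refine ext_pos_neg (fun i hi => ?_) (fun i hi => ?_)
  · have hi : i < X.1 + Z.1 := hi
    rcases lt_or_ge i X.1 with h | h
    · exact h1 i h
    · obtain ⟨k, rfl⟩ := Nat.exists_eq_add_of_le h
      exact h2 k (by omega)
  · have hi : i < Y.2 + W.2 := hi
    rcases lt_or_ge i Y.2 with h | h
    · exact h3 i h
    · obtain ⟨k, rfl⟩ := Nat.exists_eq_add_of_le h
      exact h4 k (by omega)

/-- Composing with wires renames variables, so each component on either side is a renamed component
of `f` or `g`. The renamings need to agree only within the arity, where the live variables lie. -/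
theorem sym_natural {X Y Z W : ℕ × ℕ} (f : IntHom A X Y) (g : IntHom A Z W) :
    (f.tens g).comp (IntHom.sym Y W) = (IntHom.sym X Z).comp (g.tens f) := by
  have e1 : ∀ X Y : ℕ × ℕ, (X + Y).1 = X.1 + Y.1 := fun _ _ => rfl
  have e2 : ∀ X Y : ℕ × ℕ, (X + Y).2 = X.2 + Y.2 := fun _ _ => rfl
  obtain ⟨h1, h2⟩ := nth_comp_wire (f.tens g) (isWire_sym Y W)
  obtain ⟨k1, k2⟩ := nth_wire_comp (g.tens f) (isWire_sym X Z)
  obtain ⟨a1, a2, a3, a4⟩ := nth_tens f g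
  obtain ⟨b1, b2, b3, b4⟩ := nth_tens g f
  have hf : ∀ i, (((f.nth i).bind fun v => Beh.var (leftTensVar X Z v)).bind fun v =>
      Beh.var (if v < (X + Z).2 then v else (X + Z).2 +
        if v - (X + Z).2 < Y.1 then W.1 + (v - (X + Z).2) else v - (X + Z).2 - Y.1)) =
      ((f.nth i).bind fun v => Beh.var (rightTensVar Z W X v)).bind fun v =>
      Beh.var (if v < (Z + X).2 then (if v < Z.2 then X.2 + v else v - Z.2) else
        (X + Z).2 + (v - (Z + X).2)) := by
    intro i
    rw [Beh.bind_bind, Beh.bind_bind]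
    refine Beh.bind_congr fun v hv => ?_
    have hv := RegBeh.lt_of_live_nth hv
    rw [Beh.var_bind, Beh.var_bind, e2, e2, leftTensVar, rightTensVar]
    congr 1
    split_ifs <;> omega
  have hg : ∀ i, (((g.nth i).bind fun v => Beh.var (rightTensVar X Y Z v)).bind fun v =>
      Beh.var (if v < (X + Z).2 then v else (X + Z).2 +
        if v - (X + Z).2 < Y.1 then W.1 + (v - (X + Z).2) else v - (X + Z).2 - Y.1)) =
      ((g.nth i).bind fun v => Beh.var (leftTensVar Z X v)).bind fun v =>
      Beh.var (if v < (Z + X).2 then (if v < Z.2 then X.2 + v else v - Z.2) else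
        (X + Z).2 + (v - (Z + X).2)) := by
    intro i
    rw [Beh.bind_bind, Beh.bind_bind]
    refine Beh.bind_congr fun v hv => ?_
    have hv := RegBeh.lt_of_live_nth hv
    rw [Beh.var_bind, Beh.var_bind, e2, e2, leftTensVar, rightTensVar]
    congr 1
    split_ifs <;> omega
  refine ext_tens (fun i hi => ?_) (fun i hi => ?_) (fun i hi => ?_) (fun i hi => ?_)
  · rw [h1 i (by rw [e1]; omega), k1 i (by rw [e1]; omega), if_pos hi, a1 i hi, b2 i hi, hf]
  · rw [h1 _ (by rw [e1]; omega), k1 _ (by rw [e1]; omega), if_neg (by omega), a2 i hi,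
      Nat.add_sub_cancel_left, b1 i hi, hg]
  · have h := h2 i (by rw [e2]; omega)
    have k := k2 i (by rw [e2]; omega)
    rw [if_pos hi] at h
    rw [e1] at h k
    rw [h, k, a4 i hi, e1, b3 i hi, hg]
  · have h := h2 (W.2 + i) (by rw [e2]; omega)
    have k := k2 (W.2 + i) (by rw [e2]; omega)
    rw [if_neg (by omega), Nat.add_sub_cancel_left] at h
    rw [e1] at h k
    rw [h, k, a3 i hi, e1, b4 i hi, hf]

theorem tens_assoc {X₁ Y₁ X₂ Y₂ X₃ Y₃ : ℕ × ℕ} (f : IntHom A X₁ Y₁) (g : IntHom A X₂ Y₂)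
    (h : IntHom A X₃ Y₃) :
    ((f.tens g).tens h).cast (add_assoc X₁ X₂ X₃) (add_assoc Y₁ Y₂ Y₃) = f.tens (g.tens h) := by
  have e1 : ∀ X Y : ℕ × ℕ, (X + Y).1 = X.1 + Y.1 := fun _ _ => rfl
  have e2 : ∀ X Y : ℕ × ℕ, (X + Y).2 = X.2 + Y.2 := fun _ _ => rfl
  obtain ⟨a1, a2, a3, a4⟩ := nth_tens (f.tens g) h
  obtain ⟨b1, b2, b3, b4⟩ := nth_tens f g
  obtain ⟨c1, c2, c3, c4⟩ := nth_tens f (g.tens h)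
  obtain ⟨d1, d2, d3, d4⟩ := nth_tens g h
  simp only [e1, e2] at a1 a2 a3 a4 c1 c2 c3 c4
  have hf : ∀ i, (((f.nth i).bind fun v => Beh.var (leftTensVar X₁ X₂ v)).bind
      fun v => Beh.var (leftTensVar (X₁ + X₂) X₃ v)) =
      (f.nth i).bind fun v => Beh.var (leftTensVar X₁ (X₂ + X₃) v) := by
    intro i
    rw [Beh.bind_bind]
    refine Beh.bind_congr fun v hv => ?_
    have hv := RegBeh.lt_of_live_nth hv
    rw [Beh.var_bind]
    simp only [leftTensVar, e2]
    congr 1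
    split_ifs <;> omega
  have hg : ∀ i, (((g.nth i).bind fun v => Beh.var (rightTensVar X₁ Y₁ X₂ v)).bind
      fun v => Beh.var (leftTensVar (X₁ + X₂) X₃ v)) =
      ((g.nth i).bind fun v => Beh.var (leftTensVar X₂ X₃ v)).bind
        fun v => Beh.var (rightTensVar X₁ Y₁ (X₂ + X₃) v) := by
    intro i
    rw [Beh.bind_bind, Beh.bind_bind]
    refine Beh.bind_congr fun v hv => ?_
    have hv := RegBeh.lt_of_live_nth hv
    rw [Beh.var_bind, Beh.var_bind]
    simp only [leftTensVar, rightTensVar, e2]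
    congr 1
    split_ifs <;> omega
  have hh : ∀ i, ((h.nth i).bind fun v => Beh.var (rightTensVar (X₁ + X₂) (Y₁ + Y₂) X₃ v)) =
      ((h.nth i).bind fun v => Beh.var (rightTensVar X₂ Y₂ X₃ v)).bind
        fun v => Beh.var (rightTensVar X₁ Y₁ (X₂ + X₃) v) := by
    intro i
    rw [Beh.bind_bind]
    refine Beh.bind_congr fun v hv => ?_
    have hv := RegBeh.lt_of_live_nth hv
    rw [Beh.var_bind]
    simp only [rightTensVar, e1, e2]
    congr 1
    split_ifs <;> omega
  refine ext_tens (fun i hi => ?_) (fun i hi => ?_) (fun i hi => ?_) (fun i hi => ?_) <;>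
    rw [nth_cast]
  · rw [a1 i (by omega), b1 i hi, c1 i hi, hf]
  · rw [e1] at hi
    rw [c2 i hi]
    rcases lt_or_ge i X₂.1 with hi' | hi'
    · rw [a1 _ (by omega), b2 i hi', d1 i hi', hg]
    · obtain ⟨k, rfl⟩ := Nat.exists_eq_add_of_le hi'
      rw [← Nat.add_assoc, a2 k (by omega), d2 k (by omega), hh]
  · rw [e1, c3 i hi, ← Nat.add_assoc, a3 i (by omega), b3 i hi, hf]
  · rw [e2] at hi
    rw [e1, c4 i hi, ← Nat.add_assoc X₁.1]
    rcases lt_or_ge i Y₂.2 with hi' | hi'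
    · rw [a3 _ (by omega), b4 i hi', d3 i hi', hg]
    · obtain ⟨k, rfl⟩ := Nat.exists_eq_add_of_le hi'
      rw [← Nat.add_assoc Y₁.2, a4 k (by omega), d4 k (by omega), hh]

theorem id_tens {X Y : ℕ × ℕ} (f : IntHom A X Y) :
    ((IntHom.id (0, 0)).tens f).cast (zero_add X) (zero_add Y) = f := by
  obtain ⟨-, h2, -, h4⟩ := nth_tens (IntHom.id (A := A) (0, 0)) f
  have key : ∀ i, ((f.nth i).bind fun v => Beh.var (rightTensVar (0, 0) (0, 0) X v)) =
      f.nth i := by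
    intro i
    refine Eq.trans (Beh.bind_congr fun v _ => ?_) (Beh.bind_var _)
    simp [rightTensVar]
  simp only [Nat.zero_add] at h2 h4
  refine ext_pos_neg (fun i hi => ?_) fun i hi => ?_ <;> rw [nth_cast]
  · rw [h2 i hi, key]
  · rw [h4 i hi, key]

theorem tens_unit {X Y : ℕ × ℕ} (f : IntHom A X Y) :
    (f.tens (IntHom.id (0, 0))).cast (add_zero X) (add_zero Y) = f := by
  obtain ⟨h1, -, h3, -⟩ := nth_tens f (IntHom.id (A := A) (0, 0))
  have key : ∀ i, ((f.nth i).bind fun v => Beh.var (leftTensVar X (0, 0) v)) = f.nth i := by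
    intro i
    refine Eq.trans (Beh.bind_congr fun v _ => ?_) (Beh.bind_var _)
    simp [leftTensVar]
  simp only [Nat.add_zero] at h3
  refine ext_pos_neg (fun i hi => ?_) fun i hi => ?_ <;> rw [nth_cast]
  · rw [h1 i hi, key]
  · rw [h3 i hi, key]

end IntHom

/-! ### Graphs that present morphisms -/

open Relation (ReflTransGen)

/-- A graph with silent and labelled edges. Its ports are numbered; `domIn` and `codIn` are its
entries, `domOut` and `codOut` its exits. -/
structure PortGraph (A : Type*) where
  Node : Type*
  eps : Node → Node → Prop
  act : Node → A → Node → Prop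
  domIn : ℕ → Node
  domOut : ℕ → Node
  codIn : ℕ → Node
  codOut : ℕ → Node

namespace PortGraph

variable {A : Type*}

open Beh (beta)

/-- The node `m` is an exit of the graph, with the variable `w`. -/
def IsExit (G : PortGraph A) (X Y : ℕ × ℕ) (m : G.Node) (w : ℕ) : Prop :=
  (w < X.2 ∧ m = G.domOut w) ∨ ∃ v, v < Y.1 ∧ m = G.codOut v ∧ w = X.2 + v

/-- The observations made at a node itself. -/
def Emit (G : PortGraph A) (X Y : ℕ × ℕ) (b : G.Node → Beh A) (m : G.Node)
    (e : A × Beh A ⊕ ℕ) : Prop :=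
  (∃ a n, G.act m a n ∧ e = .inl (a, b n)) ∨ ∃ w, G.IsExit X Y m w ∧ e = .inr w

/-- `b` assigns to each node its behaviour. -/
def Realizes (G : PortGraph A) (X Y : ℕ × ℕ) (b : G.Node → Beh A) : Prop :=
  ∀ n e, e ∈ beta (b n) ↔ ∃ m, ReflTransGen G.eps n m ∧ G.Emit X Y b m e

/-- The graph `G` presents the morphism `f`. -/
def Presents (G : PortGraph A) {X Y : ℕ × ℕ} (f : IntHom A X Y) : Prop :=
  ∃ b, G.Realizes X Y b ∧ (∀ i, i < X.1 → b (G.domIn i) = f.nth i) ∧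
    ∀ i, i < Y.2 → b (G.codIn i) = f.nth (X.1 + i)

variable {G H K : PortGraph A} {X Y Z W : ℕ × ℕ}

theorem Realizes.inr_mem {b : G.Node → Beh A} (h : G.Realizes X Y b) {n : G.Node} {w : ℕ} :
    .inr w ∈ beta (b n) ↔ ∃ m, ReflTransGen G.eps n m ∧ G.IsExit X Y m w := by
  rw [h]
  refine exists_congr fun m => and_congr_right fun _ => ?_
  constructor
  · rintro (⟨_, _, _, h⟩ | ⟨w', h, h'⟩)
    · cases h
    · cases h'
      exact h
  · exact fun h => Or.inr ⟨w, h, rfl⟩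

theorem Realizes.inl_mem {b : G.Node → Beh A} (h : G.Realizes X Y b) {n : G.Node} {a : A}
    {y : Beh A} : .inl (a, y) ∈ beta (b n) ↔
      ∃ m n', ReflTransGen G.eps n m ∧ G.act m a n' ∧ y = b n' := by
  rw [h]
  constructor
  · rintro ⟨m, hm, ⟨a', n', h, h'⟩ | ⟨w', h, h'⟩⟩
    · cases h'
      exact ⟨m, n', hm, h, rfl⟩
    · cases h'
  · rintro ⟨m, n', hm, h, rfl⟩
    exact ⟨m, hm, Or.inl ⟨a, n', h, rfl⟩⟩

/-- Closure under single edges gives one inclusion by induction along silent paths; only the other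
one requires paths to be exhibited. -/
theorem Realizes.of_closed {b : G.Node → Beh A}
    (h1 : ∀ n n', G.eps n n' → beta (b n') ⊆ beta (b n))
    (h2 : ∀ n a n', G.act n a n' → .inl (a, b n') ∈ beta (b n))
    (h3 : ∀ n w, G.IsExit X Y n w → .inr w ∈ beta (b n))
    (h4 : ∀ n e, e ∈ beta (b n) → ∃ m, ReflTransGen G.eps n m ∧ G.Emit X Y b m e) :
    G.Realizes X Y b := by
  refine fun n e => ⟨h4 n e, ?_⟩
  rintro ⟨m, hm, he⟩
  induction hm using ReflTransGen.head_induction_on with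
  | refl =>
    rcases he with ⟨a, n', h, rfl⟩ | ⟨w, h, rfl⟩
    · exact h2 _ a n' h
    · exact h3 _ w h
  | head h _ ih => exact h1 _ _ h ih

theorem Realizes.beta_mono {b : G.Node → Beh A} (h : G.Realizes X Y b) {n n' : G.Node}
    (h' : G.eps n n') : beta (b n') ⊆ beta (b n) := by
  intro e he
  obtain ⟨m, hm, he⟩ := (h n' e).1 he
  exact (h n e).2 ⟨m, .head h' hm, he⟩

/-- Weak simulations between graphs. -/
structure Sim (G H : PortGraph A) (X Y : ℕ × ℕ) (R : G.Node → H.Node → Prop) : Prop where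
  eps : ∀ n m, R n m → ∀ n', G.eps n n' → ∃ m', ReflTransGen H.eps m m' ∧ R n' m'
  act : ∀ n m, R n m → ∀ a n', G.act n a n' →
    ∃ m₁ m', ReflTransGen H.eps m m₁ ∧ H.act m₁ a m' ∧ R n' m'
  exit : ∀ n m, R n m → ∀ w, G.IsExit X Y n w → ∃ m', ReflTransGen H.eps m m' ∧ H.IsExit X Y m' w

theorem Sim.path {R : G.Node → H.Node → Prop} (h : Sim G H X Y R) {n n' : G.Node}
    (hn : ReflTransGen G.eps n n') {m : H.Node} (r : R n m) :
    ∃ m', ReflTransGen H.eps m m' ∧ R n' m' := by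
  induction hn with
  | refl => exact ⟨m, .refl, r⟩
  | tail _ h' ih =>
    obtain ⟨m₁, h₁, r₁⟩ := ih
    obtain ⟨m₂, h₂, r₂⟩ := h.eps _ _ r₁ _ h'
    exact ⟨m₂, h₁.trans h₂, r₂⟩

/-- Behaviours of nodes absorb silent paths, so a weak bisimulation between nodes becomes a strong
bisimulation between their behaviours. -/
theorem eq_of_sim {f g : IntHom A X Y} (hf : G.Presents f) (hg : H.Presents g)
    (R : G.Node → H.Node → Prop) (h : Sim G H X Y R) (h' : Sim H G X Y fun m n => R n m)
    (hd : ∀ i, i < X.1 → R (G.domIn i) (H.domIn i))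
    (hc : ∀ i, i < Y.2 → R (G.codIn i) (H.codIn i)) : f = g := by
  obtain ⟨b, hb, fd, fc⟩ := hf
  obtain ⟨c, hc', gd, gc⟩ := hg
  have key : ∀ n m, R n m → b n = c m := by
    intro n m r
    refine Beh.eq_of_bisim (fun x y => ∃ n m, R n m ∧ x = b n ∧ y = c m) ?_ ⟨n, m, r, rfl, rfl⟩
    rintro _ _ ⟨n, m, r, rfl, rfl⟩
    refine ⟨fun w => ?_, fun a x hx => ?_, fun a x hx => ?_⟩
    · rw [hb.inr_mem, hc'.inr_mem]
      constructor
      · rintro ⟨n', hn, he⟩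
        obtain ⟨m', hm, r'⟩ := h.path hn r
        obtain ⟨m'', hm', he'⟩ := h.exit _ _ r' w he
        exact ⟨m'', hm.trans hm', he'⟩
      · rintro ⟨n', hn, he⟩
        obtain ⟨m', hm, r'⟩ := h'.path hn r
        obtain ⟨m'', hm', he'⟩ := h'.exit _ _ r' w he
        exact ⟨m'', hm.trans hm', he'⟩
    · obtain ⟨n₁, n₂, hn, ha, rfl⟩ := hb.inl_mem.1 hx
      obtain ⟨m₁, hm, r₁⟩ := h.path hn r
      obtain ⟨m₂, m₃, hm', ha', r₂⟩ := h.act _ _ r₁ _ _ ha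
      exact ⟨_, hc'.inl_mem.2 ⟨m₂, m₃, hm.trans hm', ha', rfl⟩, Or.inl ⟨_, _, r₂, rfl, rfl⟩⟩
    · obtain ⟨n₁, n₂, hn, ha, rfl⟩ := hc'.inl_mem.1 hx
      obtain ⟨m₁, hm, r₁⟩ := h'.path hn r
      obtain ⟨m₂, m₃, hm', ha', r₂⟩ := h'.act _ _ r₁ _ _ ha
      exact ⟨_, hb.inl_mem.2 ⟨m₂, m₃, hm.trans hm', ha', rfl⟩, Or.inl ⟨_, _, r₂, rfl, rfl⟩⟩
  exact IntHom.ext_pos_neg (fun i hi => by rw [← fd i hi, ← gd i hi, key _ _ (hd i hi)])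
    fun i hi => by rw [← fc i hi, ← gc i hi, key _ _ (hc i hi)]

theorem eq_of_iso {f g : IntHom A X Y} (hf : G.Presents f) (hg : H.Presents g)
    (φ : G.Node ≃ H.Node) (heps : ∀ n n', G.eps n n' ↔ H.eps (φ n) (φ n'))
    (hact : ∀ n a n', G.act n a n' ↔ H.act (φ n) a (φ n'))
    (hdi : ∀ i, i < X.1 → φ (G.domIn i) = H.domIn i)
    (hdo : ∀ i, i < X.2 → φ (G.domOut i) = H.domOut i)
    (hci : ∀ i, i < Y.2 → φ (G.codIn i) = H.codIn i)
    (hco : ∀ i, i < Y.1 → φ (G.codOut i) = H.codOut i) : f = g := by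
  refine eq_of_sim hf hg (fun n m => φ n = m) ⟨?_, ?_, ?_⟩ ⟨?_, ?_, ?_⟩ hdi hci
  · rintro n _ rfl n' h
    exact ⟨φ n', .single ((heps _ _).1 h), rfl⟩
  · rintro n _ rfl a n' h
    exact ⟨φ n, φ n', .refl, (hact _ _ _).1 h, rfl⟩
  · rintro n _ rfl w (⟨hw, rfl⟩ | ⟨v, hv, rfl, rfl⟩)
    · exact ⟨_, .refl, Or.inl ⟨hw, hdo w hw⟩⟩
    · exact ⟨_, .refl, Or.inr ⟨v, hv, hco v hv, rfl⟩⟩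
  · rintro _ n rfl m h
    obtain ⟨n', rfl⟩ := φ.surjective m
    exact ⟨n', .single ((heps _ _).2 h), rfl⟩
  · rintro _ n rfl a m h
    obtain ⟨n', rfl⟩ := φ.surjective m
    exact ⟨n, n', .refl, (hact _ _ _).2 h, rfl⟩
  · rintro _ n rfl w (⟨hw, h⟩ | ⟨v, hv, h, rfl⟩)
    · exact ⟨n, .refl, Or.inl ⟨hw, φ.injective (h.trans (hdo w hw).symm)⟩⟩
    · exact ⟨n, .refl, Or.inr ⟨v, hv, φ.injective (h.trans (hco v hv).symm), rfl⟩⟩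

/-- Composition of graphs along the object `Y`. -/
def comp (Y : ℕ × ℕ) (G H : PortGraph A) : PortGraph A where
  Node := G.Node ⊕ H.Node
  eps
    | .inl n, .inl n' => G.eps n n'
    | .inr m, .inr m' => H.eps m m'
    | .inl n, .inr m => ∃ j, j < Y.1 ∧ n = G.codOut j ∧ m = H.domIn j
    | .inr m, .inl n => ∃ j, j < Y.2 ∧ m = H.domOut j ∧ n = G.codIn j
  act
    | .inl n, a, .inl n' => G.act n a n'
    | .inr m, a, .inr m' => H.act m a m'
    | .inl _, _, .inr _ => False
    | .inr _, _, .inl _ => False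
  domIn i := .inl (G.domIn i)
  domOut i := .inl (G.domOut i)
  codIn i := .inr (H.codIn i)
  codOut i := .inr (H.codOut i)

/-- Juxtaposition of graphs; `X → Y` is the type of the first one. -/
def tens (X Y : ℕ × ℕ) (G H : PortGraph A) : PortGraph A where
  Node := G.Node ⊕ H.Node
  eps
    | .inl n, .inl n' => G.eps n n'
    | .inr m, .inr m' => H.eps m m'
    | .inl _, .inr _ => False
    | .inr _, .inl _ => False
  act
    | .inl n, a, .inl n' => G.act n a n'
    | .inr m, a, .inr m' => H.act m a m'
    | .inl _, _, .inr _ => False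
    | .inr _, _, .inl _ => False
  domIn i := if i < X.1 then .inl (G.domIn i) else .inr (H.domIn (i - X.1))
  domOut i := if i < X.2 then .inl (G.domOut i) else .inr (H.domOut (i - X.2))
  codIn i := if i < Y.2 then .inl (G.codIn i) else .inr (H.codIn (i - Y.2))
  codOut i := if i < Y.1 then .inl (G.codOut i) else .inr (H.codOut (i - Y.1))

theorem tens_domIn_of_lt {i : ℕ} (h : i < X.1) :
    (G.tens X Y H).domIn i = (.inl (G.domIn i) : G.Node ⊕ H.Node) :=
  if_pos h

theorem tens_domIn_add (i : ℕ) :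
    (G.tens X Y H).domIn (X.1 + i) = (.inr (H.domIn i) : G.Node ⊕ H.Node) := by
  refine (if_neg (by omega)).trans ?_
  rw [Nat.add_sub_cancel_left]

theorem tens_domOut_of_lt {i : ℕ} (h : i < X.2) :
    (G.tens X Y H).domOut i = (.inl (G.domOut i) : G.Node ⊕ H.Node) :=
  if_pos h

theorem tens_domOut_add (i : ℕ) :
    (G.tens X Y H).domOut (X.2 + i) = (.inr (H.domOut i) : G.Node ⊕ H.Node) := by
  refine (if_neg (by omega)).trans ?_
  rw [Nat.add_sub_cancel_left]

theorem tens_codIn_of_lt {i : ℕ} (h : i < Y.2) :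
    (G.tens X Y H).codIn i = (.inl (G.codIn i) : G.Node ⊕ H.Node) :=
  if_pos h

theorem tens_codIn_add (i : ℕ) :
    (G.tens X Y H).codIn (Y.2 + i) = (.inr (H.codIn i) : G.Node ⊕ H.Node) := by
  refine (if_neg (by omega)).trans ?_
  rw [Nat.add_sub_cancel_left]

theorem tens_codOut_of_lt {i : ℕ} (h : i < Y.1) :
    (G.tens X Y H).codOut i = (.inl (G.codOut i) : G.Node ⊕ H.Node) :=
  if_pos h

theorem tens_codOut_add (i : ℕ) :
    (G.tens X Y H).codOut (Y.1 + i) = (.inr (H.codOut i) : G.Node ⊕ H.Node) := by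
  refine (if_neg (by omega)).trans ?_
  rw [Nat.add_sub_cancel_left]

theorem comp_path_inl {n n' : G.Node} (h : ReflTransGen G.eps n n') :
    ReflTransGen (G.comp Y H).eps (.inl n) (.inl n') :=
  ReflTransGen.lift (p := (G.comp Y H).eps) Sum.inl (fun _ _ h => h) _ _ h

theorem comp_path_inr {n n' : H.Node} (h : ReflTransGen H.eps n n') :
    ReflTransGen (G.comp Y H).eps (.inr n) (.inr n') :=
  ReflTransGen.lift (p := (G.comp Y H).eps) Sum.inr (fun _ _ h => h) _ _ h

theorem tens_path_inl {n n' : G.Node} (h : ReflTransGen G.eps n n') :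
    ReflTransGen (G.tens X Y H).eps (.inl n) (.inl n') :=
  ReflTransGen.lift (p := (G.tens X Y H).eps) Sum.inl (fun _ _ h => h) _ _ h

theorem tens_path_inr {n n' : H.Node} (h : ReflTransGen H.eps n n') :
    ReflTransGen (G.tens X Y H).eps (.inr n) (.inr n') :=
  ReflTransGen.lift (p := (G.tens X Y H).eps) Sum.inr (fun _ _ h => h) _ _ h

/-- No edge joins the two halves, so each node keeps its behaviour up to the renumbering of the
exits. -/
theorem Presents.tens {f : IntHom A X Y} {g : IntHom A Z W} (hf : G.Presents f)
    (hg : H.Presents g) : (G.tens X Y H).Presents (f.tens g) := by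
  obtain ⟨b, hb, fd, fc⟩ := hf
  obtain ⟨c, hc, gd, gc⟩ := hg
  obtain ⟨h1, h2, h3, h4⟩ := IntHom.nth_tens f g
  have e1 : ∀ X Y : ℕ × ℕ, (X + Y).1 = X.1 + Y.1 := fun _ _ => rfl
  have e2 : ∀ X Y : ℕ × ℕ, (X + Y).2 = X.2 + Y.2 := fun _ _ => rfl
  have hexl : ∀ n w, G.IsExit X Y n w →
      (G.tens X Y H).IsExit (X + Z) (Y + W) (.inl n) (IntHom.leftTensVar X Z w) := by
    rintro n w (⟨hw, rfl⟩ | ⟨v, hv, rfl, rfl⟩)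
    · rw [IntHom.leftTensVar, if_pos hw]
      exact Or.inl ⟨by rw [e2]; omega, (tens_domOut_of_lt hw).symm⟩
    · rw [IntHom.leftTensVar, if_neg (by omega)]
      exact Or.inr ⟨v, by rw [e1]; omega, (tens_codOut_of_lt hv).symm, by rw [e2]; omega⟩
  have hexr : ∀ n w, H.IsExit Z W n w →
      (G.tens X Y H).IsExit (X + Z) (Y + W) (.inr n) (IntHom.rightTensVar X Y Z w) := by
    rintro n w (⟨hw, rfl⟩ | ⟨v, hv, rfl, rfl⟩)
    · rw [IntHom.rightTensVar, if_pos hw]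
      exact Or.inl ⟨by rw [e2]; omega, (tens_domOut_add w).symm⟩
    · rw [IntHom.rightTensVar, if_neg (by omega)]
      exact Or.inr ⟨Y.1 + v, by rw [e1]; omega, (tens_codOut_add v).symm, by rw [e2]; omega⟩
  have hexl' : ∀ n w, (G.tens X Y H).IsExit (X + Z) (Y + W) (.inl n) w →
      ∃ v, G.IsExit X Y n v ∧ w = IntHom.leftTensVar X Z v := by
    rintro n w (⟨hw, h⟩ | ⟨v, hv, h, rfl⟩)
    · rcases lt_or_ge w X.2 with hX | hX
      · exact ⟨w, Or.inl ⟨hX, Sum.inl.inj (h.trans (tens_domOut_of_lt hX))⟩,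
          by rw [IntHom.leftTensVar, if_pos hX]⟩
      · obtain ⟨k, rfl⟩ := Nat.exists_eq_add_of_le hX
        cases h.trans (tens_domOut_add k)
    · rcases lt_or_ge v Y.1 with hX | hX
      · exact ⟨X.2 + v, Or.inr ⟨v, hX, Sum.inl.inj (h.trans (tens_codOut_of_lt hX)), rfl⟩,
          by rw [IntHom.leftTensVar, if_neg (by omega), e2]; omega⟩
      · obtain ⟨k, rfl⟩ := Nat.exists_eq_add_of_le hX
        cases h.trans (tens_codOut_add k)
  have hexr' : ∀ n w, (G.tens X Y H).IsExit (X + Z) (Y + W) (.inr n) w →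
      ∃ v, H.IsExit Z W n v ∧ w = IntHom.rightTensVar X Y Z v := by
    rintro n w (⟨hw, h⟩ | ⟨v, hv, h, rfl⟩)
    · rw [e2] at hw
      rcases lt_or_ge w X.2 with hX | hX
      · cases h.trans (tens_domOut_of_lt hX)
      · obtain ⟨k, rfl⟩ := Nat.exists_eq_add_of_le hX
        exact ⟨k, Or.inl ⟨by omega, Sum.inr.inj (h.trans (tens_domOut_add k))⟩,
          by rw [IntHom.rightTensVar, if_pos (by omega)]⟩
    · rw [e1] at hv
      rcases lt_or_ge v Y.1 with hX | hX
      · cases h.trans (tens_codOut_of_lt hX)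
      · obtain ⟨k, rfl⟩ := Nat.exists_eq_add_of_le hX
        exact ⟨Z.2 + k, Or.inr ⟨k, by omega, Sum.inr.inj (h.trans (tens_codOut_add k)), rfl⟩,
          by rw [IntHom.rightTensVar, if_neg (by omega), e2]; omega⟩
  let θ : ℕ → Beh A := fun v => Beh.var (IntHom.leftTensVar X Z v)
  let ψ : ℕ → Beh A := fun v => Beh.var (IntHom.rightTensVar X Y Z v)
  let B : (G.tens X Y H).Node → Beh A :=
    Sum.elim (fun n => (b n).bind θ) fun n => (c n).bind ψ
  refine ⟨B, .of_closed ?_ ?_ ?_ ?_, fun i hi => ?_, fun i hi => ?_⟩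
  · rintro (n | n) (n' | n') h
    · exact Beh.beta_bind_mono (hb.beta_mono h) θ
    · exact h.elim
    · exact h.elim
    · exact Beh.beta_bind_mono (hc.beta_mono h) ψ
  · rintro (n | n) a (n' | n') h
    · exact Beh.inl_mem_beta_bind.2 (Or.inl ⟨_, hb.inl_mem.2 ⟨n, n', .refl, h, rfl⟩, rfl⟩)
    · exact h.elim
    · exact h.elim
    · exact Beh.inl_mem_beta_bind.2 (Or.inl ⟨_, hc.inl_mem.2 ⟨n, n', .refl, h, rfl⟩, rfl⟩)
  · rintro (n | n) w h
    · obtain ⟨v, hv, rfl⟩ := hexl' n w h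
      exact Beh.inr_mem_beta_bind.2 ⟨v, hb.inr_mem.2 ⟨n, .refl, hv⟩, Beh.mem_beta_var.2 rfl⟩
    · obtain ⟨v, hv, rfl⟩ := hexr' n w h
      exact Beh.inr_mem_beta_bind.2 ⟨v, hc.inr_mem.2 ⟨n, .refl, hv⟩, Beh.mem_beta_var.2 rfl⟩
  · rintro (n | n) e h
    · rcases Beh.mem_beta_bind.1 h with ⟨a, x, hx, rfl⟩ | ⟨v, hv, he⟩
      · obtain ⟨m, n', hm, ha, rfl⟩ := hb.inl_mem.1 hx
        exact ⟨.inl m, tens_path_inl hm, Or.inl ⟨a, .inl n', ha, rfl⟩⟩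
      · obtain ⟨m, hm, hv⟩ := hb.inr_mem.1 hv
        exact ⟨.inl m, tens_path_inl hm, Or.inr ⟨_, hexl m v hv, Beh.mem_beta_var.1 he⟩⟩
    · rcases Beh.mem_beta_bind.1 h with ⟨a, x, hx, rfl⟩ | ⟨v, hv, he⟩
      · obtain ⟨m, n', hm, ha, rfl⟩ := hc.inl_mem.1 hx
        exact ⟨.inr m, tens_path_inr hm, Or.inl ⟨a, .inr n', ha, rfl⟩⟩
      · obtain ⟨m, hm, hv⟩ := hc.inr_mem.1 hv
        exact ⟨.inr m, tens_path_inr hm, Or.inr ⟨_, hexr m v hv, Beh.mem_beta_var.1 he⟩⟩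
  · rw [e1] at hi
    rcases lt_or_ge i X.1 with h | h
    · rw [tens_domIn_of_lt h, h1 i h, ← fd i h]
      rfl
    · obtain ⟨k, rfl⟩ := Nat.exists_eq_add_of_le h
      rw [tens_domIn_add, h2 k (by omega), ← gd k (by omega)]
      rfl
  · rw [e2] at hi
    rcases lt_or_ge i Y.2 with h | h
    · rw [tens_codIn_of_lt h, e1, h3 i h, ← fc i h]
      rfl
    · obtain ⟨k, rfl⟩ := Nat.exists_eq_add_of_le h
      rw [tens_codIn_add, e1, h4 k (by omega), ← gc k (by omega)]
      rfl

/-- A node of one factor behaves as before, with the solution of the system at the entries of the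
other factor substituted for the exits towards `Y`. That the glued graph shows all observations of
this behaviour depends on more than the fixpoint equation: `mem_beta_dagger` yields a finite path of
components, and each of its steps is a silent path in one factor followed by a crossing. -/
theorem Presents.comp {f : IntHom A X Y} {g : IntHom A Y Z} (hf : G.Presents f)
    (hg : H.Presents g) : (G.comp Y H).Presents (f.comp g) := by
  obtain ⟨b, hb, fd, fc⟩ := hf
  obtain ⟨c, hc, gd, gc⟩ := hg
  obtain ⟨F, h0, h1, h2, h3, h4⟩ := IntHom.exists_comp_system f g
  set D := RegBeh.nth (RegBeh.dagger _ _ F) with hD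
  let θ := fun v => Beh.feed (X.2 + Z.1) D (IntHom.leftVar X Y Z v)
  let ψ := fun v => Beh.feed (X.2 + Z.1) D (IntHom.rightVar X Y Z v)
  have hDφ : ∀ i, D i = (RegBeh.nth F i).bind (Beh.feed (X.2 + Z.1) D) :=
    RegBeh.nth_dagger_eq F
  have D1 : ∀ i, i < X.1 → D i = (f.nth i).bind θ := fun i hi => by
    rw [hDφ, h1 i hi, Beh.bind_bind]
    simp only [Beh.var_bind, θ]
  have D2 : ∀ i, i < Z.2 → D (X.1 + i) = (g.nth (Y.1 + i)).bind ψ := fun i hi => by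
    rw [hDφ, h2 i hi, Beh.bind_bind]
    simp only [Beh.var_bind, ψ]
  have D3 : ∀ i, i < Y.2 → D (X.1 + Z.2 + i) = (f.nth (X.1 + i)).bind θ := fun i hi => by
    rw [hDφ, h3 i hi, Beh.bind_bind]
    simp only [Beh.var_bind, θ]
  have D4 : ∀ i, i < Y.1 → D (X.1 + Z.2 + (Y.2 + i)) = (g.nth i).bind ψ := fun i hi => by
    rw [hDφ, h4 i hi, Beh.bind_bind]
    simp only [Beh.var_bind, ψ]
  -- The node at which the `i`-th equation of the system is entered; the equations come in the order
  -- `X⁺ Z⁻ Y⁻ Y⁺`.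
  let entry : ℕ → G.Node ⊕ H.Node := fun i =>
    if i < X.1 then .inl (G.domIn i)
    else if i < X.1 + Z.2 then .inr (H.codIn (i - X.1))
    else if i < X.1 + Z.2 + Y.2 then .inl (G.codIn (i - (X.1 + Z.2)))
    else .inr (H.domIn (i - (X.1 + Z.2 + Y.2)))
  have E1 : ∀ i, i < X.1 → entry i = .inl (G.domIn i) := fun i hi => if_pos hi
  have E2 : ∀ i, i < Z.2 → entry (X.1 + i) = .inr (H.codIn i) := fun i hi => by
    simp only [entry]
    rw [if_neg (by omega), if_pos (by omega), Nat.add_sub_cancel_left]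
  have E3 : ∀ i, i < Y.2 → entry (X.1 + Z.2 + i) = .inl (G.codIn i) := fun i hi => by
    simp only [entry]
    rw [if_neg (by omega), if_neg (by omega), if_pos (by omega), Nat.add_sub_cancel_left]
  have E4 : ∀ i, entry (X.1 + Z.2 + (Y.2 + i)) = .inr (H.domIn i) := fun i => by
    simp only [entry]
    rw [if_neg (by omega), if_neg (by omega), if_neg (by omega), ← Nat.add_assoc,
      Nat.add_sub_cancel_left]
  have hentry : ∀ i, i < X.1 + Z.2 + (Y.2 + Y.1) →
      (∃ n, entry i = .inl n ∧
        RegBeh.nth F i = (b n).bind fun v => Beh.var (IntHom.leftVar X Y Z v)) ∨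
      (∃ n, entry i = .inr n ∧
        RegBeh.nth F i = (c n).bind fun v => Beh.var (IntHom.rightVar X Y Z v)) := by
    intro i hi
    rcases lt_or_ge i X.1 with h | h
    · exact Or.inl ⟨_, E1 i h, by rw [fd i h, h1 i h]⟩
    rcases lt_or_ge i (X.1 + Z.2) with h' | h'
    · obtain ⟨k, rfl⟩ := Nat.exists_eq_add_of_le h
      exact Or.inr ⟨_, E2 k (by omega), by rw [gc k (by omega), h2 k (by omega)]⟩
    obtain ⟨k, rfl⟩ := Nat.exists_eq_add_of_le h'
    rcases lt_or_ge k Y.2 with h'' | h''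
    · exact Or.inl ⟨_, E3 k h'', by rw [fc k h'', h3 k h'']⟩
    · obtain ⟨l, rfl⟩ := Nat.exists_eq_add_of_le h''
      exact Or.inr ⟨_, E4 l, by rw [gd l (by omega), h4 l (by omega)]⟩
  let B : (G.comp Y H).Node → Beh A :=
    Sum.elim (fun n => (b n).bind θ) fun n => (c n).bind ψ
  -- an output at a node leads to an exit of the composite or to an entry of the other graph
  have hl : ∀ n v, .inr v ∈ beta (b n) → (v < X.2 ∧ ReflTransGen G.eps n (G.domOut v)) ∨
      ∃ y, y < Y.1 ∧ v = X.2 + y ∧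
        ReflTransGen (G.comp Y H).eps (.inl n) (entry (X.1 + Z.2 + (Y.2 + y))) := by
    intro n v hv
    obtain ⟨m, hm, ⟨hw, rfl⟩ | ⟨y, hy, rfl, rfl⟩⟩ := hb.inr_mem.1 hv
    · exact Or.inl ⟨hw, hm⟩
    · refine Or.inr ⟨y, hy, rfl, ?_⟩
      rw [E4]
      exact (comp_path_inl hm).tail ⟨y, hy, rfl, rfl⟩
  have hr : ∀ n v, .inr v ∈ beta (c n) →
      (∃ z, z < Z.1 ∧ v = Y.2 + z ∧ ReflTransGen H.eps n (H.codOut z)) ∨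
      (v < Y.2 ∧ ReflTransGen (G.comp Y H).eps (.inr n) (entry (X.1 + Z.2 + v))) := by
    intro n v hv
    obtain ⟨m, hm, ⟨hw, rfl⟩ | ⟨y, hy, rfl, rfl⟩⟩ := hc.inr_mem.1 hv
    · refine Or.inr ⟨hw, ?_⟩
      rw [E3 v hw]
      exact (comp_path_inr hm).tail ⟨v, hw, rfl, rfl⟩
    · exact Or.inl ⟨y, hy, rfl, hm⟩
  have hactl : ∀ n e, Beh.TransObs θ (b n) e →
      ∃ m, ReflTransGen (G.comp Y H).eps (.inl n) m ∧ (G.comp Y H).Emit X Z B m e := by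
    rintro n e ⟨a, x, hx, rfl⟩
    obtain ⟨m, n', hm, ha, rfl⟩ := hb.inl_mem.1 hx
    exact ⟨.inl m, comp_path_inl hm, Or.inl ⟨a, .inl n', ha, rfl⟩⟩
  have hactr : ∀ n e, Beh.TransObs ψ (c n) e →
      ∃ m, ReflTransGen (G.comp Y H).eps (.inr n) m ∧ (G.comp Y H).Emit X Z B m e := by
    rintro n e ⟨a, x, hx, rfl⟩
    obtain ⟨m, n', hm, ha, rfl⟩ := hc.inl_mem.1 hx
    exact ⟨.inr m, comp_path_inr hm, Or.inl ⟨a, .inr n', ha, rfl⟩⟩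
  have hvar : ∀ w e, ¬ Beh.TransObs (Beh.feed (X.2 + Z.1) D) (Beh.var w) e := by
    rintro w e ⟨a, x, hx, -⟩
    rw [Beh.mem_beta_var] at hx
    cases hx
  have hclaim : ∀ i e, i < X.1 + Z.2 + (Y.2 + Y.1) → e ∈ beta (D i) →
      ∃ m, ReflTransGen (G.comp Y H).eps (entry i) m ∧ (G.comp Y H).Emit X Z B m e := by
    intro i e hi h
    obtain ⟨j, hj, he⟩ := (RegBeh.mem_beta_dagger F i e).1 h
    clear h
    rw [← hD] at he
    induction hj using ReflTransGen.head_induction_on with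
    -- At the end of the path the observation is a transition or a visible output. A visible
    -- variable is no feedback variable, which rules out the crossing alternatives of `hl` and `hr`.
    | refl =>
      rcases hentry j hi with ⟨n, hn, hφ⟩ | ⟨n, hn, hφ⟩ <;> rw [hφ] at he <;> rw [hn]
      · rcases he with he | ⟨v, hv, hvx, rfl⟩
        · rcases Beh.transObs_bind.1 he with he | ⟨w, _, he⟩
          · simp only [Beh.var_bind] at he
            exact hactl n e he
          · exact absurd he (hvar _ e)
        · obtain ⟨w, hw, hwv⟩ := Beh.inr_mem_beta_bind.1 hvx
          obtain rfl := Sum.inr.inj (Beh.mem_beta_var.1 hwv)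
          rcases hl n w hw with ⟨h, hp⟩ | ⟨y, _, rfl, _⟩
          · refine ⟨_, comp_path_inl hp, Or.inr ⟨w, Or.inl ⟨h, rfl⟩, ?_⟩⟩
            rw [IntHom.leftVar, if_pos h]
          · rw [IntHom.leftVar, if_neg (by omega)] at hv
            omega
      · rcases he with he | ⟨v, hv, hvx, rfl⟩
        · rcases Beh.transObs_bind.1 he with he | ⟨w, _, he⟩
          · simp only [Beh.var_bind] at he
            exact hactr n e he
          · exact absurd he (hvar _ e)
        · obtain ⟨w, hw, hwv⟩ := Beh.inr_mem_beta_bind.1 hvx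
          obtain rfl := Sum.inr.inj (Beh.mem_beta_var.1 hwv)
          rcases hr n w hw with ⟨z, hz, rfl, hp⟩ | ⟨h, _⟩
          · refine ⟨_, comp_path_inr hp, Or.inr ⟨X.2 + z, Or.inr ⟨z, hz, rfl, rfl⟩, ?_⟩⟩
            rw [IntHom.rightVar, if_neg (by omega), Nat.add_sub_cancel_left]
          · rw [IntHom.rightVar, if_pos h] at hv
            omega
    -- An intermediate step uses a feedback variable, so the exit reached leads into the other
    -- graph, and the number of the variable identifies the entry `k`.
    | @head i k hik _ ih =>
      have hk := RegBeh.lt_of_inr_mem_nth hik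
      obtain ⟨m, hm, hme⟩ := ih (by omega)
      refine ⟨m, ReflTransGen.trans ?_ hm, hme⟩
      rcases hentry i hi with ⟨n, hn, hφ⟩ | ⟨n, hn, hφ⟩ <;> rw [hφ] at hik <;> rw [hn]
      · obtain ⟨w, hw, hwv⟩ := Beh.inr_mem_beta_bind.1 hik
        have hwv := Sum.inr.inj (Beh.mem_beta_var.1 hwv)
        rcases hl n w hw with ⟨h, hp⟩ | ⟨y, hy, rfl, hp⟩
        · rw [IntHom.leftVar, if_pos h] at hwv
          omega
        · rw [IntHom.leftVar, if_neg (by omega)] at hwv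
          obtain rfl : k = X.1 + Z.2 + (Y.2 + y) := by omega
          exact hp
      · obtain ⟨w, hw, hwv⟩ := Beh.inr_mem_beta_bind.1 hik
        have hwv := Sum.inr.inj (Beh.mem_beta_var.1 hwv)
        rcases hr n w hw with ⟨z, hz, rfl, hp⟩ | ⟨h, hp⟩
        · rw [IntHom.rightVar, if_neg (by omega)] at hwv
          omega
        · rw [IntHom.rightVar, if_pos h] at hwv
          obtain rfl : k = X.1 + Z.2 + w := by omega
          exact hp
  have hθlt : ∀ v, v < X.2 → θ v = Beh.var v := fun v hv => IntHom.feed_leftVar_of_lt hv D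
  have hθadd : ∀ v, θ (X.2 + v) = D (X.1 + Z.2 + (Y.2 + v)) :=
    fun v => IntHom.feed_leftVar_add v D
  have hψlt : ∀ v, v < Y.2 → ψ v = D (X.1 + Z.2 + v) :=
    fun v hv => IntHom.feed_rightVar_of_lt hv D
  have hψadd : ∀ v, v < Z.1 → ψ (Y.2 + v) = Beh.var (X.2 + v) :=
    fun v hv => IntHom.feed_rightVar_add hv D
  refine ⟨B, .of_closed ?_ ?_ ?_ ?_, fun i hi => ?_, fun i hi => ?_⟩
  · rintro (n | n) (n' | n') h
    · exact Beh.beta_bind_mono (hb.beta_mono h) _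
    · obtain ⟨j, hj, rfl, rfl⟩ := h
      intro e he
      refine Beh.mem_beta_bind.2 (Or.inr ⟨X.2 + j, hb.inr_mem.2
        ⟨_, .refl, Or.inr ⟨j, hj, rfl, rfl⟩⟩, ?_⟩)
      rw [hθadd, D4 j hj, ← gd j hj]
      exact he
    · obtain ⟨j, hj, rfl, rfl⟩ := h
      intro e he
      refine Beh.mem_beta_bind.2 (Or.inr ⟨j, hc.inr_mem.2
        ⟨_, .refl, Or.inl ⟨hj, rfl⟩⟩, ?_⟩)
      rw [hψlt j hj, D3 j hj, ← fc j hj]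
      exact he
    · exact Beh.beta_bind_mono (hc.beta_mono h) _
  · rintro (n | n) a (n' | n') h
    · exact Beh.inl_mem_beta_bind.2 (Or.inl ⟨_, hb.inl_mem.2 ⟨n, n', .refl, h, rfl⟩, rfl⟩)
    · exact h.elim
    · exact h.elim
    · exact Beh.inl_mem_beta_bind.2 (Or.inl ⟨_, hc.inl_mem.2 ⟨n, n', .refl, h, rfl⟩, rfl⟩)
  · rintro n w (⟨hw, rfl⟩ | ⟨v, hv, rfl, rfl⟩)
    · refine Beh.inr_mem_beta_bind.2 ⟨w, hb.inr_mem.2 ⟨_, .refl, Or.inl ⟨hw, rfl⟩⟩, ?_⟩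
      rw [hθlt w hw, Beh.mem_beta_var]
    · refine Beh.inr_mem_beta_bind.2 ⟨Y.2 + v, hc.inr_mem.2
        ⟨_, .refl, Or.inr ⟨v, hv, rfl, rfl⟩⟩, ?_⟩
      rw [hψadd v hv, Beh.mem_beta_var]
  · rintro (n | n) e h
    · rcases Beh.mem_beta_bind.1 h with h | ⟨v, hv, he⟩
      · exact hactl n e h
      · rcases hl n v hv with ⟨hv, hp⟩ | ⟨y, hy, rfl, hp⟩
        · rw [hθlt v hv, Beh.mem_beta_var] at he
          exact ⟨_, comp_path_inl hp, Or.inr ⟨v, Or.inl ⟨hv, rfl⟩, he⟩⟩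
        · rw [hθadd] at he
          obtain ⟨m, hm, hme⟩ := hclaim _ e (by omega) he
          exact ⟨m, hp.trans hm, hme⟩
    · rcases Beh.mem_beta_bind.1 h with h | ⟨v, hv, he⟩
      · exact hactr n e h
      · rcases hr n v hv with ⟨z, hz, rfl, hp⟩ | ⟨hv, hp⟩
        · rw [hψadd z hz, Beh.mem_beta_var] at he
          exact ⟨_, comp_path_inr hp, Or.inr ⟨_, Or.inr ⟨z, hz, rfl, rfl⟩, he⟩⟩
        · rw [hψlt v hv] at he
          obtain ⟨m, hm, hme⟩ := hclaim _ e (by omega) he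
          exact ⟨m, hp.trans hm, hme⟩
  · rw [h0 i (by omega)]
    change (b (G.domIn i)).bind θ = D i
    rw [fd i hi, D1 i hi]
  · rw [h0 _ (by omega)]
    change (c (H.codIn i)).bind ψ = D (X.1 + i)
    rw [gc i hi, D2 i hi]

/-- The graph whose nodes are behaviours and whose exits are variables. -/
noncomputable def ofHom (f : IntHom A X Y) : PortGraph A where
  Node := Beh A
  eps x y := ∃ v, y = Beh.var v ∧ .inr v ∈ beta x
  act x a y := .inl (a, y) ∈ beta x
  domIn i := f.nth i
  domOut i := Beh.var i
  codIn i := f.nth (X.1 + i)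
  codOut i := Beh.var (X.2 + i)

/-- The nodes are arbitrary behaviours and may output variables that are not exits. The substitution
`τ` erases these; the components of `f` have none and are unchanged. -/
theorem presents_ofHom (f : IntHom A X Y) : (ofHom f).Presents f := by
  let τ : ℕ → Beh A := fun v => if v < X.2 + Y.1 then Beh.var v else Beh.zero
  have hτ : ∀ i, (f.nth i).bind τ = f.nth i := fun i =>
    (Beh.bind_congr fun v hv => if_pos (RegBeh.lt_of_live_nth hv)).trans (Beh.bind_var _)
  have hexit : ∀ w, w < X.2 + Y.1 → (ofHom f).IsExit X Y (Beh.var w : Beh A) w := by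
    intro w hw
    rcases lt_or_ge w X.2 with h | h
    · exact Or.inl ⟨h, rfl⟩
    · obtain ⟨k, rfl⟩ := Nat.exists_eq_add_of_le h
      exact Or.inr ⟨k, by omega, rfl, rfl⟩
  refine ⟨fun x : Beh A => x.bind τ, .of_closed ?_ ?_ ?_ ?_, fun i _ => hτ i, fun i _ => hτ _⟩
  · rintro x _ ⟨v, rfl, hv⟩
    refine Beh.beta_bind_mono (x := Beh.var v) (fun e he => ?_) τ
    rw [Beh.mem_beta_var] at he
    rwa [he]
  · intro x a y h
    exact Beh.inl_mem_beta_bind.2 (Or.inl ⟨y, h, rfl⟩)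
  · rintro _ w (⟨hw, rfl⟩ | ⟨v, hv, rfl, rfl⟩)
    · change _ ∈ beta ((Beh.var w).bind τ)
      rw [Beh.var_bind]
      simp only [τ]
      rw [if_pos (by omega), Beh.mem_beta_var]
    · change _ ∈ beta ((Beh.var (X.2 + v)).bind τ)
      rw [Beh.var_bind]
      simp only [τ]
      rw [if_pos (by omega), Beh.mem_beta_var]
  · intro x e he
    rcases Beh.mem_beta_bind.1 he with ⟨a, y, hy, rfl⟩ | ⟨v, hv, he⟩
    · exact ⟨x, .refl, Or.inl ⟨a, y, hy, rfl⟩⟩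
    · simp only [τ] at he
      split_ifs at he with h
      · rw [Beh.mem_beta_var] at he
        exact ⟨Beh.var v, .single ⟨v, rfl, hv⟩, Or.inr ⟨v, hexit v h, he⟩⟩
      · exact absurd he Beh.notMem_beta_zero

theorem Presents.cast {X' Y' : ℕ × ℕ} (hX : X = X') (hY : Y = Y') {f : IntHom A X Y}
    (hf : G.Presents f) : G.Presents (f.cast hX hY) := by
  subst hX hY
  exact hf

end PortGraph

/-! ### Associativity and interchange -/

namespace IntHom

variable {A : Type*}

open PortGraph

/-- Gluing three graphs in either order gives the same edges; only the disjoint union of the nodes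
is bracketed differently. -/
theorem comp_assoc {X Y Z W : ℕ × ℕ} (f : IntHom A X Y) (g : IntHom A Y Z) (h : IntHom A Z W) :
    (f.comp g).comp h = f.comp (g.comp h) := by
  refine eq_of_iso (((presents_ofHom f).comp (presents_ofHom g)).comp (presents_ofHom h))
    ((presents_ofHom f).comp ((presents_ofHom g).comp (presents_ofHom h)))
    (Equiv.sumAssoc (Beh A) (Beh A) (Beh A)) ?_ ?_ (fun _ _ => rfl) (fun _ _ => rfl)
    (fun _ _ => rfl) (fun _ _ => rfl)
  · rintro ((n | n) | n) ((n' | n') | n') <;>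
      first
        | exact Iff.rfl
        | constructor <;> rintro ⟨j, hj, ⟨⟩, ⟨⟩⟩ <;> exact ⟨j, hj, rfl, rfl⟩
  · rintro ((n | n) | n) a ((n' | n') | n') <;> exact Iff.rfl

/-- Both sides consist of the same four graphs, glued along the same ports; the isomorphism
exchanges the two middle sets of nodes. -/
theorem interchange {X₁ Y₁ Z₁ X₂ Y₂ Z₂ : ℕ × ℕ} (f₁ : IntHom A X₁ Y₁) (g₁ : IntHom A Y₁ Z₁)
    (f₂ : IntHom A X₂ Y₂) (g₂ : IntHom A Y₂ Z₂) :
    (f₁.tens f₂).comp (g₁.tens g₂) = (f₁.comp g₁).tens (f₂.comp g₂) := by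
  have e1 : ∀ X Y : ℕ × ℕ, (X + Y).1 = X.1 + Y.1 := fun _ _ => rfl
  have e2 : ∀ X Y : ℕ × ℕ, (X + Y).2 = X.2 + Y.2 := fun _ _ => rfl
  set F₁ := ofHom f₁
  set F₂ := ofHom f₂
  set G₁ := ofHom g₁
  set G₂ := ofHom g₂
  -- The gluing edges between two juxtapositions: as the port numbers split at `m` on both sides,
  -- each edge joins left to left or right to right.
  have hcross : ∀ {m n : ℕ} {N₁ N₂ M₁ M₂ : Type _} {p : ℕ → N₁ ⊕ N₂} {q : ℕ → M₁ ⊕ M₂}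
      {p₁ : ℕ → N₁} {p₂ : ℕ → N₂} {q₁ : ℕ → M₁} {q₂ : ℕ → M₂},
      (∀ j, j < m → p j = .inl (p₁ j)) → (∀ j, p (m + j) = .inr (p₂ j)) →
      (∀ j, j < m → q j = .inl (q₁ j)) → (∀ j, q (m + j) = .inr (q₂ j)) →
      ∀ x y, (∃ j, j < m + n ∧ x = p j ∧ y = q j) ↔
        (∃ j, j < m ∧ x = .inl (p₁ j) ∧ y = .inl (q₁ j)) ∨
        ∃ j, j < n ∧ x = .inr (p₂ j) ∧ y = .inr (q₂ j) := by
    intro m n N₁ N₂ M₁ M₂ p q p₁ p₂ q₁ q₂ hp hp' hq hq' x y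
    constructor
    · rintro ⟨j, hj, rfl, rfl⟩
      rcases lt_or_ge j m with h | h
      · exact Or.inl ⟨j, h, hp j h, hq j h⟩
      · obtain ⟨k, rfl⟩ := Nat.exists_eq_add_of_le h
        exact Or.inr ⟨k, by omega, hp' k, hq' k⟩
    · rintro (⟨j, hj, rfl, rfl⟩ | ⟨j, hj, rfl, rfl⟩)
      · exact ⟨j, by omega, (hp j hj).symm, (hq j hj).symm⟩
      · exact ⟨m + j, by omega, (hp' j).symm, (hq' j).symm⟩
  have c1 := hcross (n := Y₂.1) (fun j => tens_codOut_of_lt (G := F₁) (H := F₂) (X := X₁) (Y := Y₁))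
    tens_codOut_add (fun j => tens_domIn_of_lt (G := G₁) (H := G₂) (X := Y₁) (Y := Z₁))
    tens_domIn_add
  have c2 := hcross (n := Y₂.2) (fun j => tens_domOut_of_lt (G := G₁) (H := G₂) (X := Y₁) (Y := Z₁))
    tens_domOut_add (fun j => tens_codIn_of_lt (G := F₁) (H := F₂) (X := X₁) (Y := Y₁))
    tens_codIn_add
  refine eq_of_iso (((presents_ofHom f₁).tens (presents_ofHom f₂)).comp
      ((presents_ofHom g₁).tens (presents_ofHom g₂)))
    (((presents_ofHom f₁).comp (presents_ofHom g₁)).tens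
      ((presents_ofHom f₂).comp (presents_ofHom g₂)))
    (Equiv.sumSumSumComm F₁.Node F₂.Node G₁.Node G₂.Node) ?_ ?_ ?_ ?_ ?_ ?_
  · rintro ((n | n) | (n | n)) ((n' | n') | (n' | n')) <;>
      first
        | exact Iff.rfl
        | refine (c1 _ _).trans ?_
          constructor
          · rintro (⟨j, hj, ⟨⟩, ⟨⟩⟩ | ⟨j, hj, ⟨⟩, ⟨⟩⟩) <;> exact ⟨j, hj, rfl, rfl⟩
          · first
              | exact False.elim
              | rintro ⟨j, hj, ⟨⟩, ⟨⟩⟩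
                first
                  | exact Or.inl ⟨j, hj, rfl, rfl⟩
                  | exact Or.inr ⟨j, hj, rfl, rfl⟩
        | refine (c2 _ _).trans ?_
          constructor
          · rintro (⟨j, hj, ⟨⟩, ⟨⟩⟩ | ⟨j, hj, ⟨⟩, ⟨⟩⟩) <;> exact ⟨j, hj, rfl, rfl⟩
          · first
              | exact False.elim
              | rintro ⟨j, hj, ⟨⟩, ⟨⟩⟩
                first
                  | exact Or.inl ⟨j, hj, rfl, rfl⟩
                  | exact Or.inr ⟨j, hj, rfl, rfl⟩
  · rintro ((n | n) | (n | n)) a ((n' | n') | (n' | n')) <;> exact Iff.rfl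
  · intro i _
    rcases lt_or_ge i X₁.1 with h | h
    · exact (congrArg (fun z => Equiv.sumSumSumComm F₁.Node F₂.Node G₁.Node G₂.Node (.inl z))
        (tens_domIn_of_lt h)).trans
        (tens_domIn_of_lt (G := F₁.comp Y₁ G₁) (H := F₂.comp Y₂ G₂) h).symm
    · obtain ⟨k, rfl⟩ := Nat.exists_eq_add_of_le h
      exact (congrArg (fun z => Equiv.sumSumSumComm F₁.Node F₂.Node G₁.Node G₂.Node (.inl z))
        (tens_domIn_add k)).trans
        (tens_domIn_add (G := F₁.comp Y₁ G₁) (H := F₂.comp Y₂ G₂) k).symm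
  · intro i _
    rcases lt_or_ge i X₁.2 with h | h
    · exact (congrArg (fun z => Equiv.sumSumSumComm F₁.Node F₂.Node G₁.Node G₂.Node (.inl z))
        (tens_domOut_of_lt h)).trans
        (tens_domOut_of_lt (G := F₁.comp Y₁ G₁) (H := F₂.comp Y₂ G₂) h).symm
    · obtain ⟨k, rfl⟩ := Nat.exists_eq_add_of_le h
      exact (congrArg (fun z => Equiv.sumSumSumComm F₁.Node F₂.Node G₁.Node G₂.Node (.inl z))
        (tens_domOut_add k)).trans
        (tens_domOut_add (G := F₁.comp Y₁ G₁) (H := F₂.comp Y₂ G₂) k).symm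
  · intro i _
    rcases lt_or_ge i Z₁.2 with h | h
    · exact (congrArg (fun z => Equiv.sumSumSumComm F₁.Node F₂.Node G₁.Node G₂.Node (.inr z))
        (tens_codIn_of_lt h)).trans
        (tens_codIn_of_lt (G := F₁.comp Y₁ G₁) (H := F₂.comp Y₂ G₂) h).symm
    · obtain ⟨k, rfl⟩ := Nat.exists_eq_add_of_le h
      exact (congrArg (fun z => Equiv.sumSumSumComm F₁.Node F₂.Node G₁.Node G₂.Node (.inr z))
        (tens_codIn_add k)).trans
        (tens_codIn_add (G := F₁.comp Y₁ G₁) (H := F₂.comp Y₂ G₂) k).symm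
  · intro i _
    rcases lt_or_ge i Z₁.1 with h | h
    · exact (congrArg (fun z => Equiv.sumSumSumComm F₁.Node F₂.Node G₁.Node G₂.Node (.inr z))
        (tens_codOut_of_lt h)).trans
        (tens_codOut_of_lt (G := F₁.comp Y₁ G₁) (H := F₂.comp Y₂ G₂) h).symm
    · obtain ⟨k, rfl⟩ := Nat.exists_eq_add_of_le h
      exact (congrArg (fun z => Equiv.sumSumSumComm F₁.Node F₂.Node G₁.Node G₂.Node (.inr z))
        (tens_codOut_add k)).trans
        (tens_codOut_add (G := F₁.comp Y₁ G₁) (H := F₂.comp Y₂ G₂) k).symm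

end IntHom

/-! ### Well-definedness of the semantics -/

namespace IntHom

variable {A : Type*}

theorem cast_rfl {X Y : ℕ × ℕ} (f : IntHom A X Y) : f.cast rfl rfl = f := rfl

theorem cast_cast {X X' X'' Y Y' Y'' : ℕ × ℕ} (hX : X = X') (hY : Y = Y') (hX' : X' = X'')
    (hY' : Y' = Y'') (f : IntHom A X Y) :
    (f.cast hX hY).cast hX' hY' = f.cast (hX.trans hX') (hY.trans hY') := by
  subst hX hY hX' hY'
  rfl

theorem cast_comp_cast {X X' Y Y' Z Z' : ℕ × ℕ} (hX : X = X') (hY : Y = Y') (hZ : Z = Z')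
    (f : IntHom A X Y) (g : IntHom A Y Z) :
    (f.cast hX hY).comp (g.cast hY hZ) = (f.comp g).cast hX hZ := by
  subst hX hY hZ
  rfl

theorem cast_tens_cast {X X' Y Y' Z Z' W W' : ℕ × ℕ} (hX : X = X') (hY : Y = Y') (hZ : Z = Z')
    (hW : W = W') (f : IntHom A X Y) (g : IntHom A Z W) :
    (f.cast hX hY).tens (g.cast hZ hW) =
      (f.tens g).cast (congrArg₂ (· + ·) hX hZ) (congrArg₂ (· + ·) hY hW) := by
  subst hX hY hZ hW
  rfl

theorem id_cast {X X' : ℕ × ℕ} (hX : X = X') :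
    (IntHom.id (A := A) X).cast hX hX = IntHom.id X' := by
  subst hX
  rfl

end IntHom

theorem Term.sem_cast {A : Type*} {v v' w w' : Word} (hv : v = v') (hw : w = w')
    (t : Term A v w) :
    (t.cast hv hw).sem = t.sem.cast (congrArg Word.obj hv) (congrArg Word.obj hw) := by
  subst hv hw
  rfl

open IntHom in
-- Apart from `sym_append`, the axioms are laws of Int(RegBeh) up to casts. In `sym_append` both
-- sides consist of wires, so it remains to compare port numbers.
theorem Term.Eqv.sem_eq {A : Type*} {v w : Word} {s t : Term A v w} (h : s.Eqv t) :
    s.sem = t.sem := by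
  induction h with
  | refl => rfl
  | symm _ ih => exact ih.symm
  | trans _ _ ih ih' => exact ih.trans ih'
  | comp_congr _ _ ih ih' => simp only [Term.sem, ih, ih']
  | tens_congr _ _ ih ih' => simp only [Term.sem, ih, ih']
  | comp_assoc s t r => exact IntHom.comp_assoc _ _ _
  | id_comp t => exact IntHom.id_comp _
  | comp_id t => exact IntHom.comp_id _
  | tens_id v w =>
    simp only [Term.sem]
    rw [IntHom.tens_id, id_cast]
  | interchange s₁ t₁ s₂ t₂ =>
    simp only [Term.sem]
    rw [cast_comp_cast, IntHom.interchange]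
  | tens_assoc s t r =>
    rw [Term.sem_cast]
    simp only [Term.sem]
    have h1 := cast_tens_cast (Word.obj_append _ _).symm (Word.obj_append _ _).symm rfl rfl
      (s.sem.tens t.sem) r.sem
    have h2 := cast_tens_cast rfl rfl (Word.obj_append _ _).symm (Word.obj_append _ _).symm
      s.sem (t.sem.tens r.sem)
    rw [cast_rfl] at h1 h2
    rw [h1, h2, ← IntHom.tens_assoc, IntHom.cast_cast, IntHom.cast_cast, IntHom.cast_cast, IntHom.cast_cast]
  | id_tens t => exact IntHom.id_tens _
  | tens_unit t =>
    rw [Term.sem_cast]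
    simp only [Term.sem]
    rw [IntHom.cast_cast]
    exact IntHom.tens_unit _
  | sym_natural s t =>
    simp only [Term.sem]
    rw [cast_comp_cast, cast_comp_cast, IntHom.sym_natural]
  | sym_sym v w =>
    simp only [Term.sem]
    rw [cast_comp_cast, IntHom.sym_sym, id_cast]
  | sym_append u v w =>
    simp only [Term.sem, Term.sem_cast]
    have hr := ((((isWire_sym (A := A) u.obj v.obj).cast (Word.obj_append _ _).symm
      (Word.obj_append _ _).symm).tens (isWire_id w.obj)).cast (Word.obj_append _ _).symm
      (Word.obj_append _ _).symm).cast (congrArg Word.obj (List.append_assoc u v w))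
      (congrArg Word.obj (List.append_assoc v u w))
    have hr' := (((isWire_id (A := A) v.obj).tens ((isWire_sym u.obj w.obj).cast
      (Word.obj_append _ _).symm (Word.obj_append _ _).symm)).cast (Word.obj_append _ _).symm
      (Word.obj_append _ _).symm)
    refine ((isWire_sym u.obj (v ++ w).obj).cast (Word.obj_append _ _).symm
      (Word.obj_append _ _).symm).unique ((hr.comp hr').cast rfl
      (congrArg Word.obj (List.append_assoc v w u).symm)) ?_ ?_
    · intro i hi
      simp only [Word.obj_append, Prod.fst_add] at hi ⊢
      split_ifs <;> omega
    · intro i hi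
      simp only [Word.obj_append, Prod.snd_add] at hi ⊢
      split_ifs <;> omega

theorem Term.eqv_equivalence {A : Type*} {v w : Word} :
    Equivalence (Term.Eqv (A := A) (v := v) (w := w)) :=
  ⟨.refl, .symm, .trans⟩

namespace Syn

variable {A : Type*}

/-- `Term.Eqv` is itself an equivalence relation, so the representative picked by `Quot.out` is
related to `t` by the axioms and has the same semantics. -/
theorem sem_mk {v w : Word} (t : Term A v w) : (Syn.mk t).sem = t.sem := by
  have h : Quot.mk Term.Eqv (Quot.out (Syn.mk t)) = Quot.mk Term.Eqv t := Quot.out_eq (Syn.mk t)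
  exact ((Term.eqv_equivalence.eqvGen_iff).1 (Quot.eqvGen_exact h)).sem_eq

theorem sem_gen {v w : Word} (g : Gen A v w) : (Syn.gen g).sem = g.sem := sem_mk _

theorem sem_id (w : Word) : (Syn.id (A := A) w).sem = IntHom.id w.obj := sem_mk _

theorem sem_sym (v w : Word) : (Syn.sym (A := A) v w).sem =
    (IntHom.sym v.obj w.obj).cast (Word.obj_append v w).symm (Word.obj_append w v).symm :=
  sem_mk _

theorem sem_comp {u v w : Word} (f : Syn A u v) (g : Syn A v w) :
    (f.comp g).sem = f.sem.comp g.sem := by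
  induction f using Quot.inductionOn with
  | h s =>
  induction g using Quot.inductionOn with
  | h t =>
    change (Syn.mk (s.comp t)).sem = (Syn.mk s).sem.comp (Syn.mk t).sem
    rw [sem_mk, sem_mk, sem_mk, Term.sem]

theorem sem_tens {v₁ w₁ v₂ w₂ : Word} (f : Syn A v₁ w₁) (g : Syn A v₂ w₂) :
    (f.tens g).sem = (f.sem.tens g.sem).cast (Word.obj_append _ _).symm
      (Word.obj_append _ _).symm := by
  induction f using Quot.inductionOn with
  | h s =>
  induction g using Quot.inductionOn with
  | h t =>
    change (Syn.mk (s.tens t)).sem = ((Syn.mk s).sem.tens (Syn.mk t).sem).cast _ _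
    rw [sem_mk, sem_mk, sem_mk, Term.sem]

end Syn

/-! ### Full morphisms -/

namespace Beh

variable {A : Type*}

/-- The behaviour that outputs the first `n` variables and has no transitions. -/
def full (n : ℕ) : Beh A :=
  mk
    { State := Unit
      finite := inferInstance
      pre := { trans := fun _ => ∅, out := fun _ => Finset.range n }
      start := () }

theorem mem_beta_full {n : ℕ} {e : A × Beh A ⊕ ℕ} :
    e ∈ beta (full n) ↔ ∃ w, w < n ∧ e = .inr w := by
  rcases e with ⟨a, y⟩ | v
  · rw [full, inl_mem_beta_mk]
    simp
  · rw [full, inr_mem_beta_mk]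
    simp

theorem eq_full {x : Beh A} {n : ℕ} (h : ∀ e, e ∈ beta x ↔ ∃ w, w < n ∧ e = .inr w) :
    x = full n :=
  beta_injective (Finset.ext fun e => (h e).trans mem_beta_full.symm)

end Beh

namespace IntHom

variable {A : Type*} {X Y : ℕ × ℕ}

/-- Every component of `f` outputs all variables and has no transitions. -/
def IsFull (f : IntHom A X Y) : Prop := ∀ i, i < X.1 + Y.2 → f.nth i = Beh.full (X.2 + Y.1)

theorem IsFull.unique {f g : IntHom A X Y} (hf : f.IsFull) (hg : g.IsFull) : f = g :=
  ext_nth fun i hi => (hf i hi).trans (hg i hi).symm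

end IntHom

namespace PortGraph

open Beh (beta)

variable {A : Type*} {G H : PortGraph A} {X Y Z W : ℕ × ℕ}

/-- The graph has no labelled edges. -/
def Inert (G : PortGraph A) : Prop := ∀ n a n', ¬ G.act n a n'

/-- The graph with a single node. -/
def hub (A : Type*) : PortGraph A where
  Node := Unit
  eps _ _ := False
  act _ _ _ := False
  domIn _ := ()
  domOut _ := ()
  codIn _ := ()
  codOut _ := ()

/-- The graph of wires that lead from `X⁺ᵢ` to `Y⁺_{ρ i}` and from `Y⁻ⱼ` to `X⁻_{τ j}`. -/
def wire (A : Type*) (ρ τ : ℕ → ℕ) : PortGraph A where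
  Node := ℕ ⊕ ℕ
  eps _ _ := False
  act _ _ _ := False
  domIn i := .inl (ρ i)
  domOut i := .inr i
  codIn i := .inr (τ i)
  codOut i := .inl i

theorem inert_hub : (hub A).Inert := fun _ _ _ h => h

theorem inert_wire (ρ τ : ℕ → ℕ) : (wire A ρ τ).Inert := fun _ _ _ h => h

theorem Inert.comp (hG : G.Inert) (hH : H.Inert) : (G.comp Y H).Inert := by
  rintro (n | n) a (n' | n') h
  · exact hG _ _ _ h
  · exact h
  · exact h
  · exact hH _ _ _ h

theorem Inert.tens (hG : G.Inert) (hH : H.Inert) : (G.tens X Y H).Inert := by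
  rintro (n | n) a (n' | n') h
  · exact hG _ _ _ h
  · exact h
  · exact h
  · exact hH _ _ _ h

/-- All components are the same behaviour, so a single node can be every entry and every exit. -/
theorem _root_.IntHom.IsFull.presents {f : IntHom A X Y} (h : f.IsFull) : (hub A).Presents f := by
  refine ⟨fun _ => Beh.full (X.2 + Y.1), .of_closed (fun _ _ h => h.elim) (fun _ _ _ h => h.elim)
    ?_ ?_, fun i hi => (h i (by omega)).symm, fun i hi => (h _ (by omega)).symm⟩
  · rintro _ w (⟨hw, _⟩ | ⟨v, hv, _, rfl⟩)
    · exact Beh.mem_beta_full.2 ⟨w, by omega, rfl⟩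
    · exact Beh.mem_beta_full.2 ⟨_, by omega, rfl⟩
  · rintro n e he
    obtain ⟨w, hw, rfl⟩ := Beh.mem_beta_full.1 he
    refine ⟨n, .refl, Or.inr ⟨w, ?_, rfl⟩⟩
    rcases lt_or_ge w X.2 with h | h
    · exact Or.inl ⟨h, rfl⟩
    · obtain ⟨k, rfl⟩ := Nat.exists_eq_add_of_le h
      exact Or.inr ⟨k, by omega, rfl, rfl⟩

/-- Each exit is a node, and an entry is identified with the exit to which its wire leads. Nodes
beyond the type of `f` are given the behaviour `Beh.zero`. -/
theorem _root_.IntHom.IsWire.presents {f : IntHom A X Y} {ρ τ : ℕ → ℕ} (h : f.IsWire ρ τ) :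
    (wire A ρ τ).Presents f := by
  refine ⟨Sum.elim (fun j => if j < Y.1 then Beh.var (X.2 + j) else Beh.zero)
    fun k => if k < X.2 then Beh.var k else Beh.zero,
    .of_closed (fun _ _ h => h.elim) (fun _ _ _ h => h.elim) ?_ ?_, fun i hi => ?_, fun i hi => ?_⟩
  · rintro _ w (⟨hw, rfl⟩ | ⟨v, hv, rfl, rfl⟩)
    · change _ ∈ beta (ite _ _ _)
      rw [if_pos hw, Beh.mem_beta_var]
    · change _ ∈ beta (ite _ _ _)
      rw [if_pos hv, Beh.mem_beta_var]
  · rintro (j | k) e he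
    · change _ ∈ beta (ite _ _ _) at he
      split_ifs at he with hj
      · exact ⟨.inl j, .refl, Or.inr ⟨_, Or.inr ⟨j, hj, rfl, rfl⟩, Beh.mem_beta_var.1 he⟩⟩
      · exact absurd he Beh.notMem_beta_zero
    · change _ ∈ beta (ite _ _ _) at he
      split_ifs at he with hk
      · exact ⟨.inr k, .refl, Or.inr ⟨_, Or.inl ⟨hk, rfl⟩, Beh.mem_beta_var.1 he⟩⟩
      · exact absurd he Beh.notMem_beta_zero
  · exact (if_pos (h.pos_lt i hi)).trans (h.pos i hi).symm
  · exact (if_pos (h.neg_lt i hi)).trans (h.neg i hi).symm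

/-- An inert graph in which all entries are connected with all exits presents a full morphism. -/
theorem Presents.isFull {f : IntHom A X Y} (hf : G.Presents f) (hG : G.Inert)
    (hdd : ∀ i, i < X.1 → ∀ j, j < X.2 → ReflTransGen G.eps (G.domIn i) (G.domOut j))
    (hdc : ∀ i, i < X.1 → ∀ j, j < Y.1 → ReflTransGen G.eps (G.domIn i) (G.codOut j))
    (hcd : ∀ i, i < Y.2 → ∀ j, j < X.2 → ReflTransGen G.eps (G.codIn i) (G.domOut j))
    (hcc : ∀ i, i < Y.2 → ∀ j, j < Y.1 → ReflTransGen G.eps (G.codIn i) (G.codOut j)) :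
    f.IsFull := by
  obtain ⟨b, hb, fd, fc⟩ := hf
  have key : ∀ n, (∀ j, j < X.2 → ReflTransGen G.eps n (G.domOut j)) →
      (∀ j, j < Y.1 → ReflTransGen G.eps n (G.codOut j)) → b n = Beh.full (X.2 + Y.1) := by
    refine fun n h h' => Beh.eq_full fun e => ?_
    rcases e with ⟨a, y⟩ | w
    · rw [hb.inl_mem]
      constructor
      · rintro ⟨m, n', _, ha, _⟩
        exact (hG _ _ _ ha).elim
      · rintro ⟨w, _, ⟨⟩⟩
    · rw [hb.inr_mem]
      constructor
      · rintro ⟨m, _, ⟨hw, _⟩ | ⟨v, hv, _, rfl⟩⟩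
        · exact ⟨w, by omega, rfl⟩
        · exact ⟨_, by omega, rfl⟩
      · rintro ⟨_, hw, ⟨⟩⟩
        rcases lt_or_ge w X.2 with hX | hX
        · exact ⟨_, h w hX, Or.inl ⟨hX, rfl⟩⟩
        · obtain ⟨k, rfl⟩ := Nat.exists_eq_add_of_le hX
          exact ⟨_, h' k (by omega), Or.inr ⟨k, by omega, rfl, rfl⟩⟩
  intro i hi
  rcases lt_or_ge i X.1 with h | h
  · rw [← fd i h, key _ (hdd i h) (hdc i h)]
  · obtain ⟨k, rfl⟩ := Nat.exists_eq_add_of_le h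
    rw [← fc k (by omega), key _ (hcd k (by omega)) (hcc k (by omega))]

/-- All entries and exits are connected through the node `c`. -/
theorem Presents.isFull_of_center {f : IntHom A X Y} (hf : G.Presents f) (hG : G.Inert)
    (c : G.Node) (hdi : ∀ i, i < X.1 → ReflTransGen G.eps (G.domIn i) c)
    (hdo : ∀ i, i < X.2 → ReflTransGen G.eps c (G.domOut i))
    (hci : ∀ i, i < Y.2 → ReflTransGen G.eps (G.codIn i) c)
    (hco : ∀ i, i < Y.1 → ReflTransGen G.eps c (G.codOut i)) : f.IsFull :=
  hf.isFull hG (fun i hi j hj => (hdi i hi).trans (hdo j hj))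
    (fun i hi j hj => (hdi i hi).trans (hco j hj))
    (fun i hi j hj => (hci i hi).trans (hdo j hj)) fun i hi j hj => (hci i hi).trans (hco j hj)

end PortGraph

/-! ### Generators that denote full morphisms -/

namespace Gen

variable {A : Type*}

theorem isFull_copy : (Gen.copy : Gen A _ _).sem.IsFull := by
  intro i hi
  have hi : i < 1 := hi
  obtain rfl : i = 0 := by omega
  refine Beh.eq_full fun e => ?_
  change e ∈ Beh.beta (Beh.mk (Chart.sum (Chart.var 0) (Chart.var 1))) ↔ ∃ w, w < 2 ∧ _
  rcases e with ⟨a, y⟩ | v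
  · rw [Beh.inl_mem_beta_mk]
    simp only [Chart.sum, Chart.var, Finset.image_empty, Finset.union_empty]
    constructor
    · rintro ⟨q, hq, _⟩
      exact absurd hq (Finset.notMem_empty _)
    · rintro ⟨w, _, ⟨⟩⟩
  · rw [Beh.inr_mem_beta_mk]
    change v ∈ ({0} ∪ {1} : Finset ℕ) ↔ _
    simp
    omega

theorem isFull_delete : (Gen.delete : Gen A _ _).sem.IsFull := by
  intro i hi
  have hi : i < 1 := hi
  obtain rfl : i = 0 := by omega
  refine Beh.eq_full fun e => ?_
  change e ∈ Beh.beta Beh.zero ↔ ∃ w, w < 0 ∧ _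
  simp [Beh.notMem_beta_zero]

theorem full_one : (Beh.full 1 : Beh A) = Beh.var 0 :=
  (Beh.eq_full fun e => by simp [Beh.mem_beta_var]).symm

theorem isFull_merge : (Gen.merge : Gen A _ _).sem.IsFull := by
  intro i hi
  have hi : i < 2 := hi
  refine Eq.trans ?_ full_one.symm
  obtain rfl | rfl : i = 0 ∨ i = 1 := by omega
  · rfl
  · rfl

theorem isFull_generate : (Gen.generate : Gen A _ _).sem.IsFull := by
  intro i hi
  have hi : i < 0 := hi
  omega

theorem isFull_cap : (Gen.cap : Gen A _ _).sem.IsFull := by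
  intro i hi
  have hi : i < 1 := hi
  refine Eq.trans ?_ full_one.symm
  obtain rfl : i = 0 := by omega
  rfl

theorem isFull_cup : (Gen.cup : Gen A _ _).sem.IsFull := by
  intro i hi
  have hi : i < 1 := hi
  refine Eq.trans ?_ full_one.symm
  obtain rfl : i = 0 := by omega
  rfl

end Gen

namespace IntHom

variable {A : Type*}

/-- Composition of morphisms without negative ports is substitution. -/
theorem nth_comp_of_pos {X Y Z : ℕ × ℕ} (hX : X.2 = 0) (hY : Y.2 = 0) (f : IntHom A X Y)
    (g : IntHom A Y Z) {i : ℕ} (hi : i < X.1) : (f.comp g).nth i = (f.nth i).bind g.nth := by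
  obtain ⟨D, h0, h1, -, -, h4⟩ := exists_comp_solution f g
  rw [h0 i (by omega), h1 i hi]
  refine Beh.bind_congr fun v hv => ?_
  have hv := RegBeh.lt_of_live_nth hv
  have key := feed_leftVar_add (X := X) (Y := Y) (Z := Z) v D
  rw [show X.2 + v = v by omega] at key
  rw [key, h4 v (by omega)]
  refine (Beh.bind_congr fun w hw => ?_).trans (Beh.bind_var _)
  have hw := RegBeh.lt_of_live_nth hw
  have key := feed_rightVar_add (X := X) (Y := Y) (Z := Z) (v := w) (by omega) D
  rw [show Y.2 + w = w by omega] at key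
  rw [key, show X.2 + w = w by omega]

end IntHom

namespace PortGraph

variable {A : Type*} {G H : PortGraph A} {Y : ℕ × ℕ}

theorem forall_lt_zero {p : ℕ → Prop} : ∀ i, i < 0 → p i := fun _ h => absurd h (by omega)

theorem forall_lt_one {p : ℕ → Prop} (h : p 0) : ∀ i, i < 1 → p i := fun i hi => by
  obtain rfl : i = 0 := by omega
  exact h

theorem forall_lt_two {p : ℕ → Prop} (h : p 0) (h' : p 1) : ∀ i, i < 2 → p i := fun i hi => by
  obtain rfl | rfl : i = 0 ∨ i = 1 := by omega
  · exact h
  · exact h'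

theorem forall_lt_three {p : ℕ → Prop} (h : p 0) (h' : p 1) (h'' : p 2) : ∀ i, i < 3 → p i :=
  fun i hi => by
    obtain rfl | rfl | rfl : i = 0 ∨ i = 1 ∨ i = 2 := by omega
    · exact h
    · exact h'
    · exact h''

end PortGraph

/-! ### Soundness of the equational axioms -/

namespace SynEq

open PortGraph Gen

variable {A : Type*}

/-- A single wire has one entry and one exit, hence is full, unlike the identity on two wires. So
axioms that equate a diagram with the identity on one object also compare full morphisms. -/
theorem isFull_id_right : (IntHom.id (A := A) (Word.obj [.r])).IsFull :=
  (IntHom.isWire_id (Word.obj [.r])).presents.isFull_of_center (inert_wire _ _) (.inl 0)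
    (forall_lt_one .refl) forall_lt_zero forall_lt_zero (forall_lt_one .refl)

theorem isFull_id_left : (IntHom.id (A := A) (Word.obj [.l])).IsFull :=
  (IntHom.isWire_id (Word.obj [.l])).presents.isFull_of_center (inert_wire _ _) (.inr 0)
    forall_lt_zero (forall_lt_one .refl) (forall_lt_one .refl) forall_lt_zero

/-- The zigzag is followed from the entry to the cap, which serves as the centre, back to the cup
along the negative port, and out. -/
theorem isFull_A1 : (((Syn.tens (.gen .cup) (.id [.r]) : Syn A [.r] [.r, .l, .r]).comp
    (Syn.tens (.id [.r]) (.gen .cap)) : Syn A [.r] [.r])).sem.IsFull := by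
  simp only [Syn.sem_comp, Syn.sem_tens, Syn.sem_gen, Syn.sem_id]
  refine (((isFull_cup.presents.tens isFull_id_right.presents).cast _ _).comp
    ((isFull_id_right.presents.tens isFull_cap.presents).cast _ _)).isFull_of_center
    ((inert_hub.tens inert_hub).comp (inert_hub.tens inert_hub)) (.inr (.inr ()))
    (forall_lt_one ?_) forall_lt_zero forall_lt_zero (forall_lt_one ?_)
  · exact .single ⟨1, by decide, rfl, rfl⟩
  · exact .head (b := Sum.inl (Sum.inl ())) ⟨0, by decide, rfl, rfl⟩
      (.single ⟨0, by decide, rfl, rfl⟩)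

theorem isFull_A2 : (((Syn.tens (.id [.l]) (.gen .cup) : Syn A [.l] [.l, .r, .l]).comp
    (Syn.tens (.gen .cap) (.id [.l])) : Syn A [.l] [.l])).sem.IsFull := by
  simp only [Syn.sem_comp, Syn.sem_tens, Syn.sem_gen, Syn.sem_id]
  refine (((isFull_id_left.presents.tens isFull_cup.presents).cast _ _).comp
    ((isFull_cap.presents.tens isFull_id_left.presents).cast _ _)).isFull_of_center
    ((inert_hub.tens inert_hub).comp (inert_hub.tens inert_hub)) (.inr (.inl ()))
    forall_lt_zero (forall_lt_one ?_) (forall_lt_one ?_) forall_lt_zero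
  · exact .single ⟨0, by decide, rfl, rfl⟩
  · exact .head (b := Sum.inl (Sum.inr ())) ⟨1, by decide, rfl, rfl⟩
      (.single ⟨0, by decide, rfl, rfl⟩)

theorem isFull_B1_left :
    ((Syn.gen .copy).comp (Syn.tens (.gen .copy) (.id [.r])) : Syn A [.r] _).sem.IsFull := by
  simp only [Syn.sem_comp, Syn.sem_tens, Syn.sem_gen, Syn.sem_id]
  refine (isFull_copy.presents.comp
    ((isFull_copy.presents.tens isFull_id_right.presents).cast _ _)).isFull_of_center
    (inert_hub.comp (inert_hub.tens inert_hub)) (.inl ())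
    (forall_lt_one .refl) forall_lt_zero forall_lt_zero (forall_lt_three ?_ ?_ ?_)
  · exact .single ⟨0, by decide, rfl, rfl⟩
  · exact .single ⟨0, by decide, rfl, rfl⟩
  · exact .single ⟨1, by decide, rfl, rfl⟩

theorem isFull_B1_right :
    ((Syn.gen .copy).comp (Syn.tens (.id [.r]) (.gen .copy)) : Syn A [.r] _).sem.IsFull := by
  simp only [Syn.sem_comp, Syn.sem_tens, Syn.sem_gen, Syn.sem_id]
  refine (isFull_copy.presents.comp
    ((isFull_id_right.presents.tens isFull_copy.presents).cast _ _)).isFull_of_center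
    (inert_hub.comp (inert_hub.tens inert_hub)) (.inl ())
    (forall_lt_one .refl) forall_lt_zero forall_lt_zero (forall_lt_three ?_ ?_ ?_)
  · exact .single ⟨0, by decide, rfl, rfl⟩
  · exact .single ⟨1, by decide, rfl, rfl⟩
  · exact .single ⟨1, by decide, rfl, rfl⟩

theorem isFull_B2 :
    ((Syn.gen .copy).comp (Syn.tens (.id [.r]) (.gen .delete)) : Syn A [.r] [.r]).sem.IsFull := by
  simp only [Syn.sem_comp, Syn.sem_tens, Syn.sem_gen, Syn.sem_id]
  refine (isFull_copy.presents.comp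
    ((isFull_id_right.presents.tens isFull_delete.presents).cast _ _)).isFull_of_center
    (inert_hub.comp (inert_hub.tens inert_hub)) (.inl ())
    (forall_lt_one .refl) forall_lt_zero forall_lt_zero (forall_lt_one ?_)
  exact .single ⟨0, by decide, rfl, rfl⟩

theorem isFull_B3 :
    ((Syn.gen .copy).comp (Syn.sym [.r] [.r]) : Syn A [.r] [.r, .r]).sem.IsFull := by
  simp only [Syn.sem_comp, Syn.sem_sym, Syn.sem_gen]
  refine (isFull_copy.presents.comp
    ((IntHom.isWire_sym (Word.obj [.r]) (Word.obj [.r])).presents.cast _ _)).isFull_of_center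
    (inert_hub.comp (inert_wire _ _)) (.inl ())
    (forall_lt_one .refl) forall_lt_zero forall_lt_zero (forall_lt_two ?_ ?_)
  · exact .single ⟨1, by decide, rfl, rfl⟩
  · exact .single ⟨0, by decide, rfl, rfl⟩

theorem isFull_B4_left : ((Syn.tens (.gen .merge) (.id [.r])).comp (Syn.gen .merge) :
    Syn A [.r, .r, .r] [.r]).sem.IsFull := by
  simp only [Syn.sem_comp, Syn.sem_tens, Syn.sem_gen, Syn.sem_id]
  refine (((isFull_merge.presents.tens isFull_id_right.presents).cast _ _).comp
    isFull_merge.presents).isFull_of_center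
    ((inert_hub.tens inert_hub).comp inert_hub) (.inr ())
    (forall_lt_three ?_ ?_ ?_) forall_lt_zero forall_lt_zero (forall_lt_one .refl)
  · exact .single ⟨0, by decide, rfl, rfl⟩
  · exact .single ⟨0, by decide, rfl, rfl⟩
  · exact .single ⟨1, by decide, rfl, rfl⟩

theorem isFull_B4_right : ((Syn.tens (.id [.r]) (.gen .merge)).comp (Syn.gen .merge) :
    Syn A [.r, .r, .r] [.r]).sem.IsFull := by
  simp only [Syn.sem_comp, Syn.sem_tens, Syn.sem_gen, Syn.sem_id]
  refine (((isFull_id_right.presents.tens isFull_merge.presents).cast _ _).comp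
    isFull_merge.presents).isFull_of_center
    ((inert_hub.tens inert_hub).comp inert_hub) (.inr ())
    (forall_lt_three ?_ ?_ ?_) forall_lt_zero forall_lt_zero (forall_lt_one .refl)
  · exact .single ⟨0, by decide, rfl, rfl⟩
  · exact .single ⟨1, by decide, rfl, rfl⟩
  · exact .single ⟨1, by decide, rfl, rfl⟩

theorem isFull_B5 : ((Syn.tens (.id [.r]) (.gen .generate)).comp (Syn.gen .merge) :
    Syn A [.r] [.r]).sem.IsFull := by
  simp only [Syn.sem_comp, Syn.sem_tens, Syn.sem_gen, Syn.sem_id]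
  refine (((isFull_id_right.presents.tens isFull_generate.presents).cast _ _).comp
    isFull_merge.presents).isFull_of_center
    ((inert_hub.tens inert_hub).comp inert_hub) (.inr ())
    (forall_lt_one ?_) forall_lt_zero forall_lt_zero (forall_lt_one .refl)
  exact .single ⟨0, by decide, rfl, rfl⟩

theorem isFull_B6 :
    ((Syn.sym [.r] [.r]).comp (Syn.gen .merge) : Syn A [.r, .r] [.r]).sem.IsFull := by
  simp only [Syn.sem_comp, Syn.sem_sym, Syn.sem_gen]
  refine (((IntHom.isWire_sym (Word.obj [.r]) (Word.obj [.r])).presents.cast _ _).comp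
    isFull_merge.presents).isFull_of_center ((inert_wire _ _).comp inert_hub) (.inr ())
    (forall_lt_two ?_ ?_) forall_lt_zero forall_lt_zero (forall_lt_one .refl)
  · exact .single ⟨1, by decide, rfl, rfl⟩
  · exact .single ⟨0, by decide, rfl, rfl⟩

theorem isFull_B7_left :
    ((Syn.gen .merge).comp (Syn.gen .copy) : Syn A [.r, .r] [.r, .r]).sem.IsFull := by
  simp only [Syn.sem_comp, Syn.sem_gen]
  refine (isFull_merge.presents.comp isFull_copy.presents).isFull_of_center
    (inert_hub.comp inert_hub) (.inl ())
    (forall_lt_two .refl .refl) forall_lt_zero forall_lt_zero (forall_lt_two ?_ ?_)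
  · exact .single ⟨0, by decide, rfl, rfl⟩
  · exact .single ⟨0, by decide, rfl, rfl⟩

/-- There is no node through which everything passes. Instead, each of the four pairs of entry and
exit has a path along its own strand of the middle layer, and these strands are the intermediate
nodes given below. -/
theorem isFull_B7_right :
    (Syn.comp (v := [.r, .r, .r, .r]) (Syn.tens (.gen .copy) (.gen .copy))
      (Syn.comp (v := [.r, .r, .r, .r])
        (Syn.tens (v₁ := [.r]) (w₁ := [.r]) (v₂ := [.r, .r, .r]) (w₂ := [.r, .r, .r]) (.id [.r])
          (Syn.tens (v₁ := [.r, .r]) (w₁ := [.r, .r]) (.sym [.r] [.r]) (.id [.r])))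
        (Syn.tens (.gen .merge) (.gen .merge))) : Syn A [.r, .r] [.r, .r]).sem.IsFull := by
  simp only [Syn.sem_comp, Syn.sem_tens, Syn.sem_sym, Syn.sem_gen, Syn.sem_id]
  refine (((isFull_copy.presents.tens isFull_copy.presents).cast _ _).comp
    (((isFull_id_right.presents.tens
      ((((IntHom.isWire_sym (Word.obj [.r]) (Word.obj [.r])).presents.cast _ _).tens
        isFull_id_right.presents).cast _ _)).cast _ _).comp
      ((isFull_merge.presents.tens isFull_merge.presents).cast _ _))).isFull
    ((inert_hub.tens inert_hub).comp ((inert_hub.tens ((inert_wire _ _).tens inert_hub)).comp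
      (inert_hub.tens inert_hub)))
    (fun _ _ => forall_lt_zero)
    (forall_lt_two (forall_lt_two ?_ ?_) (forall_lt_two ?_ ?_)) forall_lt_zero forall_lt_zero
  · exact .head (b := Sum.inr (Sum.inl (Sum.inl ()))) ⟨0, by decide, rfl, rfl⟩
      (.single ⟨0, by decide, rfl, rfl⟩)
  · exact .head (b := Sum.inr (Sum.inl (Sum.inr (Sum.inl (Sum.inl 1)))))
      ⟨1, by decide, rfl, rfl⟩ (.single ⟨2, by decide, rfl, rfl⟩)
  · exact .head (b := Sum.inr (Sum.inl (Sum.inr (Sum.inl (Sum.inl 0)))))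
      ⟨2, by decide, rfl, rfl⟩ (.single ⟨1, by decide, rfl, rfl⟩)
  · exact .head (b := Sum.inr (Sum.inl (Sum.inr (Sum.inr ())))) ⟨3, by decide, rfl, rfl⟩
      (.single ⟨3, by decide, rfl, rfl⟩)

theorem isFull_B8_left :
    ((Syn.gen .merge).comp (Syn.gen .delete) : Syn A [.r, .r] []).sem.IsFull := by
  simp only [Syn.sem_comp, Syn.sem_gen]
  exact (isFull_merge.presents.comp isFull_delete.presents).isFull (inert_hub.comp inert_hub)
    (fun _ _ => forall_lt_zero) (fun _ _ => forall_lt_zero) forall_lt_zero forall_lt_zero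

theorem isFull_B8_right :
    (Syn.tens (.gen .delete) (.gen .delete) : Syn A [.r, .r] []).sem.IsFull := by
  simp only [Syn.sem_tens, Syn.sem_gen]
  exact ((isFull_delete.presents.tens isFull_delete.presents).cast _ _).isFull
    (inert_hub.tens inert_hub)
    (fun _ _ => forall_lt_zero) (fun _ _ => forall_lt_zero) forall_lt_zero forall_lt_zero

/-- Without entries there are no components, so any two such morphisms are equal. This accounts for
B9 and for Codel. -/
theorem isFull_of_no_entry {w : Word} (hw : w.obj.2 = 0) (f : Syn A [] w) : f.sem.IsFull :=
  fun i hi => absurd hi (by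
    change ¬ i < 0 + w.obj.2
    omega)

theorem isFull_B10 :
    ((Syn.gen .copy).comp (Syn.gen .merge) : Syn A [.r] [.r]).sem.IsFull := by
  simp only [Syn.sem_comp, Syn.sem_gen]
  refine (isFull_copy.presents.comp isFull_merge.presents).isFull_of_center
    (inert_hub.comp inert_hub) (.inl ())
    (forall_lt_one .refl) forall_lt_zero forall_lt_zero (forall_lt_one ?_)
  exact .single ⟨0, by decide, rfl, rfl⟩

/-- The loop is silent and does not affect which exits are reachable. The direct way through `merge`
and `copy` already connects entry and exit. -/
theorem isFull_B11 : (Syn.comp (v := [.r, .r, .l]) (Syn.tens (.id [.r]) (.gen .cup))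
    (Syn.comp (v := [.r, .r, .l]) (Syn.tens (Syn.comp (.gen .merge) (.gen .copy)) (.id [.l]))
      (Syn.tens (v₁ := [.r]) (w₁ := [.r]) (v₂ := [.r, .l]) (.id [.r])
        (Syn.comp (.sym [.r] [.l]) (.gen .cap)))) : Syn A [.r] [.r]).sem.IsFull := by
  simp only [Syn.sem_comp, Syn.sem_tens, Syn.sem_sym, Syn.sem_gen, Syn.sem_id]
  refine (((isFull_id_right.presents.tens isFull_cup.presents).cast _ _).comp
    ((((isFull_merge.presents.comp isFull_copy.presents).tens
      isFull_id_left.presents).cast _ _).comp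
      ((isFull_id_right.presents.tens
        (((IntHom.isWire_sym (Word.obj [.r]) (Word.obj [.l])).presents.cast _ _).comp
          isFull_cap.presents)).cast _ _))).isFull_of_center
    ((inert_hub.tens inert_hub).comp (((inert_hub.comp inert_hub).tens inert_hub).comp
      (inert_hub.tens ((inert_wire _ _).comp inert_hub)))) (.inr (.inl (.inl (.inl ()))))
    (forall_lt_one ?_) forall_lt_zero forall_lt_zero (forall_lt_one ?_)
  · exact .single ⟨0, by decide, rfl, rfl⟩
  · exact .head (b := Sum.inr (Sum.inl (Sum.inl (Sum.inr ())))) ⟨0, by decide, rfl, rfl⟩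
      (.single ⟨0, by decide, rfl, rfl⟩)

/-- Labelled edges rule out the connectivity argument, but in the absence of negative ports
composition is substitution, and both components of both sides evaluate to `a.v₁`. -/
theorem sem_eq_C1 (a : A) :
    ((Syn.gen .merge).comp (Syn.gen (.act a)) : Syn A [.r, .r] [.r]).sem =
      ((Syn.tens (.gen (.act a)) (.gen (.act a))).comp (Syn.gen .merge) :
        Syn A [.r, .r] [.r]).sem := by
  simp only [Syn.sem_comp, Syn.sem_tens, Syn.sem_gen]
  have hm : ∀ i, i < 2 → (Gen.merge : Gen A _ _).sem.nth i = Beh.var 0 :=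
    forall_lt_two rfl rfl
  have hlive : ∀ v, ((Gen.act a).sem.nth 0).Live v → v = 0 := fun v hv => by
    have := RegBeh.lt_of_live_nth hv
    have : v < 1 := this
    omega
  obtain ⟨h1, h2, -, -⟩ := IntHom.nth_tens (Gen.act a).sem (Gen.act a).sem
  refine IntHom.ext_nth fun i hi => ?_
  have hi : i < 2 := hi
  rw [IntHom.nth_comp_of_pos rfl rfl _ _ hi, IntHom.nth_comp_of_pos rfl rfl _ _ hi, hm i hi,
    Beh.var_bind, IntHom.nth_cast]
  obtain rfl | rfl : i = 0 ∨ i = 1 := by omega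
  · rw [h1 0 Nat.one_pos, Beh.bind_bind]
    refine (Beh.bind_var _).symm.trans (Beh.bind_congr fun v hv => ?_)
    rw [hlive v hv, Beh.var_bind]
    exact (hm 0 (by omega)).symm
  · rw [show ((Gen.act a).sem.tens (Gen.act a).sem).nth 1 = _ from h2 0 Nat.one_pos,
      Beh.bind_bind]
    refine (Beh.bind_var _).symm.trans (Beh.bind_congr fun v hv => ?_)
    rw [hlive v hv, Beh.var_bind]
    exact (hm 1 (by omega)).symm

theorem sem_eq {v w : Word} {f g : Syn A v w} (h : SynEq f g) : f.sem = g.sem := by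
  have hid : (Syn.id (A := A) [.r]).sem.IsFull := by
    rw [Syn.sem_id]
    exact isFull_id_right
  have hid' : (Syn.id (A := A) [.l]).sem.IsFull := by
    rw [Syn.sem_id]
    exact isFull_id_left
  induction h with
  | refl => rfl
  | symm _ ih => exact ih.symm
  | trans _ _ ih ih' => exact ih.trans ih'
  | comp_congr _ _ ih ih' => rw [Syn.sem_comp, Syn.sem_comp, ih, ih']
  | tens_congr _ _ ih ih' => rw [Syn.sem_tens, Syn.sem_tens, ih, ih']
  | A1 => exact isFull_A1.unique hid
  | A2 => exact isFull_A2.unique hid'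
  | B1 => exact isFull_B1_left.unique isFull_B1_right
  | B2 => exact isFull_B2.unique hid
  | B3 =>
    refine isFull_B3.unique ?_
    rw [Syn.sem_gen]
    exact isFull_copy
  | B4 => exact isFull_B4_left.unique isFull_B4_right
  | B5 => exact isFull_B5.unique hid
  | B6 =>
    refine isFull_B6.unique ?_
    rw [Syn.sem_gen]
    exact isFull_merge
  | B7 => exact isFull_B7_left.unique isFull_B7_right
  | B8 => exact isFull_B8_left.unique isFull_B8_right
  | B9 => exact (isFull_of_no_entry rfl _).unique (isFull_of_no_entry rfl _)
  | B10 => exact isFull_B10.unique hid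
  | B11 => exact isFull_B11.unique hid
  | C1 a => exact sem_eq_C1 a

end SynEq

/-! ### Bisimilarity up to a finite depth -/

namespace Beh

variable {A : Type*}

/-- Observations that agree up to the relation `R` on successor behaviours. -/
def ObsRel (R : Beh A → Beh A → Prop) : A × Beh A ⊕ ℕ → A × Beh A ⊕ ℕ → Prop :=
  Sum.LiftRel (fun p q => p.1 = q.1 ∧ R p.2 q.2) Eq

theorem ObsRel.mono {R S : Beh A → Beh A → Prop} (h : ∀ x y, R x y → S x y)
    {e e' : A × Beh A ⊕ ℕ} (he : ObsRel R e e') : ObsRel S e e' :=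
  Sum.LiftRel.mono (fun _ _ hp => ⟨hp.1, h _ _ hp.2⟩) (fun _ _ => _root_.id) he

/-- Bisimilarity up to depth `k`. -/
def Approx : ℕ → Beh A → Beh A → Prop
  | 0, _, _ => True
  | k + 1, x, y => (∀ e ∈ beta x, ∃ e' ∈ beta y, ObsRel (Approx k) e e') ∧
      ∀ e ∈ beta y, ∃ e' ∈ beta x, ObsRel (Approx k) e e'

theorem Approx.symm {k : ℕ} {x y : Beh A} (h : Approx k x y) : Approx k y x := by
  cases k with
  | zero => trivial
  | succ k => exact And.symm h

theorem Approx.refl (k : ℕ) (x : Beh A) : Approx k x x := by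
  induction k generalizing x with
  | zero => trivial
  | succ k ih =>
    have : ∀ e ∈ beta x, ∃ e' ∈ beta x, ObsRel (Approx k) e e' := by
      rintro (⟨a, y⟩ | v) he
      · exact ⟨_, he, .inl ⟨rfl, ih y⟩⟩
      · exact ⟨_, he, .inr rfl⟩
    exact ⟨this, this⟩

theorem Approx.of_succ {k : ℕ} {x y : Beh A} (h : Approx (k + 1) x y) : Approx k x y := by
  induction k generalizing x y with
  | zero => trivial
  | succ k ih =>
    refine ⟨fun e he => ?_, fun e he => ?_⟩
    · obtain ⟨e', he', h⟩ := h.1 e he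
      exact ⟨e', he', h.mono fun _ _ => ih⟩
    · obtain ⟨e', he', h⟩ := h.2 e he
      exact ⟨e', he', h.mono fun _ _ => ih⟩

/-- No depth is lost. An observation of `x.bind θ` is a transition of `x`, whose target is compared
at one depth less, or an observation of some `θ v`, where both `x` and `y` output `v`. -/
theorem Approx.bind {k : ℕ} {x y : Beh A} {θ ψ : ℕ → Beh A} (h : Approx k x y)
    (h' : ∀ v, Approx k (θ v) (ψ v)) : Approx k (x.bind θ) (y.bind ψ) := by
  induction k generalizing x y θ ψ with
  | zero => trivial
  | succ k ih =>
    have gen : ∀ {x y : Beh A} {θ ψ : ℕ → Beh A}, Approx (k + 1) x y →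
        (∀ v, Approx (k + 1) (θ v) (ψ v)) →
        ∀ e ∈ beta (x.bind θ), ∃ e' ∈ beta (y.bind ψ), ObsRel (Approx k) e e' := by
      intro x y θ ψ h h' e he
      rcases mem_beta_bind.1 he with ⟨a, x', hx, rfl⟩ | ⟨v, hv, he⟩
      · obtain ⟨_, hy, ⟨rfl, hxy⟩⟩ := h.1 _ hx
        rename_i q
        exact ⟨_, mem_beta_bind.2 (Or.inl ⟨q.1, q.2, hy, rfl⟩),
          .inl ⟨rfl, ih hxy fun v => (h' v).of_succ⟩⟩
      · obtain ⟨_, hy, _ | rfl⟩ := h.1 _ hv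
        obtain ⟨e', he', hee⟩ := (h' v).1 e he
        exact ⟨e', mem_beta_bind.2 (Or.inr ⟨v, hy, he'⟩), hee⟩
    exact ⟨gen h h', gen h.symm fun v => (h' v).symm⟩

/-- By `mem_beta_mu` the recursion is substituted only into targets of transitions, where one depth
less is required. The induction hypothesis provides this, even if `w` is unguarded. -/
theorem Approx.mu {k : ℕ} {x y : Beh A} (w : ℕ) (h : Approx k x y) :
    Approx k (mu w x) (mu w y) := by
  induction k generalizing x y with
  | zero => trivial
  | succ k ih =>
    have gen : ∀ {x y : Beh A}, Approx (k + 1) x y →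
        ∀ e ∈ beta (Beh.mu w x), ∃ e' ∈ beta (Beh.mu w y), ObsRel (Approx k) e e' := by
      intro x y h e he
      rcases mem_beta_mu.1 he with ⟨a, x', hx, rfl⟩ | ⟨v, hv, hne, rfl⟩
      · obtain ⟨_, hy, ⟨rfl, hxy⟩⟩ := h.1 _ hx
        rename_i q
        refine ⟨_, mem_beta_mu.2 (Or.inl ⟨q.1, q.2, hy, rfl⟩),
          .inl ⟨rfl, hxy.bind fun v => ?_⟩⟩
        rcases eq_or_ne v w with rfl | hv
        · rw [Function.update_self, Function.update_self]
          exact ih h.of_succ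
        · rw [Function.update_of_ne hv, Function.update_of_ne hv]
          exact .refl _ _
      · obtain ⟨_, hy, _ | rfl⟩ := h.1 _ hv
        exact ⟨_, mem_beta_mu.2 (Or.inr ⟨v, hy, hne, rfl⟩), .inr rfl⟩
    exact ⟨gen h, gen h.symm⟩

theorem Approx.feed {k p : ℕ} {D E : ℕ → Beh A} (h : ∀ i, Approx k (D i) (E i)) (v : ℕ) :
    Approx k (feed p D v) (feed p E v) := by
  simp only [Beh.feed]
  split_ifs
  · exact .refl _ _
  · exact h _

/-- The behavioural distance on regular behaviours. -/
noncomputable def bd (x y : Beh A) : unitInterval := (PMet.bd (prechart A)).d x y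

/-- Only the fixpoint equation is needed in what follows: the factor one half already forces the
values, and leastness plays no role. -/
theorem bd_eq (x y : Beh A) :
    bd x y = (PMet.hausdorff (PMet.lift (PMet.bd (prechart A)))).d (beta x) (beta y) := by
  have h : PMet.step (prechart A) (PMet.bd (prechart A)) = PMet.bd (prechart A) :=
    OrderHom.map_lfp ⟨PMet.step (prechart A), PMet.step_mono (prechart A)⟩
  exact congrArg (fun δ => PMet.d δ x y) h.symm

end Beh

/-- The strict bound makes a separate treatment of empty `T` unnecessary: there the infimum is `1`,
which lies below no `c`. -/
theorem PMet.exists_lt_of_hausdorff_lt {X : Type*} {δ : PMet X} {S T : Finset X}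
    {c : unitInterval} (h : (hausdorff δ).d S T < c) {x : X} (hx : x ∈ S) :
    ∃ y ∈ T, δ.d x y < c := by
  have h' : (T.inf fun y => δ.d x y) < c :=
    ((Finset.le_sup (f := fun x => T.inf fun y => δ.d x y) hx).trans (le_max_left _ _)).trans_lt h
  by_contra! hno
  exact absurd h' (not_lt.2 (Finset.le_inf hno))

theorem PMet.hausdorff_le {X : Type*} {δ : PMet X} {S T : Finset X} {c : unitInterval}
    (h : ∀ x ∈ S, ∃ y ∈ T, δ.d x y ≤ c) (h' : ∀ y ∈ T, ∃ x ∈ S, δ.d y x ≤ c) :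
    (hausdorff δ).d S T ≤ c := by
  refine max_le (Finset.sup_le fun x hx => ?_) (Finset.sup_le fun y hy => ?_)
  · obtain ⟨y, hy, hc⟩ := h x hx
    exact (Finset.inf_le hy).trans hc
  · obtain ⟨x, hx, hc⟩ := h' y hy
    exact (Finset.inf_le hx).trans hc

/-! ### The behavioural distance in terms of depth -/

namespace Beh

variable {A : Type*}

/-- The number `2⁻ᵏ`. -/
noncomputable def halfPow (k : ℕ) : unitInterval :=
  ⟨(1 / 2) ^ k, by positivity, pow_le_one₀ (by norm_num) (by norm_num)⟩

/-- Observations with different labels, or of different kinds, have distance `1`, and nothing in the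
unit interval exceeds `1`. -/
theorem obsRel_of_lift_lt {c : unitInterval} {e e' : A × Beh A ⊕ ℕ}
    (h : (PMet.lift (PMet.bd (prechart A))).d e e' < c) :
    ObsRel (fun x y => (1 / 2 : ℝ) * bd x y < c) e e' := by
  have one : ¬ (1 : unitInterval) < c := not_lt.2 unitInterval.le_one'
  rcases e with ⟨a, x⟩ | v <;> rcases e' with ⟨b, y⟩ | w
  · simp only [PMet.lift] at h
    split_ifs at h with hab
    · exact .inl ⟨hab, h⟩
    · exact absurd h one
  · exact absurd h one
  · exact absurd h one
  · simp only [PMet.lift] at h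
    split_ifs at h with hvw
    · exact .inr hvw
    · exact absurd h one

theorem lift_le_of_obsRel {c : unitInterval} {e e' : A × Beh A ⊕ ℕ}
    (h : ObsRel (fun x y => (1 / 2 : ℝ) * bd x y ≤ c) e e') :
    (PMet.lift (PMet.bd (prechart A))).d e e' ≤ c := by
  rcases h with ⟨h, h'⟩ | h
  · simp only [PMet.lift]
    rw [if_pos h]
    exact h'
  · subst h
    rw [PMet.refl]
    exact unitInterval.nonneg'

/-- A distance below `2⁻ᵏ` is below `1`, so every observation is matched by one of the same kind and
label, and matched successors are at distance below twice `2⁻ᵏ`. The depth is `k + 1` because a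
distance below `1 = 2⁰` already guarantees one matched step. -/
theorem approx_of_bd_lt {k : ℕ} {x y : Beh A} (h : bd x y < halfPow k) : Approx (k + 1) x y := by
  have obs : ∀ (k : ℕ), (∀ x y : Beh A, (1 / 2 : ℝ) * bd x y < halfPow k → Approx k x y) →
      ∀ x y : Beh A, bd x y < halfPow k → Approx (k + 1) x y := by
    intro k hk x y h
    have h' : bd y x < halfPow k := by
      rwa [bd, PMet.symm]
    rw [bd_eq] at h h'
    constructor <;> intro e he
    · obtain ⟨e', he', hlt⟩ := PMet.exists_lt_of_hausdorff_lt h he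
      exact ⟨e', he', (obsRel_of_lift_lt hlt).mono hk⟩
    · obtain ⟨e', he', hlt⟩ := PMet.exists_lt_of_hausdorff_lt h' he
      exact ⟨e', he', (obsRel_of_lift_lt hlt).mono hk⟩
  refine obs k ?_ x y h
  clear h
  induction k with
  | zero => exact fun _ _ _ => trivial
  | succ k ih =>
    refine fun x y h => obs k ih x y (Subtype.coe_lt_coe.1 ?_)
    simp only [halfPow, pow_succ] at h ⊢
    linarith

theorem Approx.bd_le {k : ℕ} {x y : Beh A} (h : Approx k x y) : bd x y ≤ halfPow k := by
  induction k generalizing x y with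
  | zero => exact unitInterval.le_one'
  | succ k ih =>
    rw [bd_eq]
    have key : ∀ e e' : A × Beh A ⊕ ℕ, ObsRel (Approx k) e e' →
        (PMet.lift (PMet.bd (prechart A))).d e e' ≤ halfPow (k + 1) := by
      refine fun e e' h => lift_le_of_obsRel (h.mono fun x y h => ?_)
      have := Subtype.coe_le_coe.2 (ih h)
      simp only [halfPow, pow_succ] at this ⊢
      linarith
    refine PMet.hausdorff_le (fun e he => ?_) fun e he => ?_
    · obtain ⟨e', he', h⟩ := h.1 e he
      exact ⟨e', he', key _ _ h⟩
    · obtain ⟨e', he', h⟩ := h.2 e he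
      exact ⟨e', he', key _ _ h⟩

/-- The distance takes only the values `0` and `2⁻ᵏ`, so a bound on it is a statement about depths.
Rules about distances then become congruence properties of `Approx`. -/
theorem bd_le_iff {x y : Beh A} {r : ℝ} (hr : 0 ≤ r) :
    (bd x y : ℝ) ≤ r ↔ ∀ k : ℕ, r < (1 / 2) ^ k → Approx (k + 1) x y := by
  constructor
  · exact fun h k hk => approx_of_bd_lt (Subtype.coe_lt_coe.1 (h.trans_lt hk))
  · intro h
    by_contra! hlt
    -- For the least such `k` one has `r < bd x y ≤ 2⁻ᵏ`, so the hypothesis yields depth `k + 1`,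
    -- and `Approx.bd_le` contradicts the choice of `k`.
    have hex : ∃ k : ℕ, (1 / 2 : ℝ) ^ (k + 1) < bd x y := by
      obtain ⟨k, hk⟩ := exists_pow_lt_of_lt_one (hr.trans_lt hlt) (by norm_num : (1 / 2 : ℝ) < 1)
      refine ⟨k, lt_of_le_of_lt ?_ hk⟩
      rw [pow_succ]
      have : (0 : ℝ) < (1 / 2) ^ k := by positivity
      linarith
    classical
    have hs := Nat.find_spec hex
    have hk : r < (1 / 2) ^ Nat.find hex := by
      rcases h0 : Nat.find hex with _ | j
      · exact hlt.trans_le (by simpa using unitInterval.le_one _)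
      · have := Nat.find_min hex (h0 ▸ Nat.lt_succ_self j : j < Nat.find hex)
        exact hlt.trans_le (not_lt.1 this)
    have := Subtype.coe_le_coe.2 (h _ hk).bd_le
    exact absurd hs (not_lt.2 this)

end Beh

/-! ### Depth and distance for tuples and in Int(RegBeh) -/

namespace RegBeh

variable {A : Type*}

/-- Componentwise bisimilarity up to depth `k`. -/
def Approx {m n : ℕ} (k : ℕ) (f g : RegBeh A m n) : Prop :=
  ∀ i, Beh.Approx k (nth f i) (nth g i)

theorem Approx.refl {m n : ℕ} (k : ℕ) (f : RegBeh A m n) : Approx k f f := fun _ => .refl _ _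

theorem Approx.comp {m n p k : ℕ} {f f' : RegBeh A m n} {g g' : RegBeh A n p}
    (h : Approx k f f') (h' : Approx k g g') : Approx k (f.comp g) (f'.comp g') := by
  intro i
  rw [nth_comp, nth_comp]
  exact (h i).bind h'

theorem Approx.oplus {l m n p k : ℕ} {f f' : RegBeh A l m} {g g' : RegBeh A n p}
    (h : Approx k f f') (h' : Approx k g g') : Approx k (oplus f g) (oplus f' g') := by
  intro i
  rw [nth_oplus, nth_oplus]
  split_ifs
  · exact h i
  · exact (h' _).bind fun _ => .refl _ _

/-- The pairing identity assembles the dagger from substitutions and scalar recursions, both of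
which preserve the depth. -/
theorem Approx.dagger {n p k : ℕ} {f g : RegBeh A n (p + n)} (h : Approx k f g) :
    Approx k (dagger n p f) (dagger n p g) := by
  induction n generalizing p with
  | zero => exact .refl _ _
  | succ n ih =>
    obtain ⟨f', hf, hf0, hfs⟩ := nth_dagger_succ f
    obtain ⟨g', hg, hg0, hgs⟩ := nth_dagger_succ g
    have ih' : Approx k (RegBeh.dagger n (p + 1) f') (RegBeh.dagger n (p + 1) g') := ih fun i => by
      rw [hf, hg]
      exact h _
    have h0 : Beh.Approx k (nth (RegBeh.dagger (n + 1) p f) 0)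
        (nth (RegBeh.dagger (n + 1) p g) 0) := by
      rw [hf0, hg0]
      exact ((h 0).bind (Beh.Approx.feed ih')).mu p
    rintro (_ | i)
    · exact h0
    · rw [hfs, hgs]
      exact (ih' i).bind (Beh.Approx.feed fun _ => h0)

theorem Approx.trace {p q n k : ℕ} {f g : RegBeh A (p + n) (q + n)} (h : Approx k f g) :
    Approx k (trace f) (trace g) :=
  (Approx.refl k _).comp (h.comp (.refl k _)).dagger

theorem dist_le_iff {m n : ℕ} {f g : RegBeh A m n} {r : ℝ} (hr : 0 ≤ r) :
    (dist f g : ℝ) ≤ r ↔ ∀ i, (Beh.bd (nth f i) (nth g i) : ℝ) ≤ r := by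
  have hle : ∀ i : Fin m, Beh.bd (f i).1 (g i).1 ≤ dist f g := fun i =>
    Finset.le_sup (f := fun i => (PMet.bd (Beh.prechart A)).d (f i).1 (g i).1) (Finset.mem_univ i)
  constructor
  · intro h i
    rcases lt_or_ge i m with hi | hi
    · rw [nth_of_lt _ hi, nth_of_lt _ hi]
      exact (Subtype.coe_le_coe.2 (hle _)).trans h
    · rw [nth_of_le _ hi, nth_of_le _ hi, Beh.bd, PMet.refl]
      exact hr
  · intro h
    -- The supremum is formed in the unit interval, which contains `r` only when `r` is at most `1`.
    rcases le_or_gt 1 r with h1 | h1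
    · exact (unitInterval.le_one _).trans h1
    · refine Subtype.coe_le_coe.2 (Finset.sup_le fun i _ => ?_ : dist f g ≤ ⟨r, hr, h1.le⟩)
      have := h i
      rw [nth_of_lt _ i.2, nth_of_lt _ i.2] at this
      exact this

theorem dist_le_iff_approx {m n : ℕ} {f g : RegBeh A m n} {r : ℝ} (hr : 0 ≤ r) :
    (dist f g : ℝ) ≤ r ↔ ∀ k : ℕ, r < (1 / 2) ^ k → Approx (k + 1) f g := by
  simp only [dist_le_iff hr, Beh.bd_le_iff hr]
  exact ⟨fun h k hk i => h i k hk, fun h i k hk => h k hk i⟩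

end RegBeh

namespace IntHom

variable {A : Type*}

open RegBeh (Approx)

theorem approx_comp {X Y Z : ℕ × ℕ} {k : ℕ} {f f' : IntHom A X Y} {g g' : IntHom A Y Z}
    (h : Approx k f f') (h' : Approx k g g') : Approx k (f.comp g) (f'.comp g') :=
  (((Approx.refl k _).comp (h.oplus h')).comp (.refl k _)).trace

theorem approx_tens {X Y Z W : ℕ × ℕ} {k : ℕ} {f f' : IntHom A X Y} {g g' : IntHom A Z W}
    (h : Approx k f f') (h' : Approx k g g') : Approx k (f.tens g) (f'.tens g') :=
  ((Approx.refl k _).comp (h.oplus h')).comp (.refl k _)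

end IntHom

/-! ### A layer of prefixes -/

namespace Word

theorem obj_right (n : ℕ) : (Word.right n).obj = (n, 0) := by
  induction n with
  | zero => rfl
  | succ n ih =>
    change (1, 0) + (Word.right n).obj = _
    rw [ih, Prod.mk_add_mk, Nat.add_comm 1 n]

end Word

namespace Syn

variable {A : Type*}

theorem mem_beta_act (a : A) (e : A × Beh A ⊕ ℕ) :
    e ∈ Beh.beta ((Gen.act a).sem.nth 0) ↔ e = .inl (a, Beh.var 0) := by
  change e ∈ Beh.beta (Beh.mk (Chart.pref a (Chart.var 0))) ↔ _
  have hstart : Beh.mk ((Chart.pref a (Chart.var 0)).at' (some ())) = (Beh.var 0 : Beh A) := by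
    refine Quotient.sound ⟨fun x y => x = some (), ⟨?_, ?_, ?_⟩, rfl⟩
    · rintro _ _ rfl
      rfl
    · rintro _ _ rfl b q h
      simp only [Chart.at', Chart.pref, Chart.var, Finset.image_empty] at h
      exact absurd h (Finset.notMem_empty _)
    · rintro _ _ rfl b q h
      exact absurd h (Finset.notMem_empty _)
  rcases e with ⟨b, y⟩ | v
  · rw [Beh.inl_mem_beta_mk]
    constructor
    · rintro ⟨q, hq, rfl⟩
      obtain ⟨rfl, rfl⟩ := Prod.mk.inj (Finset.mem_singleton.1 hq)
      exact congrArg (fun z => Sum.inl (b, z)) hstart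
    · intro h
      obtain ⟨rfl, rfl⟩ := Prod.mk.inj (Sum.inl.inj h)
      exact ⟨some (), Finset.mem_singleton_self _, hstart⟩
  · rw [Beh.inr_mem_beta_mk]
    exact ⟨fun h => absurd h (Finset.notMem_empty _), fun h => by cases h⟩

theorem mem_beta_acts {m : ℕ} (a : Fin m → A) (i : Fin m) (e : A × Beh A ⊕ ℕ) :
    e ∈ Beh.beta ((acts a).sem.nth i) ↔ e = .inl (a i, Beh.var i) := by
  induction m generalizing e with
  | zero => exact i.elim0
  | succ m ih =>
    have hs : (acts a).sem.nth =
        ((Gen.act (a 0)).sem.tens (acts fun i => a i.succ).sem).nth := by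
      refine (congrArg IntHom.nth (sem_tens (v₁ := [.r]) (w₁ := [.r]) (gen (.act (a 0)))
        (acts fun i => a i.succ))).trans ?_
      rw [IntHom.nth_cast, sem_gen]
    obtain ⟨h1, h2, -, -⟩ := IntHom.nth_tens (Gen.act (a 0)).sem (acts fun i => a i.succ).sem
    have hX : (Word.obj (Word.right m)).1 = m := by rw [Word.obj_right]
    have hX' : (Word.obj (Word.right m)).2 = 0 := by rw [Word.obj_right]
    rw [hs]
    -- The monoidal product only renumbers variables, which turns the behaviour `b.v` into `b.w`.
    have key : ∀ {x : Beh A} {b : A} {v w : ℕ} {ρ : ℕ → ℕ}, ρ v = w →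
        (∀ e, e ∈ Beh.beta x ↔ e = .inl (b, Beh.var v)) →
        ∀ e, e ∈ Beh.beta (x.bind fun v => Beh.var (ρ v)) ↔ e = .inl (b, Beh.var w) := by
      rintro x b v _ ρ rfl hx e
      rw [Beh.mem_beta_bind]
      constructor
      · rintro (⟨c, y, hy, rfl⟩ | ⟨i, hi, _⟩)
        · cases (hx _).1 hy
          rw [Beh.var_bind]
        · cases (hx _).1 hi
      · rintro rfl
        exact Or.inl ⟨b, Beh.var v, (hx _).2 rfl, by rw [Beh.var_bind]⟩
    refine Fin.cases ?_ (fun j => ?_) i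
    · rw [show ((Gen.act (a 0)).sem.tens (acts fun i => a i.succ).sem).nth
        ((0 : Fin (m + 1)) : ℕ) = _ from h1 0 Nat.one_pos]
      refine key ?_ (mem_beta_act (a 0)) e
      rw [IntHom.leftTensVar]
      change (if 0 < 0 then 0 else (Word.obj (Word.right m)).2 + 0) = 0
      rw [hX']
      rfl
    · rw [show ((j.succ : Fin (m + 1)) : ℕ) = (Word.obj [Dir.r]).1 + j from Nat.add_comm _ _,
        h2 j (by rw [hX]; exact j.2)]
      refine key ?_ (ih (fun i => a i.succ) j) e
      rw [IntHom.rightTensVar, if_neg (by omega)]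
      rfl

/-- Component `i` of the composite is the prefix of component `i` of `f` by `aᵢ`. It has this single
transition and no output, so one matched step is put in front. -/
theorem approx_acts_comp {m n k : ℕ} {f g : Syn A (Word.right m) (Word.right n)} (a : Fin m → A)
    (h : RegBeh.Approx k f.sem g.sem) :
    RegBeh.Approx (k + 1) ((acts a).comp f).sem ((acts a).comp g).sem := by
  intro i
  have hn : (Word.right n).obj.2 = 0 := by rw [Word.obj_right]
  have hm : (Word.right m).obj.1 = m := by rw [Word.obj_right]
  have hm' : (Word.right m).obj.2 = 0 := by rw [Word.obj_right]
  rcases lt_or_ge i m with hi | hi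
  · have key : ∀ f : Syn A (Word.right m) (Word.right n), ∀ e,
        e ∈ Beh.beta (((acts a).comp f).sem.nth i) ↔ e = .inl (a ⟨i, hi⟩, f.sem.nth i) := by
      intro f e
      rw [sem_comp, IntHom.nth_comp_of_pos hm' hm' _ _ (hi.trans_eq hm.symm), Beh.mem_beta_bind]
      constructor
      · rintro (⟨b, y, hy, rfl⟩ | ⟨v, hv, _⟩)
        · cases (mem_beta_acts a ⟨i, hi⟩ _).1 hy
          rw [Beh.var_bind]
        · cases (mem_beta_acts a ⟨i, hi⟩ _).1 hv
      · rintro rfl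
        exact Or.inl ⟨_, _, (mem_beta_acts a ⟨i, hi⟩ _).2 rfl, by rw [Beh.var_bind]⟩
    constructor <;> intro e he
    · rw [(key f e).1 he]
      exact ⟨_, (key g _).2 rfl, .inl ⟨rfl, h i⟩⟩
    · rw [(key g e).1 he]
      exact ⟨_, (key f _).2 rfl, .inl ⟨rfl, (h i).symm⟩⟩
  · have key : ∀ f : Syn A (Word.right m) (Word.right n), f.sem.nth i = Beh.zero :=
      fun f => RegBeh.nth_of_le _ (by omega)
    have : Beh.Approx (k + 1) (((acts a).comp f).sem.nth i) (((acts a).comp g).sem.nth i) := by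
      rw [key, key]
      exact .refl _ _
    exact this

end Syn

/-! ### Soundness of the quantitative rules -/

theorem valid_iff {A : Type*} {v w : Word} {f g : Syn A v w} {ε : ℚ≥0} :
    Valid f ε g ↔ ∀ k : ℕ, (ε : ℝ) < (1 / 2) ^ k → RegBeh.Approx (k + 1) f.sem g.sem :=
  RegBeh.dist_le_iff_approx (by positivity)

/-- A sum of bounds is not visible at the level of depths, so this rule uses the triangle inequality
of the behavioural distance in each component. -/
theorem Valid.triang {A : Type*} {v w : Word} {f g h : Syn A v w} {ε₁ ε₂ : ℚ≥0}
    (hfg : Valid f ε₁ g) (hgh : Valid g ε₂ h) : Valid f (ε₁ + ε₂) h := by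
  refine (RegBeh.dist_le_iff (by positivity)).2 fun i => ?_
  have h1 := (RegBeh.dist_le_iff (by positivity)).1 hfg i
  have h2 := (RegBeh.dist_le_iff (by positivity)).1 hgh i
  push_cast
  exact ((PMet.bd (Beh.prechart A)).tri _ _ _).trans (add_le_add h1 h2)

theorem Derivable.valid {A : Type*} {v w : Word} {f g : Syn A v w} {ε : ℚ≥0}
    (h : Derivable f ε g) : Valid f ε g := by
  induction h with
  | pref a _ ih =>
    rw [valid_iff] at ih ⊢
    intro k hk
    refine Syn.approx_acts_comp a ?_
    -- Depth `0` is no condition. Otherwise `ε / 2 < 2⁻ᵏ⁻¹` means `ε < 2⁻ᵏ`, and the hypothesis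
    -- supplies depth `k + 1`.
    rcases k with _ | k
    · exact fun _ => trivial
    · refine ih k ?_
      rw [pow_succ] at hk
      push_cast at hk
      linarith
  | max _ hle ih => exact ih.trans (by exact_mod_cast hle)
  | refl h =>
    rw [valid_iff]
    intro k _
    rw [h.sem_eq]
    exact .refl _ _
  | symm _ ih =>
    rw [valid_iff] at ih ⊢
    exact fun k hk i => (ih k hk i).symm
  | cont _ ih =>
    rw [valid_iff]
    intro k hk
    have hcast : (((1 / 2 : ℚ≥0) ^ k : ℚ≥0) : ℝ) = (1 / 2) ^ k := by
      push_cast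
      rfl
    rw [← hcast, NNRat.cast_lt] at hk
    -- For a given depth one premise is enough, that of a rational strictly between `ε` and `2⁻ᵏ`.
    obtain ⟨ε', h1, h2⟩ := exists_between hk
    exact valid_iff.1 (ih ε' h1) k (by rwa [← hcast, NNRat.cast_lt])
  | triang _ _ ih ih' => exact ih.triang ih'
  | seq _ _ ih ih' =>
    rw [valid_iff] at ih ih' ⊢
    intro k hk
    rw [Syn.sem_comp, Syn.sem_comp]
    exact IntHom.approx_comp
      (ih k (lt_of_le_of_lt (by exact_mod_cast le_sup_left) hk))
      (ih' k (lt_of_le_of_lt (by exact_mod_cast le_sup_right) hk))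
  | top f g => exact (unitInterval.le_one _).trans_eq (by simp)
  | tens _ _ ih ih' =>
    rw [valid_iff] at ih ih' ⊢
    intro k hk
    have := IntHom.approx_tens
      (ih k (lt_of_le_of_lt (by exact_mod_cast le_sup_left) hk))
      (ih' k (lt_of_le_of_lt (by exact_mod_cast le_sup_right) hk))
    rw [Syn.sem_tens, Syn.sem_tens]
    -- The casts change the types of the tuples but not their components, so the comparison is made
    -- component by component.
    intro i
    have := this i
    rw [← IntHom.nth, ← IntHom.nth] at this ⊢
    rwa [IntHom.nth_cast, IntHom.nth_cast]
  | @codel m n d =>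
    rw [valid_iff]
    intro k _
    have hn : (Word.right n).obj.2 = 0 := by rw [Word.obj_right]
    rw [(SynEq.isFull_of_no_entry hn (Syn.generates n)).unique
      (SynEq.isFull_of_no_entry hn ((Syn.generates m).comp d))]
    exact .refl _ _

theorem mainTheorem2 (A : Type*) :
    (∀ (v w : Word) (t : Term A v w), (Syn.mk t).sem = t.sem) ∧
      ∀ (v w : Word) (f g : Syn A v w) (ε : ℚ≥0), Derivable f ε g → Valid f ε g :=
  ⟨fun _ _ t => Syn.sem_mk t, fun _ _ _ _ _ h => h.valid⟩
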